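/- Let $\mathbb F$ be a field of characteristic $0$, let $\ell_1,\ell_2\ge 1$ be integers, $k_1=2\ell_1$, $k_2=2\ell_2$, $k=k_1+k_2$, and let $\mathbb N=\{0,1,2,\dots\}$. **Conformal superalgebras.** A conformal superalgebra is a $\mathbb Z_2$-graded $\mathbb F[\partial]$-module $R=R_0\oplus R_1$ with a $\mathbb Z_2$-graded linear map $Y^+(u,z)=\sum_{n\ge 0}u_nz^{-n-1}$, where $Y^+(u,z)v\in R[z^{-1}]z^{-1}$, such that for $u\in R_i$, $v\in R_j$: $Y^+(\partial u,z)=\frac{d}{dz}Y^+(u,z)$; $\;Y^+(u,z)v=(-1)^{ij}\operatorname{Res}_x\frac{e^{x\partial}Y^+(v,-x)u}{z-x}$; and $Y^+(u,z_1)Y^+(v,z_2)-(-1)^{ij}Y^+(v,z_2)Y^+(u,z_1)=\operatorname{Res}_x\frac{Y^+(Y^+(u,z_1-x)v,x)}{z_2-x}$ (expansions in nonnegative powers of the second variable). An ideal is a subspace $I$ with $\partial I\subset I$ and $u_nI\subset I$ for all $u\in R$, $n\in\mathbb N$; $R$ is simple if its only ideals are $\{0\}$ and $R$. $R$ is generated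 by a subset $X$ if $R$ is the span of all $u^1_{m_1}\cdots u^p_{m_p}v$ with $u^j,v\in X$ and $p,m_j\in\mathbb N$. **The algebra $R(\mathcal A)$.** Let $\mathcal A=M_{k\times k}(\mathbb F)$, with rows and columns divided into the first $k_1$ indices (parity $0$) and the last $k_2$ indices (parity $1$). For $i,j\in\mathbb Z_2$ let $\mathcal A^{(i,j)}$ be the space of matrices supported on rows of parity $i$ and columns of parity $j$, and put $\mathcal A_0=\mathcal A^{(0,0)}\oplus\mathcal A^{(1,1)}$, $\mathcal A_1=\mathcal A^{(0,1)}\oplus\mathcal A^{(1,0)}$. For $u\in\mathcal A_{i+j}$ and $m,n\in\mathbb N$ let $u_{[i,j]}(m,n)$ be the $2\times2$ matrix with $u$ in position $(i,j)$ and zeros elsewhere, tensored with $t_1^mt_2^n$, and let $R(\mathcal A)$ be the span of these elements; $u_{[i,j]}(m,n)$ has parity $i+j$ and weight $m+n+\delta_{i,0}+\delta_{j,0}+\frac12(\delta_{i,1}+\delta_{j,1})$. Put $\partial u_{[i,j]}(m,n)=(m+1)u_{[i,j]}(m+1,n)+(n+1)u_{[i,j]}(m,n+1)$ and $$\begin{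aligned}&Y^+(u_{[i_1,i_2]}(m_1,m_2),z)\,v_{[j_1,j_2]}(n_1,n_2)\\&=\delta_{i_2,j_1}(n_1\delta_{i_2,0}+1)\tbinom{-n_1-1-\delta_{i_2,0}}{m_2}\sum_{p=0}^{m_1+m_2+n_1+\delta_{i_2,0}}\tbinom{p}{m_1}(uv)_{[i_1,j_2]}(p,n_2)\,z^{p-m_1-m_2-n_1-1-\delta_{i_2,0}}\\&\quad-(-1)^{(i_1+i_2)(j_1+j_2)}\delta_{i_1,j_2}(\delta_{i_1,1}-(n_2+1)\delta_{i_1,0})\tbinom{-n_2-1-\delta_{i_1,0}}{m_1}\\&\qquad\cdot\sum_{q=0}^{m_1+m_2+n_2+\delta_{i_1,0}}\tbinom{q}{m_2}(vu)_{[j_1,i_2]}(n_1,q)\,z^{q-m_1-m_2-n_2-1-\delta_{i_1,0}}.\end{aligned}$$ **The subalgebra.** Let $S=\operatorname{diag}\left(\begin{pmatrix}0&I_{\ell_1}\\-I_{\ell_1}&0\end{pmatrix},\begin{pmatrix}0&I_{\ell_2}\\-I_{\ell_2}&0\end{pmatrix}\right)$ and $\sigma_2(A)=SA^tS^{-1}$.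 Put $$R^\dagger_{[k_1,k_2]}=\operatorname{span}\{u_{[i,j]}(m,n)+(-1)^{ij}\sigma_2(u)_{[j,i]}(n,m)\mid i,j\in\mathbb Z_2,\ u\in\mathcal A^{(i,j)},\ m,n\in\mathbb N\},$$ graded by the parity $i+j$, and let $(R^\dagger_{[k_1,k_2]})^{(3/2)}$ be its subspace of weight $3/2$. **Theorem.** With the operations of $R(\mathcal A)$, $R^\dagger_{[k_1,k_2]}$ is a ($\mathbb Z_2$-graded) sub-superspace of $R(\mathcal A)$ which is a conformal superalgebra, and it is simple. If $k>4$, it is generated by $(R^\dagger_{[k_1,k_2]})^{(3/2)}$. If $k=4$, it is generated by $(R^\dagger_{[k_1,k_2]})^{(3/2)}+\mathbb F\big[(E_{3,3})_{[1,1]}(0,1)-(E_{4,4})_{[1,1]}(1,0)\big]$, where $E_{p,q}$ are the matrix units. -/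

import Mathlib

/-! ### Conformal superalgebras in component form

A conformal superalgebra is described inside an ambient vector space `V` carrying a linear map `D`
(the derivation `∂`) and bilinear products `Y n`, `n ∈ ℕ`, where `Y n u v = u_n v` and
`Y⁺(u,z) = ∑_{n ≥ 0} u_n z^{-n-1}`. -/

section General

variable {F V : Type*} [Field F] [AddCommGroup V] [Module F V]

/-- The sign `(-1)^{ij}` for `i, j ∈ ℤ/2`. -/
def superSign (F : Type*) [Field F] (i j : ZMod 2) : F := (-1) ^ (i * j).val

/-- `(R 0 ⊕ R 1, D, Y)` is a conformal superalgebra with even part `R 0` and odd part `R 1`. -/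
structure IsConformalSuperalgebra (D : V →ₗ[F] V) (Y : ℕ → V →ₗ[F] V →ₗ[F] V)
    (R : ZMod 2 → Submodule F V) : Prop where
  /-- the sum of the even and the odd part is direct -/
  disjoint : Disjoint (R 0) (R 1)
  /-- the parts are `F[∂]`-submodules -/
  map_D : ∀ i, ∀ u ∈ R i, D u ∈ R i
  /-- the products respect the `ℤ/2`-grading -/
  map_Y : ∀ i j, ∀ u ∈ R i, ∀ v ∈ R j, ∀ n, Y n u v ∈ R (i + j)
  /-- `Y⁺(u,z)v` is a polynomial in `z⁻¹` -/
  finite : ∀ u ∈ R 0 ⊔ R 1, ∀ v ∈ R 0 ⊔ R 1, ∃ N, ∀ n ≥ N, Y n u v = 0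
  /-- `Y⁺(∂u,z) = d/dz Y⁺(u,z)`, the coefficient of `z^{-1}` -/
  deriv_zero : ∀ u ∈ R 0 ⊔ R 1, ∀ v ∈ R 0 ⊔ R 1, Y 0 (D u) v = 0
  /-- `Y⁺(∂u,z) = d/dz Y⁺(u,z)`, the coefficient of `z^{-n-2}` -/
  deriv_succ : ∀ u ∈ R 0 ⊔ R 1, ∀ v ∈ R 0 ⊔ R 1, ∀ n : ℕ,
    Y (n + 1) (D u) v = -((n : F) + 1) • Y n u v
  /-- `Y⁺(u,z)v = (-1)^{ij} Res_x e^{x∂} Y⁺(v,-x)u / (z-x)`; `N` is any bound beyond which the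
  products `v_m u` vanish, so that the sum contains all nonzero terms -/
  skew : ∀ i j, ∀ u ∈ R i, ∀ v ∈ R j, ∀ n N : ℕ, (∀ m ≥ N, Y m v u = 0) →
    Y n u v = superSign F i j • ∑ r ∈ Finset.range N,
      ((-1 : F) ^ (n + r + 1) * ((r.factorial : F))⁻¹) • (D ^ r) (Y (n + r) v u)
  /-- the commutator formula
  `Y⁺(u,z₁)Y⁺(v,z₂) - (-1)^{ij} Y⁺(v,z₂)Y⁺(u,z₁) = Res_x Y⁺(Y⁺(u,z₁-x)v,x)/(z₂-x)` -/
  jacobi : ∀ i j, ∀ u ∈ R i, ∀ v ∈ R j, ∀ w ∈ R 0 ⊔ R 1, ∀ m n : ℕ,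
    Y m u (Y n v w) - superSign F i j • Y n v (Y m u w) =
      ∑ r ∈ Finset.range (m + 1), (m.choose r : F) • Y (m + n - r) (Y r u v) w

/-- Ideals of a conformal superalgebra with underlying space `R`: subspaces, not assumed to be
graded, stable under `∂` and under all products with elements of `R` on the left. -/
structure IsConformalIdeal (D : V →ₗ[F] V) (Y : ℕ → V →ₗ[F] V →ₗ[F] V)
    (R I : Submodule F V) : Prop where
  le : I ≤ R
  map_D : ∀ v ∈ I, D v ∈ I
  map_Y : ∀ u ∈ R, ∀ v ∈ I, ∀ n, Y n u v ∈ I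

/-- Simplicity: the only ideals are `{0}` and `R`. -/
def IsConformallySimple (D : V →ₗ[F] V) (Y : ℕ → V →ₗ[F] V →ₗ[F] V) (R : Submodule F V) : Prop :=
  ∀ I : Submodule F V, IsConformalIdeal D Y R I → I = ⊥ ∨ I = R

/-- The monomials `u¹_{m₁} ⋯ uᵖ_{mₚ} v` with `uʲ, v ∈ S` and `p, mⱼ ∈ ℕ`. -/
inductive IsMonomial (Y : ℕ → V →ₗ[F] V →ₗ[F] V) (S : Set V) : V → Prop
  | base (v : V) : v ∈ S → IsMonomial Y S v
  | step (u w : V) (m : ℕ) : u ∈ S → IsMonomial Y S w → IsMonomial Y S (Y m u w)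

/-- `R` is generated by `S`: it is the span of all the monomials in elements of `S`. -/
def IsGeneratedBy (Y : ℕ → V →ₗ[F] V →ₗ[F] V) (R : Submodule F V) (S : Set V) : Prop :=
  R = Submodule.span F {w | IsMonomial Y S w}

end General

/-! ### The conformal superalgebra `R(𝒜)` of a `ℤ/2`-graded associative algebra -/

section Construction

/-- The index set of the monomials `e_{i,j} ⊗ t₁^m t₂^n`, written `(i, j, m, n)`. -/
abbrev DIdx : Type := ZMod 2 × ZMod 2 × ℕ × ℕ

/-- `M_{2×2}(A) ⊗ F[t₁,t₂]`, with rows and columns of the `2 × 2` matrices indexed by `ℤ/2`. -/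
abbrev DSpace (A : Type*) [Ring A] : Type _ := DIdx →₀ A

variable (F : Type*) {A : Type*} [Field F] [Ring A] [Algebra F A]

/-- `u_{[i,j]}(m,n)`: the `2 × 2` matrix with `u` in position `(i,j)`, times `t₁^m t₂^n`. -/
noncomputable def elt (i j : ZMod 2) (u : A) (m n : ℕ) : DSpace A :=
  Finsupp.single (i, j, m, n) u

/-- `δ_{i,0}` -/
def d0 (i : ZMod 2) : ℕ := if i = 0 then 1 else 0

/-- `δ_{i,1}` -/
def d1 (i : ZMod 2) : ℕ := if i = 1 then 1 else 0

/-- Coefficient of `(uv)_{[i₁,j₂]}(N - n, n₂)` in the `n`-th product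
`(u_{[i₁,i₂]}(m₁,m₂))_n v_{[j₁,j₂]}(n₁,n₂)`, where `N = m₁ + m₂ + n₁ + δ_{i₂,0}`. -/
def coeffLeft (i₂ j₁ : ZMod 2) (m₁ m₂ n₁ n : ℕ) : ℤ :=
  if i₂ = j₁ ∧ n ≤ m₁ + m₂ + n₁ + d0 i₂ then
    ((n₁ : ℤ) * d0 i₂ + 1) * Ring.choose (-(n₁ : ℤ) - 1 - d0 i₂) m₂ *
      ((m₁ + m₂ + n₁ + d0 i₂ - n).choose m₁ : ℤ)
  else 0

/-- Coefficient of `(vu)_{[j₁,i₂]}(n₁, N' - n)` in the `n`-th product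
`(u_{[i₁,i₂]}(m₁,m₂))_n v_{[j₁,j₂]}(n₁,n₂)`, where `N' = m₁ + m₂ + n₂ + δ_{i₁,0}`. -/
def coeffRight (i₁ i₂ j₁ j₂ : ZMod 2) (m₁ m₂ n₂ n : ℕ) : ℤ :=
  if i₁ = j₂ ∧ n ≤ m₁ + m₂ + n₂ + d0 i₁ then
    -(-1) ^ ((i₁ + i₂) * (j₁ + j₂)).val * ((d1 i₁ : ℤ) - ((n₂ : ℤ) + 1) * d0 i₁) *
      Ring.choose (-(n₂ : ℤ) - 1 - d0 i₁) m₁ *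
      ((m₁ + m₂ + n₂ + d0 i₁ - n).choose m₂ : ℤ)
  else 0

/-- The bilinear map `(u, v) ↦ (u_{[i₁,i₂]}(m₁,m₂))_n v_{[j₁,j₂]}(n₁,n₂)`, the coefficient of
`z^{-n-1}` in `Y⁺(u_{[i₁,i₂]}(m₁,m₂), z) v_{[j₁,j₂]}(n₁,n₂)`. -/
noncomputable def eltProd (n : ℕ) : DIdx → DIdx → A →ₗ[F] A →ₗ[F] DSpace A
  | (i₁, i₂, m₁, m₂), (j₁, j₂, n₁, n₂) =>
    coeffLeft i₂ j₁ m₁ m₂ n₁ n •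
        (LinearMap.mul F A).compr₂
          (Finsupp.lsingle (i₁, j₂, m₁ + m₂ + n₁ + d0 i₂ - n, n₂)) +
      coeffRight i₁ i₂ j₁ j₂ m₁ m₂ n₂ n •
        (LinearMap.mul F A).flip.compr₂
          (Finsupp.lsingle (j₁, i₂, n₁, m₁ + m₂ + n₂ + d0 i₁ - n))

/-- The `n`-th product `u_n v`, by bilinear extension. -/
noncomputable def modeProd (n : ℕ) : DSpace A →ₗ[F] DSpace A →ₗ[F] DSpace A :=
  Finsupp.lsum F fun a => (Finsupp.lsum F fun b => (eltProd F n a b).flip).flip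

/-- The derivation
`∂ u_{[i,j]}(m,n) = (m+1) u_{[i,j]}(m+1,n) + (n+1) u_{[i,j]}(m,n+1)`. -/
noncomputable def dd : DSpace A →ₗ[F] DSpace A :=
  Finsupp.lsum F fun
    | (i, j, m, n) => (m + 1) • Finsupp.lsingle (i, j, m + 1, n) +
        (n + 1) • Finsupp.lsingle (i, j, m, n + 1)

theorem modeProd_elt (n : ℕ) (i₁ i₂ j₁ j₂ : ZMod 2) (m₁ m₂ n₁ n₂ : ℕ) (u v : A) :
    modeProd F n (elt i₁ i₂ u m₁ m₂) (elt j₁ j₂ v n₁ n₂) =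
      coeffLeft i₂ j₁ m₁ m₂ n₁ n • elt i₁ j₂ (u * v) (m₁ + m₂ + n₁ + d0 i₂ - n) n₂ +
      coeffRight i₁ i₂ j₁ j₂ m₁ m₂ n₂ n •
        elt j₁ i₂ (v * u) n₁ (m₁ + m₂ + n₂ + d0 i₁ - n) := by
  simp [modeProd, elt, eltProd]

theorem dd_elt (i j : ZMod 2) (m n : ℕ) (u : A) :
    dd F (elt i j u m n) = (m + 1) • elt i j u (m + 1) n + (n + 1) • elt i j u m (n + 1) := by
  simp [dd, elt]

variable (𝒜 : ZMod 2 → Submodule F A)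

/-- The even (`s = 0`) and odd (`s = 1`) part of `R(𝒜) = 𝒩(𝒜) ⊗ F[t₁,t₂]`, spanned by the
`u_{[i,j]}(m,n)` with `u ∈ 𝒜_{i+j}` and `i + j = s`. -/
noncomputable def RPart (s : ZMod 2) : Submodule F (DSpace A) :=
  Submodule.span F {x | ∃ (i j : ZMod 2) (u : A) (m n : ℕ),
    i + j = s ∧ u ∈ 𝒜 (i + j) ∧ x = elt i j u m n}

/-- The subspace `R(𝒜)^{(w)}` of weight `w`, spanned by the `u_{[i,j]}(m,n)` with
`u ∈ 𝒜_{i+j}` and `m + n + δ_{i,0} + δ_{j,0} + (δ_{i,1} + δ_{j,1})/2 = w`. -/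
noncomputable def RWeight (w : ℚ) : Submodule F (DSpace A) :=
  Submodule.span F {x | ∃ (i j : ZMod 2) (u : A) (m n : ℕ), u ∈ 𝒜 (i + j) ∧
    (m : ℚ) + n + d0 i + d0 j + ((d1 i : ℚ) + d1 j) / 2 = w ∧ x = elt i j u m n}

end Construction

/-! ### The sub-superalgebra `R†_{[2ℓ₁,2ℓ₂]}` -/

section Dagger

/-- The row and column indices `1, …, k` with `k = k₁ + k₂`, `k₁ = 2ℓ₁`, `k₂ = 2ℓ₂`, cut into
four consecutive blocks of lengths `ℓ₁, ℓ₁, ℓ₂, ℓ₂`. -/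
abbrev KIdx (ℓ₁ ℓ₂ : ℕ) : Type := (Fin ℓ₁ ⊕ Fin ℓ₁) ⊕ (Fin ℓ₂ ⊕ Fin ℓ₂)

/-- `0` for the first `k₁` indices, `1` for the last `k₂` indices. -/
def idxParity {ℓ₁ ℓ₂ : ℕ} : KIdx ℓ₁ ℓ₂ → ZMod 2
  | Sum.inl _ => 0
  | Sum.inr _ => 1

variable (F : Type*) [Field F] (ℓ₁ ℓ₂ : ℕ)

/-- The algebra `M_{k×k}(F)`. -/
abbrev MatK : Type _ := Matrix (KIdx ℓ₁ ℓ₂) (KIdx ℓ₁ ℓ₂) F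

/-- The matrices whose nonzero entries lie in the block with rows of parity `i` and columns of
parity `j`, for the division of `1, …, k` into the first `k₁` and the last `k₂` indices. -/
def matBlock (i j : ZMod 2) : Submodule F (MatK F ℓ₁ ℓ₂) where
  carrier := {M | ∀ p q, M p q ≠ 0 → idxParity p = i ∧ idxParity q = j}
  zero_mem' := by intro p q h; exact absurd rfl h
  add_mem' := by
    intro M N hM hN p q h
    by_cases h1 : M p q = 0
    · exact hN p q fun h2 => h (by simp [h1, h2])
    · exact hM p q h1
  smul_mem' := by
    intro c M hM p q h
    exact hM p q fun h2 => h (by simp [h2])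

/-- The `ℤ/2`-grading of `M_{k×k}(F)`: block-diagonal matrices are even, block-off-diagonal
matrices are odd. -/
def matGrading : ZMod 2 → Submodule F (MatK F ℓ₁ ℓ₂) := fun s =>
  ⨆ i : ZMod 2, matBlock F ℓ₁ ℓ₂ i (i + s)

/-- The matrix `S`, block diagonal with blocks `(0, I; -I, 0)` of sizes `2ℓ₁` and `2ℓ₂`. -/
def matS : MatK F ℓ₁ ℓ₂ :=
  Matrix.fromBlocks (Matrix.fromBlocks 0 1 (-1) 0) 0 0 (Matrix.fromBlocks 0 1 (-1) 0)

/-- `σ₂(A) = S Aᵗ S⁻¹`. -/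
noncomputable def sigma2 (M : MatK F ℓ₁ ℓ₂) : MatK F ℓ₁ ℓ₂ :=
  matS F ℓ₁ ℓ₂ * M.transpose * (matS F ℓ₁ ℓ₂)⁻¹

/-- The even (`s = 0`) and odd (`s = 1`) part of `R†_{[k₁,k₂]}`, spanned by the elements
`u_{[i,j]}(m,n) + (-1)^{ij} σ₂(u)_{[j,i]}(n,m)` with `i + j = s` and `u` in the block `(i,j)`. -/
noncomputable def RDaggerPart (s : ZMod 2) : Submodule F (DSpace (MatK F ℓ₁ ℓ₂)) :=
  Submodule.span F {x | ∃ (i j : ZMod 2) (u : MatK F ℓ₁ ℓ₂) (m n : ℕ),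
    i + j = s ∧ u ∈ matBlock F ℓ₁ ℓ₂ i j ∧
    x = elt i j u m n + superSign F i j • elt j i (sigma2 F ℓ₁ ℓ₂ u) n m}

/-- `R†_{[k₁,k₂]} = (R†_{[k₁,k₂]})₀ + (R†_{[k₁,k₂]})₁`. -/
noncomputable def RDagger : Submodule F (DSpace (MatK F ℓ₁ ℓ₂)) :=
  RDaggerPart F ℓ₁ ℓ₂ 0 ⊔ RDaggerPart F ℓ₁ ℓ₂ 1

/-- The weight subspaces `(R†_{[k₁,k₂]})^{(w)}`. -/
noncomputable def RDaggerWeight (w : ℚ) : Submodule F (DSpace (MatK F ℓ₁ ℓ₂)) :=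
  RDagger F ℓ₁ ℓ₂ ⊓ RWeight F (matGrading F ℓ₁ ℓ₂) w

/-- The even element
`(E_{k₁+1,k₁+1})_{[1,1]}(0,1) - (E_{k₁+ℓ₂+1,k₁+ℓ₂+1})_{[1,1]}(1,0)`; for `k₁ = k₂ = 2` it is
`(E_{3,3})_{[1,1]}(0,1) - (E_{4,4})_{[1,1]}(1,0)`. -/
noncomputable def extraElt (h₂ : 0 < ℓ₂) : DSpace (MatK F ℓ₁ ℓ₂) :=
  elt 1 1 (Matrix.single (Sum.inr (Sum.inl ⟨0, h₂⟩)) (Sum.inr (Sum.inl ⟨0, h₂⟩)) (1 : F)) 0 1 -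
  elt 1 1 (Matrix.single (Sum.inr (Sum.inr ⟨0, h₂⟩)) (Sum.inr (Sum.inr ⟨0, h₂⟩)) (1 : F)) 1 0

end Dagger

/-! ### Identities for falling factorials -/

section FallingFactorials

open Finset Nat

/-! Multiplied by m! n!, the monomial u_{[i,j]}(m,n) becomes `mono i j u m n`. In this normalisation
every structure constant is a sign times a falling factorial, and ∂ is multiplication by t₁ + t₂. On
homogeneous arguments the n-th product is `leftProd` minus a sign times `rightProd`, a kind of
supercommutator.

The commutator formula splits accordingly. Left multiplications compose among themselves, and so do
right ones, by Vandermonde's identity and an alternating variant of it; left and right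
multiplications commute, so the cross terms cancel (`modeProd_jacobi`). Skew-symmetry exchanges the
two halves and is a Taylor expansion in the commuting operators t₁ and t₂
(`sum_descFactorial_taylor`). None of this restricts the coefficient u, so any pair of subspaces of
the two parities closed under ∂ and the products is a conformal superalgebra
(`isConformalSuperalgebra_of_le`). Since σ₂ is an involutive anti-automorphism, `twist` is an
involutive automorphism τ exchanging the halves (`twist_modeProd`), and R† is the image of 1 + τ on
the block-compatible elements; hence it is closed.

R† is spanned by the `daggerElt`s, and a product of two of them has at most four terms. Generation
is proved by choosing products in which all terms but one vanish or are already available.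
`RDagger_le_of_forall_mem` reduces everything to the elements with an even index of exponent 0 and
an odd index of arbitrary exponent. For k > 4 a spare pair of indices allows exponents to be raised;
for k = 4 the extra generator does this. The commutator formula shows that the span of the monomials
is closed under products (`span_isMonomial_closed`).

For simplicity, a nonzero ideal contains a nonzero vector of minimal weight bound, killed by the
first products with the elements of exponents 0 having an odd second index. Reading off coordinates,
such a vector is supported on odd indices with exponents 0 (`isOddConstant_of_lowest`), where zeroth
products are the adjoint action of the symplectic Lie algebra of rank ℓ₂. Applying a long root
vector twice isolates that root vector, up to a scalar (`exists_unitMono_mem`), and from it the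
ideal recovers all the elements required by `RDagger_le_of_forall_mem`. -/

theorem descFactorial_add_eq_sum (a b m : ℕ) :
    (a + b).descFactorial m =
      ∑ r ∈ range (m + 1), m.choose r * (a.descFactorial r * b.descFactorial (m - r)) := by
  rw [Nat.descFactorial_eq_factorial_mul_choose, Nat.add_choose_eq,
    Finset.Nat.sum_antidiagonal_eq_sum_range_succ (fun i j => a.choose i * b.choose j), mul_sum]
  refine sum_congr rfl fun r hr => ?_
  have hr' : r ≤ m := by simpa [Nat.lt_succ_iff] using hr
  rw [Nat.descFactorial_eq_factorial_mul_choose, Nat.descFactorial_eq_factorial_mul_choose,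
    ← Nat.choose_mul_factorial_mul_factorial hr']
  ring

/-- Leibniz's rule for the m-th derivative of x^a times the n-th derivative of x^b, compared on
coefficients. Splitting off the first n factors of each falling factorial of b leaves Vandermonde
for a and b - n. -/
theorem sum_choose_mul_descFactorial (a b m n : ℕ) :
    ∑ r ∈ range (m + 1), m.choose r * (a.descFactorial r * b.descFactorial (m + n - r)) =
      b.descFactorial n * (a + b - n).descFactorial m := by
  rcases lt_or_ge b n with h | h
  · rw [Nat.descFactorial_of_lt h, zero_mul]
    refine sum_eq_zero fun r hr => ?_
    have hr' : r ≤ m := by simpa [Nat.lt_succ_iff] using hr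
    rw [Nat.descFactorial_of_lt (show b < m + n - r by omega)]; simp
  · rw [Nat.add_sub_assoc h, descFactorial_add_eq_sum, mul_sum]
    refine sum_congr rfl fun r hr => ?_
    have hr' : r ≤ m := by simpa [Nat.lt_succ_iff] using hr
    rw [← Nat.descFactorial_mul_descFactorial (show n ≤ m + n - r by omega),
      show m + n - r - n = m - r by omega]
    ring

/-- Inclusion–exclusion: the m-subsets of a set of a + b points that avoid a given ones. The
induction on a uses Pascal's rule. -/
theorem sum_alternating_choose_mul_choose (a b m : ℕ) :
    ∑ r ∈ range (m + 1), (-1 : ℤ) ^ r * (a.choose r * (a + b - r).choose (m - r)) =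
      b.choose m := by
  induction a generalizing b m with
  | zero => rw [sum_range_succ']; simp
  | succ a ih =>
    cases m with
    | zero => simp
    | succ m =>
      rw [sum_range_succ']
      have h1 := ih (b + 1) (m + 1)
      have h2 := ih b m
      rw [sum_range_succ'] at h1
      rw [Nat.choose_succ_succ] at h1
      have e : ∀ r ∈ range (m + 1), (-1 : ℤ) ^ (r + 1) *
          (((a + 1).choose (r + 1) : ℕ) * ((a + 1 + b - (r + 1)).choose (m + 1 - (r + 1)) : ℕ)) =
          (-1 : ℤ) ^ (r + 1) * ((a.choose (r + 1) : ℕ) *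
            ((a + (b + 1) - (r + 1)).choose (m + 1 - (r + 1)) : ℕ)) -
          (-1 : ℤ) ^ r * ((a.choose r : ℕ) * ((a + b - r).choose (m - r) : ℕ)) := by
        intro r _
        rw [show a + 1 + b - (r + 1) = a + b - r by omega,
          show a + (b + 1) - (r + 1) = a + b - r by omega,
          show m + 1 - (r + 1) = m - r by omega, Nat.choose_succ_succ]
        push_cast; ring
      rw [sum_congr rfl e, sum_sub_distrib, h2]
      simp only [Nat.sub_zero, pow_zero, Nat.choose_zero_right, Nat.cast_one, one_mul] at h1 ⊢
      rw [show a + 1 + b = a + (b + 1) by omega]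
      push_cast at h1 ⊢
      linarith

theorem sum_alternating_descFactorial (a b m n : ℕ) :
    ∑ r ∈ range (m + 1), (m.choose r : ℤ) * ((-1) ^ r *
      (a.descFactorial r * (a + b - r).descFactorial (m + n - r))) =
      b.descFactorial m * (a + b - m).descFactorial n := by
  rw [Nat.descFactorial_eq_factorial_mul_choose b m, Nat.cast_mul,
    ← sum_alternating_choose_mul_choose a b m, mul_sum, sum_mul]
  refine sum_congr rfl fun r hr => ?_
  have hr' : r ≤ m := by simpa [Nat.lt_succ_iff] using hr
  rw [← Nat.descFactorial_mul_descFactorial (show m - r ≤ m + n - r by omega),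
      show m + n - r - (m - r) = n by omega, show a + b - r - (m - r) = a + b - m by omega,
      Nat.descFactorial_eq_factorial_mul_choose a, Nat.descFactorial_eq_factorial_mul_choose _ (m - r),
      ← Nat.choose_mul_factorial_mul_factorial hr']
  push_cast
  ring

/-- This converts the binomials in p and q of the defining formula into falling factorials. For n >
b both sides vanish. -/
theorem choose_mul_factorial_mul_factorial_eq_descFactorial (a b n : ℕ) (h : n ≤ a + b) :
    (a + b - n).choose a * (a.factorial * b.factorial) =
      (a + b - n).factorial * b.descFactorial n := by
  rcases lt_or_ge b n with h' | h'
  · rw [Nat.descFactorial_of_lt h', Nat.choose_eq_zero_of_lt (by omega)]; simp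
  · have h1 := Nat.choose_mul_factorial_mul_factorial (show a ≤ a + b - n by omega)
    rw [show a + b - n - a = b - n by omega] at h1
    rw [← Nat.factorial_mul_descFactorial h', ← h1]
    ring

theorem ring_choose_neg_natCast (a m : ℕ) :
    Ring.choose (-(a : ℤ) - 1) m = (-1) ^ m * ((a + m).choose m : ℤ) := by
  have := Ring.choose_neg ((a : ℤ) + 1) m
  rw [show -((a : ℤ) + 1) = -(a : ℤ) - 1 by ring,
    show ((a : ℤ) + 1 + m - 1) = ((a + m : ℕ) : ℤ) by push_cast; ring, Ring.choose_natCast] at this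
  rw [this, Units.smul_def, Int.negOnePow_def]
  simp

end FallingFactorials

/-! ### Normalised monomials and the two halves of the product -/

section Products

variable (F : Type*) {A : Type*} [Field F] [Ring A] [Algebra F A]

/-- The multiple `m! n! u_{[i,j]}(m,n)`, for which all structure constants are integral. -/
noncomputable def mono (i j : ZMod 2) (u : A) (m n : ℕ) : DSpace A :=
  ((m.factorial * n.factorial : ℕ) : ℤ) • elt i j u m n

theorem mono_add (i j : ZMod 2) (u v : A) (m n : ℕ) :
    mono i j (u + v) m n = mono i j u m n + mono i j v m n := by
  simp [mono, elt, smul_add]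

theorem smul_mono (c : F) (i j : ZMod 2) (u : A) (m n : ℕ) :
    mono i j (c • u) m n = c • mono i j u m n := by
  rw [mono, mono, smul_comm, elt, elt, ← Finsupp.smul_single]

theorem elt_eq_mono [CharZero F] (i j : ZMod 2) (u : A) (m n : ℕ) :
    elt i j u m n = mono i j (((m.factorial * n.factorial : ℕ) : F)⁻¹ • u) m n := by
  have h : ((m.factorial * n.factorial : ℕ) : F) ≠ 0 := by
    exact_mod_cast (Nat.mul_pos (Nat.factorial_pos _) (Nat.factorial_pos _)).ne'
  rw [smul_mono, mono, ← Int.cast_smul_eq_zsmul F, smul_smul]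
  rw [Int.cast_natCast, inv_mul_cancel₀ h, one_smul]

theorem DSpace.induction_mono (F : Type*) [Field F] [CharZero F] [Algebra F A]
    {p : DSpace A → Prop} (x : DSpace A) (h0 : p 0)
    (hadd : ∀ x y, p x → p y → p (x + y)) (hm : ∀ i j u m n, p (mono i j u m n)) : p x := by
  induction x using Finsupp.induction_linear with
  | zero => exact h0
  | add x y hx hy => exact hadd x y hx hy
  | single d u =>
    obtain ⟨i, j, m, n⟩ := d
    have := elt_eq_mono F i j u m n
    rw [elt] at this
    rw [this]; exact hm _ _ _ _ _

/-- The part of the `n`-th product that contracts the second index of the left factor with the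
first index of the right factor. -/
noncomputable def leftProd (n : ℕ) : DSpace A →ₗ[F] DSpace A →ₗ[F] DSpace A :=
  Finsupp.lsum F fun a => (Finsupp.lsum F fun b =>
    (coeffLeft a.2.1 b.1 a.2.2.1 a.2.2.2 b.2.2.1 n •
        (LinearMap.mul F A).compr₂
          (Finsupp.lsingle (a.1, b.2.1, a.2.2.1 + a.2.2.2 + b.2.2.1 + d0 a.2.1 - n, b.2.2.2))).flip).flip

/-- The part of the `n`-th product that contracts the first index of the left factor with the
second index of the right factor, without the sign `-(-1)^{|u||v|}`. -/
noncomputable def rightProd (n : ℕ) : DSpace A →ₗ[F] DSpace A →ₗ[F] DSpace A :=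
  Finsupp.lsum F fun a => (Finsupp.lsum F fun b =>
    ((-(-1) ^ ((a.1 + a.2.1) * (b.1 + b.2.1)).val *
      coeffRight a.1 a.2.1 b.1 b.2.1 a.2.2.1 a.2.2.2 b.2.2.2 n : ℤ) •
        (LinearMap.mul F A).flip.compr₂
          (Finsupp.lsingle
            (b.1, a.2.1, b.2.2.1, a.2.2.1 + a.2.2.2 + b.2.2.2 + d0 a.1 - n))).flip).flip

theorem modeProd_elt_eq (n : ℕ) (i₁ i₂ j₁ j₂ : ZMod 2) (m₁ m₂ n₁ n₂ : ℕ) (u v : A) :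
    modeProd F n (elt i₁ i₂ u m₁ m₂) (elt j₁ j₂ v n₁ n₂) =
      leftProd F n (elt i₁ i₂ u m₁ m₂) (elt j₁ j₂ v n₁ n₂) -
        superSign F (i₁ + i₂) (j₁ + j₂) •
          rightProd F n (elt i₁ i₂ u m₁ m₂) (elt j₁ j₂ v n₁ n₂) := by
  have h : (superSign F (i₁ + i₂) (j₁ + j₂)) * (superSign F (i₁ + i₂) (j₁ + j₂)) = 1 := by
    rw [superSign, ← mul_pow]; simp
  rw [modeProd_elt]
  simp only [leftProd, rightProd, elt, Finsupp.lsum_apply, LinearMap.flip_apply, map_zero,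
    Finsupp.sum_single_index, LinearMap.smul_apply, LinearMap.compr₂_apply,
    LinearMap.mul_apply', Finsupp.lsingle_apply]
  rw [mul_zsmul, ← Int.cast_smul_eq_zsmul F (-(-1) ^ _), smul_smul, sub_eq_add_neg, ← neg_smul]
  congr 1
  -- The sign in front of `rightProd` and the one inside its definition multiply to 1, which is
  -- inserted on the left.
  conv_lhs => rw [← one_smul F (coeffRight _ _ _ _ _ _ _ _ • _), ← h]
  congr 1
  simp [superSign]

/-- With δ = `d0 i₂`, the factor n₁δ + 1 completes n₁! to (n₁ + δ)!, and the generalised binomial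
contributes (-1)^m₂ and turns this into (m₂ + n₁ + δ)!/m₂!. The rest is
`choose_mul_factorial_mul_factorial_eq_descFactorial`. Beyond the admissible n the falling factorial
is zero, so no range condition is needed. -/
theorem leftProd_mono (n : ℕ) (i₁ i₂ j₁ j₂ : ZMod 2) (m₁ m₂ n₁ n₂ : ℕ) (u v : A) :
    leftProd F n (mono i₁ i₂ u m₁ m₂) (mono j₁ j₂ v n₁ n₂) =
      if i₂ = j₁ then ((-1) ^ m₂ * ((m₂ + n₁ + d0 i₂).descFactorial n : ℤ)) •
        mono i₁ j₂ (u * v) (m₁ + (m₂ + n₁ + d0 i₂) - n) n₂ else 0 := by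
  simp only [leftProd, mono, elt, map_zsmul, LinearMap.smul_apply, Finsupp.lsum_apply,
    LinearMap.flip_apply, map_zero,
    Finsupp.sum_single_index, LinearMap.compr₂_apply,
    LinearMap.mul_apply', Finsupp.lsingle_apply, coeffLeft]
  split_ifs with h1 h2 h2
  · obtain ⟨h, hn⟩ := h1
    rw [show m₁ + (m₂ + n₁ + d0 i₂) - n = m₁ + m₂ + n₁ + d0 i₂ - n by omega]
    simp only [smul_smul]
    congr 1
    rw [show -(n₁ : ℤ) - 1 - d0 i₂ = -((n₁ + d0 i₂ : ℕ) : ℤ) - 1 by push_cast; ring,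
      ring_choose_neg_natCast]
    have h1 := choose_mul_factorial_mul_factorial_eq_descFactorial m₁ (m₂ + n₁ + d0 i₂) n
      (by omega)
    rw [show m₁ + (m₂ + n₁ + d0 i₂) - n = m₁ + m₂ + n₁ + d0 i₂ - n by omega] at h1
    have h2 := Nat.choose_mul_factorial_mul_factorial (Nat.le_add_left m₂ (n₁ + d0 i₂))
    rw [Nat.add_sub_cancel] at h2
    have h3 : (n₁ + d0 i₂).factorial = (n₁ * d0 i₂ + 1) * n₁.factorial := by
      unfold d0; split_ifs <;> simp [Nat.factorial_succ]
    rw [show n₁ + d0 i₂ + m₂ = m₂ + n₁ + d0 i₂ by ring] at h2 ⊢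
    rw [← h2, h3] at h1
    zify at h1
    push_cast
    linear_combination ((-1 : ℤ) ^ m₂ * n₂.factorial) * h1
  · exact absurd h1.1 h2
  · rw [Nat.descFactorial_of_lt (by by_contra h; exact h1 ⟨h2, by omega⟩)]; simp
  · simp

/-- The mirror computation. The factor δ_{i₁,1} - (n₂ + 1)δ_{i₁,0} is negative for i₁ = 0, which
produces the additional sign (-1)^`d0 i₁`. -/
theorem rightProd_mono (n : ℕ) (i₁ i₂ j₁ j₂ : ZMod 2) (m₁ m₂ n₁ n₂ : ℕ) (u v : A) :
    rightProd F n (mono i₁ i₂ u m₁ m₂) (mono j₁ j₂ v n₁ n₂) =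
      if i₁ = j₂ then
        ((-1) ^ (m₁ + d0 i₁) * ((m₁ + n₂ + d0 i₁).descFactorial n : ℤ)) •
          mono j₁ i₂ (v * u) n₁ (m₂ + (m₁ + n₂ + d0 i₁) - n) else 0 := by
  simp only [rightProd, mono, elt, map_zsmul, LinearMap.smul_apply, Finsupp.lsum_apply,
    LinearMap.flip_apply, map_zero,
    Finsupp.sum_single_index, LinearMap.compr₂_apply,
    LinearMap.mul_apply', Finsupp.lsingle_apply, coeffRight]
  split_ifs with h1 h2 h2
  · obtain ⟨h, hn⟩ := h1
    rw [show m₂ + (m₁ + n₂ + d0 i₁) - n = m₁ + m₂ + n₂ + d0 i₁ - n by omega]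
    simp only [smul_smul]
    congr 1
    rw [show -(n₂ : ℤ) - 1 - d0 i₁ = -((n₂ + d0 i₁ : ℕ) : ℤ) - 1 by push_cast; ring,
      ring_choose_neg_natCast]
    have h1 := choose_mul_factorial_mul_factorial_eq_descFactorial m₂ (m₁ + n₂ + d0 i₁) n
      (by omega)
    rw [show m₂ + (m₁ + n₂ + d0 i₁) - n = m₁ + m₂ + n₂ + d0 i₁ - n by omega] at h1
    have h2 := Nat.choose_mul_factorial_mul_factorial (Nat.le_add_left m₁ (n₂ + d0 i₁))
    rw [Nat.add_sub_cancel] at h2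
    have h3 : ((n₂ + d0 i₁).factorial : ℤ) =
        (-1) ^ (d0 i₁) * (((d1 i₁ : ℤ) - (n₂ + 1) * d0 i₁) * n₂.factorial) := by
      have : i₁ = 0 ∨ i₁ = 1 := by
        clear * -; revert i₁; decide
      rcases this with rfl | rfl
      · simp [d0, d1, Nat.factorial_succ]; ring
      · simp [d0, d1]
    have hs : ((-1 : ℤ) ^ ((i₁ + i₂) * (j₁ + j₂)).val) * ((-1 : ℤ) ^ ((i₁ + i₂) * (j₁ + j₂)).val) = 1 := by
      rw [← mul_pow]; simp
    have hd : ((-1 : ℤ) ^ d0 i₁) * ((-1 : ℤ) ^ d0 i₁) = 1 := by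
      rw [← mul_pow]; simp
    rw [show n₂ + d0 i₁ + m₁ = m₁ + n₂ + d0 i₁ by ring] at h2 ⊢
    rw [← h2] at h1
    zify at h1
    rw [h3] at h1
    push_cast
    rw [pow_add]
    generalize (-1 : ℤ) ^ ((i₁ + i₂) * (j₁ + j₂)).val = s at *
    generalize (-1 : ℤ) ^ d0 i₁ = e at *
    linear_combination ((-1 : ℤ) ^ m₁ * n₁.factorial * e) * h1 + ((m₁ + m₂ + n₂ + d0 i₁ - n).choose m₂ *
      (m₂.factorial * ((m₁ + n₂ + d0 i₁).choose m₁ * m₁.factorial * (((d1 i₁ : ℤ) - (n₂ + 1) * d0 i₁) * n₂.factorial)))) * ((-1 : ℤ) ^ m₁ * n₁.factorial) * (hs - hd)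
  · exact absurd h1.1 h2
  · rw [Nat.descFactorial_of_lt (by by_contra h; exact h1 ⟨h2, by omega⟩)]; simp
  · simp

end Products

/-! ### Composition laws of left and right multiplications -/

section Identities

open Finset

variable {F : Type*} {A : Type*} [Field F] [Ring A] [Algebra F A]

theorem modeProd_mono_eq (n : ℕ) (i₁ i₂ j₁ j₂ : ZMod 2) (m₁ m₂ n₁ n₂ : ℕ) (u v : A) :
    modeProd F n (mono i₁ i₂ u m₁ m₂) (mono j₁ j₂ v n₁ n₂) =
      leftProd F n (mono i₁ i₂ u m₁ m₂) (mono j₁ j₂ v n₁ n₂) -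
        superSign F (i₁ + i₂) (j₁ + j₂) •
          rightProd F n (mono i₁ i₂ u m₁ m₂) (mono j₁ j₂ v n₁ n₂) := by
  simp only [mono, map_zsmul, LinearMap.smul_apply, modeProd_elt_eq, smul_sub]
  simp only [smul_comm (superSign F _ _)]

theorem DSpace.linearMap_ext [CharZero F] {V : Type*} [AddCommGroup V] [Module F V]
    {f g : DSpace A →ₗ[F] V} (h : ∀ i j u m n, f (mono i j u m n) = g (mono i j u m n)) :
    f = g := by
  refine LinearMap.ext fun x => DSpace.induction_mono F (p := fun x => f x = g x) x ?_ ?_ h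
  · simp
  · intro x y hx hy; simp only [map_add, hx, hy]

/-- The composite `(U, V, W) ↦ f U (g V W)`. -/
def compRight {V : Type*} [AddCommGroup V] [Module F V] (f g : V →ₗ[F] V →ₗ[F] V) :
    V →ₗ[F] V →ₗ[F] V →ₗ[F] V :=
  LinearMap.mk₂ F (fun u v => f u ∘ₗ g v) (by intros; ext; simp) (by intros; ext; simp)
    (by intros; ext; simp) (by intros; ext; simp)

theorem compRight_apply {V : Type*} [AddCommGroup V] [Module F V] (f g : V →ₗ[F] V →ₗ[F] V)
    (u v w : V) : compRight f g u v w = f u (g v w) := rfl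

/-- This makes truncated subtraction in the exponents harmless: exponents are compared only where
the coefficient, hence the falling factorial in it, is nonzero. -/
theorem zsmul_mono_congr {c c' : ℤ} {i j : ZMod 2} {u u' : A} {m m' n n' : ℕ} (hc : c = c')
    (hu : u = u') (h : c' ≠ 0 → m = m' ∧ n = n') :
    c • mono i j u m n = c' • mono i j u' m' n' := by
  subst hc hu
  by_cases h0 : c = 0
  · simp [h0]
  · rw [(h h0).1, (h h0).2]

theorem le_of_descFactorial_ne_zero {a b : ℕ} (h : (a.descFactorial b : ℤ) ≠ 0) : b ≤ a := by
  by_contra h'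
  exact h (by rw [Nat.descFactorial_of_lt (by omega)]; simp)

variable [CharZero F]

/-- On `mono`s every nonzero summand is a multiple of one and the same `mono`, so only coefficients
matter, and these agree by `sum_choose_mul_descFactorial`. -/
theorem leftProd_leftProd (m n : ℕ) (U V W : DSpace A) :
    leftProd F m U (leftProd F n V W) =
      ∑ r ∈ range (m + 1), (m.choose r : ℤ) • leftProd F (m + n - r) (leftProd F r U V) W := by
  have : compRight (leftProd F m) (leftProd F n) = ∑ r ∈ range (m + 1),
      (m.choose r : ℤ) • (leftProd F r).compr₂ (leftProd F (A := A) (m + n - r)) := by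
    refine DSpace.linearMap_ext fun i₁ i₂ u m₁ m₂ => DSpace.linearMap_ext fun j₁ j₂ v n₁ n₂ =>
      DSpace.linearMap_ext fun l₁ l₂ w p₁ p₂ => ?_
    simp only [compRight_apply, LinearMap.sum_apply,
      LinearMap.smul_apply, LinearMap.compr₂_apply, leftProd_mono]
    by_cases h1 : i₂ = j₁
    swap
    · split_ifs <;> simp [leftProd_mono, h1]
    by_cases h2 : j₂ = l₁
    swap
    · split_ifs; simp [leftProd_mono, h2]
    simp only [h1, h2, if_true, map_zsmul, LinearMap.smul_apply, leftProd_mono, smul_smul,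
      ← mul_assoc]
    have key := sum_choose_mul_descFactorial (m₂ + n₁ + d0 j₁) (n₂ + p₁ + d0 l₁) m n
    trans ((-1) ^ m₂ * (-1) ^ n₂ * (((n₂ + p₁ + d0 l₁).descFactorial n *
      (m₂ + n₁ + d0 j₁ + (n₂ + p₁ + d0 l₁) - n).descFactorial m : ℕ) : ℤ)) • mono i₁ l₂ (u * v * w)
        (m₁ + (m₂ + n₁ + d0 j₁) + (n₂ + p₁ + d0 l₁) - (m + n)) p₂
    · by_cases hn : n ≤ n₂ + p₁ + d0 l₁
      · rw [show m₂ + (n₁ + (n₂ + p₁ + d0 l₁) - n) + d0 j₁ =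
          m₂ + n₁ + d0 j₁ + (n₂ + p₁ + d0 l₁) - n by omega]
        exact zsmul_mono_congr (by push_cast; ring) rfl fun h => by omega
      · rw [Nat.descFactorial_of_lt (by omega)]; simp
    · rw [← key]
      push_cast
      rw [mul_sum, sum_smul]
      refine sum_congr rfl fun r hr => ?_
      have hr' : r ≤ m := by simpa [Nat.lt_succ_iff] using hr
      refine zsmul_mono_congr (by ring) rfl fun h => ?_
      have e1 := le_of_descFactorial_ne_zero (fun e => h (by rw [e]; ring) :
        ((m₂ + n₁ + d0 j₁).descFactorial r : ℤ) ≠ 0)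
      have e2 := le_of_descFactorial_ne_zero (fun e => h (by rw [e]; ring) :
        ((n₂ + p₁ + d0 l₁).descFactorial (m + n - r) : ℤ) ≠ 0)
      omega
  simpa [compRight_apply] using congr($this U V W)

/-- Multiplying by U and then by V amounts to multiplying by VU, the contraction computed by
`rightProd`. Its second exponent depends on r and feeds the sign of the outer `leftProd`, so the
alternating identity is the relevant one. -/
theorem leftProd_leftProd_swap (m n : ℕ) (U V W : DSpace A) :
    leftProd F n V (leftProd F m U W) =
      ∑ r ∈ range (m + 1), (m.choose r : ℤ) • leftProd F (m + n - r) (rightProd F r U V) W := by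
  have : (compRight (leftProd F n) (leftProd F m)).flip = ∑ r ∈ range (m + 1),
      (m.choose r : ℤ) • (rightProd F r).compr₂ (leftProd F (A := A) (m + n - r)) := by
    refine DSpace.linearMap_ext fun i₁ i₂ u m₁ m₂ => DSpace.linearMap_ext fun j₁ j₂ v n₁ n₂ =>
      DSpace.linearMap_ext fun l₁ l₂ w p₁ p₂ => ?_
    simp only [LinearMap.flip_apply, compRight_apply, LinearMap.sum_apply,
      LinearMap.smul_apply, LinearMap.compr₂_apply, leftProd_mono, rightProd_mono]
    by_cases h1 : i₂ = l₁
    swap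
    · split_ifs <;> simp [leftProd_mono, h1]
    by_cases h2 : i₁ = j₂
    swap
    · split_ifs; simp [leftProd_mono, Ne.symm h2]
    simp only [h1, h2, if_true, map_zsmul, LinearMap.smul_apply, leftProd_mono, smul_smul,
      ← mul_assoc]
    have key := sum_alternating_descFactorial (m₁ + n₂ + d0 j₂) (m₂ + p₁ + d0 l₁) m n
    trans ((-1) ^ m₂ * (-1) ^ n₂ * ((m₂ + p₁ + d0 l₁).descFactorial m *
      (m₁ + n₂ + d0 j₂ + (m₂ + p₁ + d0 l₁) - m).descFactorial n : ℤ)) • mono j₁ l₂ (v * u * w)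
        (n₁ + (m₁ + n₂ + d0 j₂) + (m₂ + p₁ + d0 l₁) - (m + n)) p₂
    · by_cases hn : m ≤ m₂ + p₁ + d0 l₁
      · rw [show n₂ + (m₁ + (m₂ + p₁ + d0 l₁) - m) + d0 j₂ =
          m₁ + n₂ + d0 j₂ + (m₂ + p₁ + d0 l₁) - m by omega]
        exact zsmul_mono_congr (by ring) rfl fun h => by omega
      · rw [Nat.descFactorial_of_lt (by omega)]; simp
    · rw [← key, mul_sum, sum_smul]
      refine sum_congr rfl fun r hr => ?_
      have hr' : r ≤ m := by simpa [Nat.lt_succ_iff] using hr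
      by_cases hA : r ≤ m₁ + n₂ + d0 j₂
      swap
      · rw [Nat.descFactorial_of_lt (by omega)]; simp
      rw [show m₂ + (m₁ + n₂ + d0 j₂) - r + p₁ + d0 l₁ =
        m₁ + n₂ + d0 j₂ + (m₂ + p₁ + d0 l₁) - r by omega]
      -- Source of the factor (-1)^r in `sum_alternating_descFactorial`; the bound `hA` makes the
      -- subtraction genuine.
      have hs : (-1 : ℤ) ^ (m₁ + d0 j₂) * (-1) ^ (m₂ + (m₁ + n₂ + d0 j₂) - r) =
          (-1) ^ m₂ * (-1) ^ n₂ * (-1) ^ r := by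
        rw [← pow_add, ← pow_add, ← pow_add]
        refine neg_one_pow_congr ?_
        rw [Nat.even_iff, Nat.even_iff]; omega
      refine zsmul_mono_congr (by linear_combination ((m.choose r : ℤ) *
        (m₁ + n₂ + d0 j₂).descFactorial r * (m₁ + n₂ + d0 j₂ + (m₂ + p₁ + d0 l₁) - r).descFactorial
          (m + n - r)) * hs.symm) rfl fun h => ?_
      have e2 := le_of_descFactorial_ne_zero (fun e => h (by rw [e]; ring) :
        ((m₁ + n₂ + d0 j₂ + (m₂ + p₁ + d0 l₁) - r).descFactorial (m + n - r) : ℤ) ≠ 0)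
      omega
  simpa [compRight_apply] using congr($this U V W)

theorem rightProd_rightProd (m n : ℕ) (U V W : DSpace A) :
    rightProd F m U (rightProd F n V W) =
      ∑ r ∈ range (m + 1), (m.choose r : ℤ) • rightProd F (m + n - r) (rightProd F r U V) W := by
  have : compRight (rightProd F m) (rightProd F n) = ∑ r ∈ range (m + 1),
      (m.choose r : ℤ) • (rightProd F r).compr₂ (rightProd F (A := A) (m + n - r)) := by
    refine DSpace.linearMap_ext fun i₁ i₂ u m₁ m₂ => DSpace.linearMap_ext fun j₁ j₂ v n₁ n₂ =>
      DSpace.linearMap_ext fun l₁ l₂ w p₁ p₂ => ?_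
    simp only [compRight_apply, LinearMap.sum_apply,
      LinearMap.smul_apply, LinearMap.compr₂_apply, rightProd_mono]
    by_cases h1 : i₁ = j₂
    swap
    · split_ifs <;> simp [rightProd_mono, h1]
    by_cases h2 : j₁ = l₂
    swap
    · split_ifs; simp [rightProd_mono, h2]
    simp only [h1, h2, if_true, map_zsmul, LinearMap.smul_apply, rightProd_mono, smul_smul,
      mul_assoc w]
    have key := sum_choose_mul_descFactorial (m₁ + n₂ + d0 j₂) (n₁ + p₂ + d0 l₂) m n
    trans ((-1) ^ (m₁ + d0 j₂) * (-1) ^ (n₁ + d0 l₂) * (((n₁ + p₂ + d0 l₂).descFactorial n *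
      (m₁ + n₂ + d0 j₂ + (n₁ + p₂ + d0 l₂) - n).descFactorial m : ℕ) : ℤ)) •
        mono l₁ i₂ (w * (v * u)) p₁
          (m₂ + (m₁ + n₂ + d0 j₂) + (n₁ + p₂ + d0 l₂) - (m + n))
    · by_cases hn : n ≤ n₁ + p₂ + d0 l₂
      · rw [show m₁ + (n₂ + (n₁ + p₂ + d0 l₂) - n) + d0 j₂ =
          m₁ + n₂ + d0 j₂ + (n₁ + p₂ + d0 l₂) - n by omega]
        exact zsmul_mono_congr (by push_cast; ring) rfl fun h => by omega
      · rw [Nat.descFactorial_of_lt (by omega)]; simp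
    · rw [← key]
      push_cast
      rw [mul_sum, sum_smul]
      refine sum_congr rfl fun r hr => ?_
      have hr' : r ≤ m := by simpa [Nat.lt_succ_iff] using hr
      refine zsmul_mono_congr (by ring) rfl fun h => ?_
      have e1 := le_of_descFactorial_ne_zero (fun e => h (by rw [e]; ring) :
        ((m₁ + n₂ + d0 j₂).descFactorial r : ℤ) ≠ 0)
      have e2 := le_of_descFactorial_ne_zero (fun e => h (by rw [e]; ring) :
        ((n₁ + p₂ + d0 l₂).descFactorial (m + n - r) : ℤ) ≠ 0)
      omega
  simpa [compRight_apply] using congr($this U V W)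

theorem rightProd_rightProd_swap (m n : ℕ) (U V W : DSpace A) :
    rightProd F n V (rightProd F m U W) =
      ∑ r ∈ range (m + 1), (m.choose r : ℤ) • rightProd F (m + n - r) (leftProd F r U V) W := by
  have : (compRight (rightProd F n) (rightProd F m)).flip = ∑ r ∈ range (m + 1),
      (m.choose r : ℤ) • (leftProd F r).compr₂ (rightProd F (A := A) (m + n - r)) := by
    refine DSpace.linearMap_ext fun i₁ i₂ u m₁ m₂ => DSpace.linearMap_ext fun j₁ j₂ v n₁ n₂ =>
      DSpace.linearMap_ext fun l₁ l₂ w p₁ p₂ => ?_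
    simp only [LinearMap.flip_apply, compRight_apply, LinearMap.sum_apply,
      LinearMap.smul_apply, LinearMap.compr₂_apply, leftProd_mono, rightProd_mono]
    by_cases h1 : i₁ = l₂
    swap
    · split_ifs <;> simp [rightProd_mono, h1]
    by_cases h2 : i₂ = j₁
    swap
    · split_ifs; simp [rightProd_mono, Ne.symm h2]
    simp only [h1, h2, if_true, map_zsmul, LinearMap.smul_apply, rightProd_mono, smul_smul,
      mul_assoc w]
    have key := sum_alternating_descFactorial (m₂ + n₁ + d0 j₁) (m₁ + p₂ + d0 l₂) m n
    trans ((-1) ^ (m₁ + d0 l₂) * (-1) ^ (n₁ + d0 j₁) * ((m₁ + p₂ + d0 l₂).descFactorial m *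
      (m₂ + n₁ + d0 j₁ + (m₁ + p₂ + d0 l₂) - m).descFactorial n : ℤ)) •
        mono l₁ j₂ (w * (u * v)) p₁
          (n₂ + (m₂ + n₁ + d0 j₁) + (m₁ + p₂ + d0 l₂) - (m + n))
    · by_cases hn : m ≤ m₁ + p₂ + d0 l₂
      · rw [show n₁ + (m₂ + (m₁ + p₂ + d0 l₂) - m) + d0 j₁ =
          m₂ + n₁ + d0 j₁ + (m₁ + p₂ + d0 l₂) - m by omega]
        exact zsmul_mono_congr (by ring) rfl fun h => by omega
      · rw [Nat.descFactorial_of_lt (by omega)]; simp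
    · rw [← key, mul_sum, sum_smul]
      refine sum_congr rfl fun r hr => ?_
      have hr' : r ≤ m := by simpa [Nat.lt_succ_iff] using hr
      by_cases hA : r ≤ m₂ + n₁ + d0 j₁
      swap
      · rw [Nat.descFactorial_of_lt (by omega)]; simp
      rw [show m₁ + (m₂ + n₁ + d0 j₁) - r + p₂ + d0 l₂ =
        m₂ + n₁ + d0 j₁ + (m₁ + p₂ + d0 l₂) - r by omega]
      have hs : (-1 : ℤ) ^ m₂ * (-1) ^ (m₁ + (m₂ + n₁ + d0 j₁) - r + d0 l₂) =
          (-1) ^ (m₁ + d0 l₂) * (-1) ^ (n₁ + d0 j₁) * (-1) ^ r := by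
        rw [← pow_add, ← pow_add, ← pow_add]
        refine neg_one_pow_congr ?_
        rw [Nat.even_iff, Nat.even_iff]; omega
      refine zsmul_mono_congr (by linear_combination ((m.choose r : ℤ) *
        (m₂ + n₁ + d0 j₁).descFactorial r * (m₂ + n₁ + d0 j₁ + (m₁ + p₂ + d0 l₂) - r).descFactorial
          (m + n - r)) * hs.symm) rfl fun h => ?_
      have e2 := le_of_descFactorial_ne_zero (fun e => h (by rw [e]; ring) :
        ((m₂ + n₁ + d0 j₁ + (m₁ + p₂ + d0 l₂) - r).descFactorial (m + n - r) : ℤ) ≠ 0)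
      omega
  simpa [compRight_apply] using congr($this U V W)

/-- Left multiplication changes only the first index and exponent of W, right multiplication only
the second ones; the coefficients are then independent and matrix multiplication is associative. -/
theorem leftProd_rightProd_comm (m n : ℕ) (U V W : DSpace A) :
    leftProd F m U (rightProd F n V W) = rightProd F n V (leftProd F m U W) := by
  have : compRight (leftProd F m) (rightProd F n) =
      (compRight (rightProd F (A := A) n) (leftProd F m)).flip := by
    refine DSpace.linearMap_ext fun i₁ i₂ u m₁ m₂ => DSpace.linearMap_ext fun j₁ j₂ v n₁ n₂ =>
      DSpace.linearMap_ext fun l₁ l₂ w p₁ p₂ => ?_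
    simp only [LinearMap.flip_apply, compRight_apply, leftProd_mono, rightProd_mono]
    split_ifs with h1 h2 h2
    · simp only [map_zsmul, leftProd_mono, rightProd_mono, h1, h2, if_true, mul_assoc]
      rw [smul_comm]
    all_goals simp [leftProd_mono, rightProd_mono, h1, h2]
  exact congr($this U V W)

end Identities

/-! ### Signs, translation and skew-symmetry for the two halves -/

section Conformal

open Finset

variable {F : Type*} {A : Type*} [Field F] [Ring A] [Algebra F A]

theorem superSign_comm (i j : ZMod 2) : superSign F i j = superSign F j i := by
  rw [superSign, mul_comm, superSign]

theorem superSign_mul_self (i j : ZMod 2) : superSign F i j * superSign F i j = 1 := by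
  rw [superSign, ← mul_pow]; simp

theorem superSign_zero_left (i : ZMod 2) : superSign F 0 i = 1 := by
  rw [superSign, zero_mul]; simp

theorem superSign_one_one : superSign F 1 1 = -1 := by
  rw [superSign, mul_one, ZMod.val_one]; simp

theorem ZMod.eq_zero_or_one : ∀ i : ZMod 2, i = 0 ∨ i = 1 := by decide

theorem superSign_add_right (i j k : ZMod 2) :
    superSign F i (j + k) = superSign F i j * superSign F i k := by
  have h0 := fun i => superSign_zero_left (F := F) i
  have h0' := fun i => (superSign_comm (F := F) i 0).trans (h0 i)
  have h11 := superSign_one_one (F := F)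
  rcases ZMod.eq_zero_or_one i with rfl | rfl <;> rcases ZMod.eq_zero_or_one j with rfl | rfl <;>
    rcases ZMod.eq_zero_or_one k with rfl | rfl <;>
    simp [h0, h0', h11, show (1 + 1 : ZMod 2) = 0 from rfl]

theorem superSign_add_left (i j k : ZMod 2) :
    superSign F (i + j) k = superSign F i k * superSign F j k := by
  rw [superSign_comm, superSign_add_right, superSign_comm, superSign_comm k]

variable (F) in
/-- Multiplication by `t₁`, on the `mono`s. -/
noncomputable def shiftLeft : DSpace A →ₗ[F] DSpace A :=
  Finsupp.lsum F fun d => (d.2.2.1 + 1) • Finsupp.lsingle (d.1, d.2.1, d.2.2.1 + 1, d.2.2.2)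

variable (F) in
/-- Multiplication by `t₂`, on the `mono`s. -/
noncomputable def shiftRight : DSpace A →ₗ[F] DSpace A :=
  Finsupp.lsum F fun d => (d.2.2.2 + 1) • Finsupp.lsingle (d.1, d.2.1, d.2.2.1, d.2.2.2 + 1)

theorem shiftLeft_mono (i j : ZMod 2) (u : A) (m n : ℕ) :
    shiftLeft F (mono i j u m n) = mono i j u (m + 1) n := by
  simp only [mono, map_zsmul, shiftLeft, elt, Finsupp.lsum_apply, LinearMap.map_zero,
    Finsupp.sum_single_index, LinearMap.smul_apply, Finsupp.lsingle_apply]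
  rw [← natCast_zsmul, smul_smul, Nat.factorial_succ]
  congr 1; push_cast; ring

theorem shiftRight_mono (i j : ZMod 2) (u : A) (m n : ℕ) :
    shiftRight F (mono i j u m n) = mono i j u m (n + 1) := by
  simp only [mono, map_zsmul, shiftRight, elt, Finsupp.lsum_apply, LinearMap.map_zero,
    Finsupp.sum_single_index, LinearMap.smul_apply, Finsupp.lsingle_apply]
  rw [← natCast_zsmul, smul_smul, Nat.factorial_succ]
  congr 1; push_cast; ring

theorem dd_eq_shift : dd F (A := A) = shiftLeft F + shiftRight F := by
  refine Finsupp.lhom_ext fun d u => ?_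
  simp [dd, shiftLeft, shiftRight]

theorem dd_mono (i j : ZMod 2) (u : A) (m n : ℕ) :
    dd F (mono i j u m n) = mono i j u (m + 1) n + mono i j u m (n + 1) := by
  rw [dd_eq_shift, LinearMap.add_apply, shiftLeft_mono, shiftRight_mono]

theorem shiftLeft_pow_mono (i j : ZMod 2) (u : A) (m n k : ℕ) :
    (shiftLeft F ^ k) (mono i j u m n) = mono i j u (m + k) n := by
  induction k with
  | zero => rfl
  | succ k ih => rw [pow_succ', Module.End.mul_apply, ih, shiftLeft_mono, add_assoc]

theorem shiftRight_pow_mono (i j : ZMod 2) (u : A) (m n k : ℕ) :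
    (shiftRight F ^ k) (mono i j u m n) = mono i j u m (n + k) := by
  induction k with
  | zero => rfl
  | succ k ih => rw [pow_succ', Module.End.mul_apply, ih, shiftRight_mono, add_assoc]

theorem shift_commute [CharZero F] :
    Commute (shiftLeft F (A := A)) (shiftRight F (A := A)) := by
  refine DSpace.linearMap_ext fun i j u m n => ?_
  simp [Module.End.mul_apply, shiftLeft_mono, shiftRight_mono]

/-- Taylor's formula for the divided falling factorials, in an algebra containing commuting
elements `x` and `y`. -/
theorem sum_descFactorial_taylor [CharZero F] {R : Type*} [Ring R] [Algebra F R] {x y : R}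
    (h : Commute x y) (n M N : ℕ) (hN : M < N) :
    ∑ r ∈ range N, ((-1 : F) ^ (n + r) * ((r.factorial : F))⁻¹ * (M.descFactorial (n + r) : F)) •
      ((x + y) ^ r * y ^ (M - (n + r))) =
    ((-1 : F) ^ M * (M.descFactorial n : F)) • x ^ (M - n) := by
  by_cases hn : n ≤ M
  swap
  · rw [Nat.descFactorial_of_lt (by omega)]
    simp only [Nat.cast_zero, mul_zero, zero_smul]
    refine sum_eq_zero fun r _ => ?_
    rw [Nat.descFactorial_of_lt (by omega)]; simp
  -- The identity is the binomial expansion of (-(x + y) + y)^(M - n) = (-x)^(M - n).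
  have hc : Commute (-(x + y)) y := ((h.add_left (Commute.refl y))).neg_left
  have hb := hc.add_pow (M - n)
  rw [show -(x + y) + y = -x by abel, neg_pow x] at hb
  have e : (x ^ (M - n) : R) = ((-1 : F) ^ (M - n)) • ((-1) ^ (M - n) * x ^ (M - n)) := by
    rw [Algebra.smul_def, ← mul_assoc]
    simp only [map_pow, map_neg, map_one]
    rw [← pow_add, Even.neg_one_pow ⟨_, rfl⟩, one_mul]
  rw [e, hb, smul_sum, smul_sum]
  -- Terms with n + r > M carry a vanishing falling factorial.
  rw [← sum_subset (range_mono (show M - n + 1 ≤ N by omega))]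
  · refine sum_congr rfl fun r hr => ?_
    have hr' : r ≤ M - n := by simpa [Nat.lt_succ_iff] using hr
    rw [← Nat.descFactorial_mul_descFactorial (show n ≤ n + r by omega), Nat.add_sub_cancel_left,
      Nat.descFactorial_eq_factorial_mul_choose (M - n), neg_pow (x + y),
      ← (Nat.cast_commute ((M - n).choose r) ((-1) ^ r * (x + y) ^ r * y ^ (M - n - r))).eq,
      ← mul_assoc, smul_smul, Nat.sub_sub]
    have h1 : ((M - n).choose r : R) * ((-1) ^ r * (x + y) ^ r) =
        (((M - n).choose r : F) * (-1) ^ r) • (x + y) ^ r := by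
      rw [Algebra.smul_def]; simp [mul_assoc]
    rw [h1, smul_mul_assoc, smul_smul]
    congr 1
    have hf : (r.factorial : F) ≠ 0 := by exact_mod_cast r.factorial_ne_zero
    have hp : (-1 : F) ^ M * (-1) ^ (M - n) = (-1) ^ n := by
      rw [← pow_add]; refine neg_one_pow_congr ?_
      rw [Nat.even_iff, Nat.even_iff]; omega
    push_cast
    rw [pow_add, show (-1 : F) ^ n * (-1) ^ r * (r.factorial : F)⁻¹ *
      (r.factorial * (M - n).choose r * M.descFactorial n) = (-1) ^ n * (-1) ^ r *
      ((r.factorial : F)⁻¹ * r.factorial) * ((M - n).choose r * M.descFactorial n) by ring,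
      inv_mul_cancel₀ hf]
    linear_combination (-((M - n).choose r * M.descFactorial n * (-1) ^ r : F)) * hp
  · intro r _ hr
    rw [Nat.descFactorial_of_lt (by simp at hr; omega)]; simp

/-- The two summands of ∂U give the same element, with opposite signs because m₂ differs by one. -/
theorem leftProd_dd_zero [CharZero F] (U V : DSpace A) : leftProd F 0 (dd F U) V = 0 := by
  have : leftProd F 0 ∘ₗ dd F (A := A) = 0 := by
    refine DSpace.linearMap_ext fun i₁ i₂ u m₁ m₂ => DSpace.linearMap_ext fun j₁ j₂ v n₁ n₂ => ?_
    simp only [LinearMap.comp_apply, dd_mono, map_add, LinearMap.add_apply, leftProd_mono,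
      LinearMap.zero_apply]
    split_ifs
    · rw [← eq_neg_iff_add_eq_zero, ← neg_smul]
      exact zsmul_mono_congr (by simp [pow_succ]) rfl fun _ => by omega
    · simp
  exact congr($this U V)

theorem rightProd_dd_zero [CharZero F] (U V : DSpace A) : rightProd F 0 (dd F U) V = 0 := by
  have : rightProd F 0 ∘ₗ dd F (A := A) = 0 := by
    refine DSpace.linearMap_ext fun i₁ i₂ u m₁ m₂ => DSpace.linearMap_ext fun j₁ j₂ v n₁ n₂ => ?_
    simp only [LinearMap.comp_apply, dd_mono, map_add, LinearMap.add_apply, rightProd_mono,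
      LinearMap.zero_apply]
    split_ifs
    · rw [← eq_neg_iff_add_eq_zero, ← neg_smul]
      exact zsmul_mono_congr (by simp [pow_succ, pow_add]) rfl fun _ => by omega
    · simp
  exact congr($this U V)

/-- The two summands of ∂u enter the product with opposite signs, so this difference is the
coefficient that arises. -/
theorem descFactorial_succ_sub (a n : ℕ) :
    (a.descFactorial (n + 1) : ℤ) - (a + 1).descFactorial (n + 1) =
      -((n : ℤ) + 1) * a.descFactorial n := by
  rw [Nat.succ_descFactorial_succ, Nat.descFactorial_succ]
  rcases le_or_gt n a with h | h
  · push_cast [h]; ring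
  · rw [Nat.descFactorial_of_lt h]; simp

theorem leftProd_dd_succ [CharZero F] (n : ℕ) (U V : DSpace A) :
    leftProd F (n + 1) (dd F U) V = -((n : F) + 1) • leftProd F n U V := by
  have : leftProd F (n + 1) ∘ₗ dd F (A := A) = -((n : F) + 1) • leftProd F n := by
    refine DSpace.linearMap_ext fun i₁ i₂ u m₁ m₂ => DSpace.linearMap_ext fun j₁ j₂ v n₁ n₂ => ?_
    simp only [LinearMap.comp_apply, dd_mono, map_add, LinearMap.add_apply, leftProd_mono,
      LinearMap.smul_apply]
    split_ifs
    · rw [show -((n : F) + 1) = ((-((n : ℤ) + 1) : ℤ) : F) by push_cast; ring,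
        Int.cast_smul_eq_zsmul, smul_smul,
        show m₁ + 1 + (m₂ + n₁ + d0 i₂) - (n + 1) = m₁ + (m₂ + n₁ + d0 i₂) - n by omega,
        show m₁ + (m₂ + 1 + n₁ + d0 i₂) - (n + 1) = m₁ + (m₂ + n₁ + d0 i₂) - n by omega,
        show m₂ + 1 + n₁ + d0 i₂ = m₂ + n₁ + d0 i₂ + 1 by omega, ← add_smul]
      congr 1
      linear_combination (-1) ^ m₂ * descFactorial_succ_sub (m₂ + n₁ + d0 i₂) n
    · simp
  exact congr($this U V)

theorem rightProd_dd_succ [CharZero F] (n : ℕ) (U V : DSpace A) :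
    rightProd F (n + 1) (dd F U) V = -((n : F) + 1) • rightProd F n U V := by
  have : rightProd F (n + 1) ∘ₗ dd F (A := A) = -((n : F) + 1) • rightProd F n := by
    refine DSpace.linearMap_ext fun i₁ i₂ u m₁ m₂ => DSpace.linearMap_ext fun j₁ j₂ v n₁ n₂ => ?_
    simp only [LinearMap.comp_apply, dd_mono, map_add, LinearMap.add_apply, rightProd_mono,
      LinearMap.smul_apply]
    split_ifs
    · rw [show -((n : F) + 1) = ((-((n : ℤ) + 1) : ℤ) : F) by push_cast; ring,
        Int.cast_smul_eq_zsmul, smul_smul,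
        show m₂ + 1 + (m₁ + n₂ + d0 i₁) - (n + 1) = m₂ + (m₁ + n₂ + d0 i₁) - n by omega,
        show m₂ + (m₁ + 1 + n₂ + d0 i₁) - (n + 1) = m₂ + (m₁ + n₂ + d0 i₁) - n by omega,
        show m₁ + 1 + n₂ + d0 i₁ = m₁ + n₂ + d0 i₁ + 1 by omega, ← add_smul]
      congr 1
      linear_combination (-1) ^ (m₁ + d0 i₁) * descFactorial_succ_sub (m₁ + n₂ + d0 i₁) n
    · simp
  exact congr($this U V)

variable (F) in
theorem DSpace.induction_mono₂ [CharZero F]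
    {p : DSpace A → DSpace A → Prop} (x y : DSpace A) (h0l : ∀ y, p 0 y) (h0r : ∀ x, p x 0)
    (haddl : ∀ x x' y, p x y → p x' y → p (x + x') y)
    (haddr : ∀ x y y', p x y → p x y' → p x (y + y'))
    (hm : ∀ i₁ i₂ u m₁ m₂ j₁ j₂ v n₁ n₂, p (mono i₁ i₂ u m₁ m₂) (mono j₁ j₂ v n₁ n₂)) :
    p x y :=
  DSpace.induction_mono F (p := fun x => p x y) x (h0l y) (fun x x' => haddl x x' y)
    fun i₁ i₂ u m₁ m₂ => DSpace.induction_mono F (p := fun y => p _ y) y (h0r _)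
      (fun y y' => haddr _ y y') fun j₁ j₂ v n₁ n₂ => hm i₁ i₂ u m₁ m₂ j₁ j₂ v n₁ n₂

theorem leftProd_finite [CharZero F] (U V : DSpace A) : ∃ N, ∀ n ≥ N, leftProd F n U V = 0 := by
  refine DSpace.induction_mono₂ F (p := fun U V => ∃ N, ∀ n ≥ N, leftProd F n U V = 0) U V ?_ ?_
    ?_ ?_ ?_
  · exact fun _ => ⟨0, by simp⟩
  · exact fun _ => ⟨0, by simp⟩
  · rintro x x' y ⟨N, h⟩ ⟨N', h'⟩
    refine ⟨max N N', fun n hn => ?_⟩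
    rw [map_add, LinearMap.add_apply, h n (by omega), h' n (by omega), add_zero]
  · rintro x x' y ⟨N, h⟩ ⟨N', h'⟩
    refine ⟨max N N', fun n hn => ?_⟩
    rw [map_add, h n (by omega), h' n (by omega), add_zero]
  · intro i₁ i₂ u m₁ m₂ j₁ j₂ v n₁ n₂
    refine ⟨m₂ + n₁ + d0 i₂ + 1, fun n hn => ?_⟩
    rw [leftProd_mono, Nat.descFactorial_of_lt (by omega)]; simp

theorem rightProd_finite [CharZero F] (U V : DSpace A) : ∃ N, ∀ n ≥ N, rightProd F n U V = 0 := by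
  refine DSpace.induction_mono₂ F (p := fun U V => ∃ N, ∀ n ≥ N, rightProd F n U V = 0) U V ?_ ?_
    ?_ ?_ ?_
  · exact fun _ => ⟨0, by simp⟩
  · exact fun _ => ⟨0, by simp⟩
  · rintro x x' y ⟨N, h⟩ ⟨N', h'⟩
    refine ⟨max N N', fun n hn => ?_⟩
    rw [map_add, LinearMap.add_apply, h n (by omega), h' n (by omega), add_zero]
  · rintro x x' y ⟨N, h⟩ ⟨N', h'⟩
    refine ⟨max N N', fun n hn => ?_⟩
    rw [map_add, h n (by omega), h' n (by omega), add_zero]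
  · intro i₁ i₂ u m₁ m₂ j₁ j₂ v n₁ n₂
    refine ⟨m₁ + n₂ + d0 i₁ + 1, fun n hn => ?_⟩
    rw [rightProd_mono, Nat.descFactorial_of_lt (by omega)]; simp

/-- On `mono`s, `rightProd F (n + r) V U` depends on r only through its coefficient and its second
exponent, so the sum is Taylor's formula for the commuting operators t₁ and t₂, whose sum is ∂. The
length of the sum is left as an eventual bound so that the statement survives addition. -/
theorem leftProd_eq_sum [CharZero F] (n : ℕ) (U V : DSpace A) :
    ∃ N₀, ∀ N ≥ N₀, leftProd F n U V = ∑ r ∈ range N,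
      ((-1 : F) ^ (n + r) * ((r.factorial : F))⁻¹) • (dd F ^ r) (rightProd F (n + r) V U) := by
  refine DSpace.induction_mono₂ F (p := fun U V => ∃ N₀, ∀ N ≥ N₀, leftProd F n U V =
    ∑ r ∈ range N, ((-1 : F) ^ (n + r) * ((r.factorial : F))⁻¹) •
      (dd F ^ r) (rightProd F (n + r) V U)) U V ?_ ?_ ?_ ?_ ?_
  · exact fun _ => ⟨0, by simp⟩
  · exact fun _ => ⟨0, by simp⟩
  · rintro x x' y ⟨N, h⟩ ⟨N', h'⟩
    refine ⟨max N N', fun n hn => ?_⟩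
    rw [map_add, LinearMap.add_apply, h n (by omega), h' n (by omega), ← sum_add_distrib]
    simp only [map_add, smul_add]
  · rintro x x' y ⟨N, h⟩ ⟨N', h'⟩
    refine ⟨max N N', fun n hn => ?_⟩
    rw [map_add, h n (by omega), h' n (by omega), ← sum_add_distrib]
    simp only [map_add, smul_add, LinearMap.add_apply]
  · intro i₁ i₂ u m₁ m₂ j₁ j₂ v n₁ n₂
    refine ⟨m₂ + n₁ + d0 i₂ + 1, fun N hN => ?_⟩
    simp only [leftProd_mono, rightProd_mono]
    by_cases h : i₂ = j₁
    swap
    · simp [h, Ne.symm h]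
    subst h
    simp only [if_true, map_zsmul]
    have key := congr($(sum_descFactorial_taylor (F := F) (R := Module.End F (DSpace A))
      (shift_commute (F := F) (A := A)) n
      (m₂ + n₁ + d0 i₂) N hN) (mono i₁ j₂ (u * v) m₁ n₂))
    simp only [LinearMap.sum_apply, LinearMap.smul_apply, Module.End.mul_apply,
      shiftRight_pow_mono, shiftLeft_pow_mono, ← dd_eq_shift] at key
    have hs : (-1 : F) ^ m₂ = (-1) ^ (n₁ + d0 i₂) * (-1) ^ (m₂ + n₁ + d0 i₂) := by
      rw [← pow_add]; refine neg_one_pow_congr ?_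
      rw [Nat.even_iff, Nat.even_iff]; omega
    by_cases hn : n ≤ m₂ + n₁ + d0 i₂
    swap
    · rw [Nat.descFactorial_of_lt (by omega)]
      simp only [Nat.cast_zero, mul_zero, zero_smul]
      refine (sum_eq_zero fun r _ => ?_).symm
      rw [Nat.descFactorial_of_lt (by omega)]; simp
    rw [← Int.cast_smul_eq_zsmul F]
    push_cast
    rw [hs, mul_assoc, mul_smul, Nat.add_sub_assoc hn, ← key, smul_sum]
    refine sum_congr rfl fun r hr => ?_
    by_cases hr : n + r ≤ m₂ + n₁ + d0 i₂
    swap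
    · rw [Nat.descFactorial_of_lt (by omega), Nat.descFactorial_of_lt (by omega)]; simp
    rw [show n₁ + m₂ + d0 i₂ = m₂ + n₁ + d0 i₂ by omega, Nat.add_sub_assoc hr,
      ← Int.cast_smul_eq_zsmul F, smul_smul, smul_smul]
    congr 1
    push_cast; ring

theorem rightProd_eq_sum [CharZero F] (n : ℕ) (U V : DSpace A) :
    ∃ N₀, ∀ N ≥ N₀, rightProd F n U V = ∑ r ∈ range N,
      ((-1 : F) ^ (n + r) * ((r.factorial : F))⁻¹) • (dd F ^ r) (leftProd F (n + r) V U) := by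
  refine DSpace.induction_mono₂ F (p := fun U V => ∃ N₀, ∀ N ≥ N₀, rightProd F n U V =
    ∑ r ∈ range N, ((-1 : F) ^ (n + r) * ((r.factorial : F))⁻¹) •
      (dd F ^ r) (leftProd F (n + r) V U)) U V ?_ ?_ ?_ ?_ ?_
  · exact fun _ => ⟨0, by simp⟩
  · exact fun _ => ⟨0, by simp⟩
  · rintro x x' y ⟨N, h⟩ ⟨N', h'⟩
    refine ⟨max N N', fun n hn => ?_⟩
    rw [map_add, LinearMap.add_apply, h n (by omega), h' n (by omega), ← sum_add_distrib]
    simp only [map_add, smul_add]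
  · rintro x x' y ⟨N, h⟩ ⟨N', h'⟩
    refine ⟨max N N', fun n hn => ?_⟩
    rw [map_add, h n (by omega), h' n (by omega), ← sum_add_distrib]
    simp only [map_add, smul_add, LinearMap.add_apply]
  · intro i₁ i₂ u m₁ m₂ j₁ j₂ v n₁ n₂
    refine ⟨m₁ + n₂ + d0 i₁ + 1, fun N hN => ?_⟩
    simp only [leftProd_mono, rightProd_mono]
    by_cases h : i₁ = j₂
    swap
    · simp [h, Ne.symm h]
    subst h
    simp only [if_true, map_zsmul]
    have key := congr($(sum_descFactorial_taylor (F := F) (R := Module.End F (DSpace A))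
      (shift_commute (F := F) (A := A)).symm n
      (m₁ + n₂ + d0 i₁) N hN) (mono j₁ i₂ (v * u) n₁ m₂))
    simp only [LinearMap.sum_apply, LinearMap.smul_apply, Module.End.mul_apply,
      shiftRight_pow_mono, shiftLeft_pow_mono, add_comm (shiftRight F), ← dd_eq_shift] at key
    have hs : (-1 : F) ^ (m₁ + d0 i₁) = (-1) ^ n₂ * (-1) ^ (m₁ + n₂ + d0 i₁) := by
      rw [← pow_add]; refine neg_one_pow_congr ?_
      rw [Nat.even_iff, Nat.even_iff]; omega
    by_cases hn : n ≤ m₁ + n₂ + d0 i₁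
    swap
    · rw [Nat.descFactorial_of_lt (by omega)]
      simp only [Nat.cast_zero, mul_zero, zero_smul]
      refine (sum_eq_zero fun r _ => ?_).symm
      rw [Nat.descFactorial_of_lt (by omega)]; simp
    rw [← Int.cast_smul_eq_zsmul F]
    push_cast
    rw [hs, mul_assoc, mul_smul, Nat.add_sub_assoc hn, ← key, smul_sum]
    refine sum_congr rfl fun r hr => ?_
    by_cases hr : n + r ≤ m₁ + n₂ + d0 i₁
    swap
    · rw [Nat.descFactorial_of_lt (by omega), Nat.descFactorial_of_lt (by omega)]; simp
    rw [show n₂ + m₁ + d0 i₁ = m₁ + n₂ + d0 i₁ by omega, Nat.add_sub_assoc hr,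
      ← Int.cast_smul_eq_zsmul F, smul_smul, smul_smul]
    congr 1
    push_cast; ring

end Conformal

/-! ### The axioms of a conformal superalgebra -/

section ParityParts

open Finset

variable (F : Type*) (A : Type*) [Field F] [Ring A] [Algebra F A]

/-- The span of the `u_{[i,j]}(m,n)` with `i + j = s`, without restriction on `u`. -/
noncomputable def parityPart (s : ZMod 2) : Submodule F (DSpace A) :=
  Submodule.span F {x | ∃ (i j : ZMod 2) (u : A) (m n : ℕ), i + j = s ∧ x = mono i j u m n}

variable {F A}

theorem mono_mem_parityPart {i j s : ZMod 2} (h : i + j = s) (u : A) (m n : ℕ) :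
    mono i j u m n ∈ parityPart F A s :=
  Submodule.subset_span ⟨i, j, u, m, n, h, rfl⟩

theorem disjoint_parityPart : Disjoint (parityPart F A 0) (parityPart F A 1) := by
  have h : ∀ s, parityPart F A s ≤ Finsupp.supported A F {d | d.1 + d.2.1 = s} := by
    intro s
    refine Submodule.span_le.2 ?_
    rintro _ ⟨i, j, u, m, n, h, rfl⟩
    rw [mono, ← Int.cast_smul_eq_zsmul F]
    exact Submodule.smul_mem _ _ (Finsupp.single_mem_supported F u h)
  refine Disjoint.mono (h 0) (h 1) (Finsupp.disjoint_supported_supported ?_)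
  rw [Set.disjoint_left]
  intro d (h0 : _ = _) (h1 : _ = _)
  rw [h0] at h1
  exact absurd h1 (by decide)

theorem parityPart_induction₂ {s t : ZMod 2} {p : DSpace A → DSpace A → Prop} {x y : DSpace A}
    (hx : x ∈ parityPart F A s) (hy : y ∈ parityPart F A t)
    (hm : ∀ i₁ i₂ u m₁ m₂ j₁ j₂ v n₁ n₂, i₁ + i₂ = s → j₁ + j₂ = t →
      p (mono i₁ i₂ u m₁ m₂) (mono j₁ j₂ v n₁ n₂))
    (h0l : ∀ y, p 0 y) (h0r : ∀ x, p x 0)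
    (haddl : ∀ x x' y, p x y → p x' y → p (x + x') y)
    (haddr : ∀ x y y', p x y → p x y' → p x (y + y'))
    (hsmull : ∀ (c : F) x y, p x y → p (c • x) y)
    (hsmulr : ∀ (c : F) x y, p x y → p x (c • y)) : p x y := by
  refine Submodule.span_induction₂ (p := fun x y _ _ => p x y) ?_ (fun y _ => h0l y)
    (fun x _ => h0r x) (fun x x' y _ _ _ => haddl x x' y) (fun x y y' _ _ _ => haddr x y y')
    (fun c x y _ _ => hsmull c x y) (fun c x y _ _ => hsmulr c x y) hx hy
  rintro _ _ ⟨i₁, i₂, u, m₁, m₂, h, rfl⟩ ⟨j₁, j₂, v, n₁, n₂, h', rfl⟩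
  exact hm _ _ _ _ _ _ _ _ _ _ h h'

/-- The sign depends only on the parities, so the splitting into halves extends bilinearly from
`mono`s. -/
theorem modeProd_of_parity {s t : ZMod 2} {x y : DSpace A} (hx : x ∈ parityPart F A s)
    (hy : y ∈ parityPart F A t) (n : ℕ) :
    modeProd F n x y = leftProd F n x y - superSign F s t • rightProd F n x y := by
  refine parityPart_induction₂ (p := fun x y => modeProd F n x y =
    leftProd F n x y - superSign F s t • rightProd F n x y) hx hy ?_ ?_ ?_ ?_ ?_ ?_ ?_
  · rintro i₁ i₂ u m₁ m₂ j₁ j₂ v n₁ n₂ rfl rfl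
    exact modeProd_mono_eq _ _ _ _ _ _ _ _ _ _ _
  · simp
  · simp
  · intro x x' y h h'; simp only [map_add, LinearMap.add_apply, h, h']; module
  · intro x x' y h h'; simp only [map_add, h, h']; module
  · intro c x y h; simp only [map_smul, LinearMap.smul_apply, h]; module
  · intro c x y h; simp only [map_smul, h]; module

theorem leftProd_mem_parityPart {s t : ZMod 2} {x y : DSpace A} (hx : x ∈ parityPart F A s)
    (hy : y ∈ parityPart F A t) (n : ℕ) : leftProd F n x y ∈ parityPart F A (s + t) := by
  refine parityPart_induction₂ (p := fun x y => leftProd F n x y ∈ _) hx hy ?_ ?_ ?_ ?_ ?_ ?_ ?_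
  · rintro i₁ i₂ u m₁ m₂ j₁ j₂ v n₁ n₂ rfl rfl
    rw [leftProd_mono]
    split_ifs with h
    · subst h
      refine zsmul_mem (mono_mem_parityPart ?_ _ _ _) _
      clear * -; revert i₁ i₂ j₂; decide
    · exact zero_mem _
  · simp
  · simp
  · intro x x' y h h'; simpa only [map_add, LinearMap.add_apply] using add_mem h h'
  · intro x x' y h h'; simpa only [map_add] using add_mem h h'
  · intro c x y h; simpa only [map_smul, LinearMap.smul_apply] using Submodule.smul_mem _ c h
  · intro c x y h; simpa only [map_smul, LinearMap.smul_apply] using Submodule.smul_mem _ c h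

theorem rightProd_mem_parityPart {s t : ZMod 2} {x y : DSpace A} (hx : x ∈ parityPart F A s)
    (hy : y ∈ parityPart F A t) (n : ℕ) : rightProd F n x y ∈ parityPart F A (s + t) := by
  refine parityPart_induction₂ (p := fun x y => rightProd F n x y ∈ _) hx hy ?_ ?_ ?_ ?_ ?_ ?_ ?_
  · rintro i₁ i₂ u m₁ m₂ j₁ j₂ v n₁ n₂ rfl rfl
    rw [rightProd_mono]
    split_ifs with h
    · subst h
      refine zsmul_mem (mono_mem_parityPart ?_ _ _ _) _
      clear * -; revert i₁ i₂ j₁; decide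
    · exact zero_mem _
  · simp
  · simp
  · intro x x' y h h'; simpa only [map_add, LinearMap.add_apply] using add_mem h h'
  · intro x x' y h h'; simpa only [map_add] using add_mem h h'
  · intro c x y h; simpa only [map_smul, LinearMap.smul_apply] using Submodule.smul_mem _ c h
  · intro c x y h; simpa only [map_smul, LinearMap.smul_apply] using Submodule.smul_mem _ c h

theorem modeProd_mem_parityPart {s t : ZMod 2} {x y : DSpace A} (hx : x ∈ parityPart F A s)
    (hy : y ∈ parityPart F A t) (n : ℕ) : modeProd F n x y ∈ parityPart F A (s + t) := by
  rw [modeProd_of_parity hx hy]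
  exact sub_mem (leftProd_mem_parityPart hx hy n)
    (Submodule.smul_mem _ _ (rightProd_mem_parityPart hx hy n))

theorem dd_mem_parityPart {s : ZMod 2} {x : DSpace A} (hx : x ∈ parityPart F A s) :
    dd F x ∈ parityPart F A s := by
  refine Submodule.span_induction (p := fun x _ => dd F x ∈ parityPart F A s) ?_ ?_ ?_ ?_ hx
  · rintro _ ⟨i, j, u, m, n, h, rfl⟩
    rw [dd_mono]
    exact add_mem (mono_mem_parityPart h _ _ _) (mono_mem_parityPart h _ _ _)
  · simp
  · intro x y _ _ h h'; simpa using add_mem h h'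
  · intro c x _ h; simpa using Submodule.smul_mem _ c h

variable [CharZero F]

/-- Expanding the right side into halves gives four sums, evaluated by the four composition laws:
only left-left and right-right compositions appear. On the left side the mixed compositions cancel,
since left and right multiplications commute and signs square to 1. -/
theorem modeProd_jacobi {i j k : ZMod 2} {u v w : DSpace A} (hu : u ∈ parityPart F A i)
    (hv : v ∈ parityPart F A j) (hw : w ∈ parityPart F A k) (m n : ℕ) :
    modeProd F m u (modeProd F n v w) - superSign F i j • modeProd F n v (modeProd F m u w) =
      ∑ r ∈ range (m + 1), (m.choose r : F) •
        modeProd F (m + n - r) (modeProd F r u v) w := by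
  have hR : ∑ r ∈ range (m + 1), (m.choose r : F) •
        modeProd F (m + n - r) (modeProd F r u v) w =
      leftProd F m u (leftProd F n v w) - superSign F i j • leftProd F n v (leftProd F m u w) -
      superSign F (i + j) k • (rightProd F n v (rightProd F m u w) -
        superSign F i j • rightProd F m u (rightProd F n v w)) := by
    rw [leftProd_leftProd m n u v w, leftProd_leftProd_swap m n u v w,
      rightProd_rightProd m n u v w, rightProd_rightProd_swap m n u v w]
    rw [smul_sum, smul_sum, ← sum_sub_distrib, ← sum_sub_distrib, smul_sum, ← sum_sub_distrib]
    refine sum_congr rfl fun r _ => ?_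
    rw [modeProd_of_parity (modeProd_mem_parityPart hu hv r) hw, modeProd_of_parity hu hv]
    simp only [map_sub, map_smul, LinearMap.sub_apply, LinearMap.smul_apply,
      ← Int.cast_smul_eq_zsmul F, Int.cast_natCast]
    module
  rw [hR, modeProd_of_parity hu (modeProd_mem_parityPart hv hw n),
    modeProd_of_parity hv (modeProd_mem_parityPart hu hw m), modeProd_of_parity hv hw,
    modeProd_of_parity hu hw]
  simp only [map_sub, map_smul, superSign_add_left, superSign_add_right, superSign_comm j i,
    leftProd_rightProd_comm]
  have h := superSign_mul_self (F := F) i j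
  generalize superSign F i j = a at *
  generalize superSign F i k = b at *
  generalize superSign F j k = c at *
  match_scalars <;> grind

theorem modeProd_skew {i j : ZMod 2} {u v : DSpace A} (hu : u ∈ parityPart F A i)
    (hv : v ∈ parityPart F A j) (n N : ℕ) (hN : ∀ m ≥ N, modeProd F m v u = 0) :
    modeProd F n u v = superSign F i j • ∑ r ∈ range N,
      ((-1 : F) ^ (n + r + 1) * ((r.factorial : F))⁻¹) •
        (dd F ^ r) (modeProd F (n + r) v u) := by
  obtain ⟨N₁, h₁⟩ := leftProd_eq_sum (F := F) n u v
  obtain ⟨N₂, h₂⟩ := rightProd_eq_sum (F := F) n u v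
  -- N bounds only the full products; the expansions of the halves may need a longer range, on which
  -- the added terms of the full sum are zero.
  have hs : range N ⊆ range (N + N₁ + N₂) := range_mono (by omega)
  rw [sum_subset hs, modeProd_of_parity hu hv, h₁ (N + N₁ + N₂) (by omega),
    h₂ (N + N₁ + N₂) (by omega), smul_sum, smul_sum, ← sum_sub_distrib]
  · refine sum_congr rfl fun r _ => ?_
    rw [modeProd_of_parity hv hu, superSign_comm j i]
    simp only [map_sub, map_smul]
    have h := superSign_mul_self (F := F) i j
    match_scalars
    · linear_combination (-(-1) ^ (n + r) * (r.factorial : F)⁻¹) * h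
    · ring
  · intro r _ hr
    rw [hN _ (by simp at hr; omega)]; simp

theorem modeProd_dd_zero {i j : ZMod 2} {u v : DSpace A} (hu : u ∈ parityPart F A i)
    (hv : v ∈ parityPart F A j) : modeProd F 0 (dd F u) v = 0 := by
  rw [modeProd_of_parity (dd_mem_parityPart hu) hv, leftProd_dd_zero, rightProd_dd_zero]; simp

theorem modeProd_dd_succ {i j : ZMod 2} {u v : DSpace A} (hu : u ∈ parityPart F A i)
    (hv : v ∈ parityPart F A j) (n : ℕ) :
    modeProd F (n + 1) (dd F u) v = -((n : F) + 1) • modeProd F n u v := by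
  rw [modeProd_of_parity (dd_mem_parityPart hu) hv, leftProd_dd_succ, rightProd_dd_succ,
    modeProd_of_parity hu hv]
  module

theorem modeProd_finite {i j : ZMod 2} {u v : DSpace A} (hu : u ∈ parityPart F A i)
    (hv : v ∈ parityPart F A j) : ∃ N, ∀ n ≥ N, modeProd F n u v = 0 := by
  obtain ⟨N₁, h₁⟩ := leftProd_finite (F := F) u v
  obtain ⟨N₂, h₂⟩ := rightProd_finite (F := F) u v
  refine ⟨N₁ + N₂, fun n hn => ?_⟩
  rw [modeProd_of_parity hu hv, h₁ n (by omega), h₂ n (by omega)]; simp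

/-- Graded subspaces of `M_{2×2}(A) ⊗ F[t₁,t₂]` closed under the operations are conformal
superalgebras. -/
theorem isConformalSuperalgebra_of_le {R : ZMod 2 → Submodule F (DSpace A)}
    (hR : ∀ s, R s ≤ parityPart F A s) (hD : ∀ i, ∀ u ∈ R i, dd F u ∈ R i)
    (hY : ∀ i j, ∀ u ∈ R i, ∀ v ∈ R j, ∀ n, modeProd F n u v ∈ R (i + j)) :
    IsConformalSuperalgebra (dd F) (modeProd F) R where
  disjoint := disjoint_parityPart.mono (hR 0) (hR 1)
  map_D := hD
  map_Y := hY
  finite u hu v hv := by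
    obtain ⟨u₀, hu₀, u₁, hu₁, rfl⟩ := Submodule.mem_sup.1 hu
    obtain ⟨v₀, hv₀, v₁, hv₁, rfl⟩ := Submodule.mem_sup.1 hv
    obtain ⟨N₁, h₁⟩ := modeProd_finite (hR _ hu₀) (hR _ hv₀)
    obtain ⟨N₂, h₂⟩ := modeProd_finite (hR _ hu₀) (hR _ hv₁)
    obtain ⟨N₃, h₃⟩ := modeProd_finite (hR _ hu₁) (hR _ hv₀)
    obtain ⟨N₄, h₄⟩ := modeProd_finite (hR _ hu₁) (hR _ hv₁)
    refine ⟨N₁ + N₂ + N₃ + N₄, fun n hn => ?_⟩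
    simp only [map_add, LinearMap.add_apply]
    rw [h₁ n (by omega), h₂ n (by omega), h₃ n (by omega), h₄ n (by omega)]; simp
  deriv_zero u hu v hv := by
    obtain ⟨u₀, hu₀, u₁, hu₁, rfl⟩ := Submodule.mem_sup.1 hu
    obtain ⟨v₀, hv₀, v₁, hv₁, rfl⟩ := Submodule.mem_sup.1 hv
    simp only [map_add, LinearMap.add_apply]
    rw [modeProd_dd_zero (hR _ hu₀) (hR _ hv₀), modeProd_dd_zero (hR _ hu₀) (hR _ hv₁),
      modeProd_dd_zero (hR _ hu₁) (hR _ hv₀), modeProd_dd_zero (hR _ hu₁) (hR _ hv₁)]; simp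
  deriv_succ u hu v hv n := by
    obtain ⟨u₀, hu₀, u₁, hu₁, rfl⟩ := Submodule.mem_sup.1 hu
    obtain ⟨v₀, hv₀, v₁, hv₁, rfl⟩ := Submodule.mem_sup.1 hv
    simp only [map_add, LinearMap.add_apply]
    rw [modeProd_dd_succ (hR _ hu₀) (hR _ hv₀), modeProd_dd_succ (hR _ hu₀) (hR _ hv₁),
      modeProd_dd_succ (hR _ hu₁) (hR _ hv₀), modeProd_dd_succ (hR _ hu₁) (hR _ hv₁)]
    module
  skew i j u hu v hv n N hN := modeProd_skew (hR _ hu) (hR _ hv) n N hN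
  jacobi i j u hu v hv w hw m n := by
    obtain ⟨w₀, hw₀, w₁, hw₁, rfl⟩ := Submodule.mem_sup.1 hw
    have h₀ := modeProd_jacobi (hR _ hu) (hR _ hv) (hR _ hw₀) m n
    have h₁ := modeProd_jacobi (hR _ hu) (hR _ hv) (hR _ hw₁) m n
    simp only [map_add, smul_add, sum_add_distrib, ← h₀, ← h₁]
    module

end ParityParts

/-! ### The involutive automorphism induced by an involutive anti-automorphism -/

section Twist

open Finset

variable {F : Type*} {A : Type*} [Field F] [Ring A] [Algebra F A]

/-- The map `u_{[i,j]}(m,n) ↦ (-1)^{ij} σ(u)_{[j,i]}(n,m)`. -/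
noncomputable def twist (σ : A →ₗ[F] A) : DSpace A →ₗ[F] DSpace A :=
  Finsupp.lsum F fun d => superSign F d.1 d.2.1 •
    Finsupp.lsingle (d.2.1, d.1, d.2.2.2, d.2.2.1) ∘ₗ σ

theorem twist_elt (σ : A →ₗ[F] A) (i j : ZMod 2) (u : A) (m n : ℕ) :
    twist σ (elt i j u m n) = superSign F i j • elt j i (σ u) n m := by
  simp only [twist, elt, Finsupp.lsum_apply, LinearMap.map_zero,
    Finsupp.sum_single_index, LinearMap.smul_apply, LinearMap.comp_apply, Finsupp.lsingle_apply]

theorem twist_mono (σ : A →ₗ[F] A) (i j : ZMod 2) (u : A) (m n : ℕ) :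
    twist σ (mono i j u m n) = superSign F i j • mono j i (σ u) n m := by
  rw [mono, map_zsmul, twist_elt, mono, smul_comm, mul_comm]

theorem twist_twist [CharZero F] {σ : A →ₗ[F] A} (hσ : ∀ u, σ (σ u) = u) (x : DSpace A) :
    twist σ (twist σ x) = x := by
  have : twist σ ∘ₗ twist σ = LinearMap.id := by
    refine DSpace.linearMap_ext fun i j u m n => ?_
    rw [LinearMap.comp_apply, twist_mono, map_smul, twist_mono, hσ, smul_smul,
      superSign_comm j i, superSign_mul_self, one_smul, LinearMap.id_apply]
  exact congr($this x)

theorem twist_dd [CharZero F] (σ : A →ₗ[F] A) (x : DSpace A) :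
    twist σ (dd F x) = dd F (twist σ x) := by
  have : twist σ ∘ₗ dd F = dd F ∘ₗ twist σ := by
    refine DSpace.linearMap_ext fun i j u m n => ?_
    simp only [LinearMap.comp_apply, dd_mono, map_add, twist_mono, map_smul]
    module
  exact congr($this x)

/-- This and the next identity show that (-1)^{ij} is the right normalisation of the twist: it
absorbs both the supercommutator sign and the (-1)^`d0` that distinguishes `rightProd` from
`leftProd`. -/
theorem superSign_twist_left (i j k : ZMod 2) :
    superSign F i k = -(superSign F i j * superSign F j k * superSign F (i + j) (j + k) *
      (-1) ^ d0 j) := by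
  have h0 := fun i => superSign_zero_left (F := F) i
  have h0' := fun i => (superSign_comm (F := F) i 0).trans (h0 i)
  have h11 := superSign_one_one (F := F)
  rcases ZMod.eq_zero_or_one i with rfl | rfl <;> rcases ZMod.eq_zero_or_one j with rfl | rfl <;>
    rcases ZMod.eq_zero_or_one k with rfl | rfl <;>
    simp [h0, h0', h11, d0, show (1 + 1 : ZMod 2) = 0 from rfl]

theorem superSign_twist_right (i j k : ZMod 2) :
    superSign F k j * superSign F (i + j) (k + i) * (-1) ^ d0 i =
      -(superSign F i j * superSign F k i) := by
  have h0 := fun i => superSign_zero_left (F := F) i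
  have h0' := fun i => (superSign_comm (F := F) i 0).trans (h0 i)
  have h11 := superSign_one_one (F := F)
  rcases ZMod.eq_zero_or_one i with rfl | rfl <;> rcases ZMod.eq_zero_or_one j with rfl | rfl <;>
    rcases ZMod.eq_zero_or_one k with rfl | rfl <;>
    simp [h0, h0', h11, d0, show (1 + 1 : ZMod 2) = 0 from rfl]

/-- Since σ reverses products and the twist exchanges indices and exponents, the left half of a
product becomes the right half of the product of the images, and conversely (`hl`, `hr`). -/
theorem twist_modeProd [CharZero F] {σ : A →ₗ[F] A} (hσ : ∀ u v, σ (u * v) = σ v * σ u) (n : ℕ)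
    (x y : DSpace A) :
    twist σ (modeProd F n x y) = modeProd F n (twist σ x) (twist σ y) := by
  have : (modeProd F n).compr₂ (twist σ) = (modeProd F n).compl₁₂ (twist σ) (twist σ) := by
    refine DSpace.linearMap_ext fun i₁ i₂ u m₁ m₂ => DSpace.linearMap_ext fun j₁ j₂ v n₁ n₂ => ?_
    simp only [LinearMap.compr₂_apply, LinearMap.compl₁₂_apply, twist_mono, map_smul,
      LinearMap.smul_apply, modeProd_mono_eq, leftProd_mono, rightProd_mono, map_sub]
    have hl : (twist σ) (if i₂ = j₁ then ((-1) ^ m₂ * ((m₂ + n₁ + d0 i₂).descFactorial n : ℤ)) •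
          mono i₁ j₂ (u * v) (m₁ + (m₂ + n₁ + d0 i₂) - n) n₂ else 0) =
        -((superSign F i₁ i₂ * superSign F j₁ j₂ * superSign F (i₁ + i₂) (j₁ + j₂)) •
          if i₂ = j₁ then ((-1) ^ (m₂ + d0 i₂) * ((m₂ + n₁ + d0 i₂).descFactorial n : ℤ)) •
            mono j₂ i₁ (σ v * σ u) n₂ (m₁ + (m₂ + n₁ + d0 i₂) - n) else 0) := by
      split_ifs with h
      · subst h
        rw [map_zsmul, twist_mono, hσ, superSign_twist_left i₁ i₂ j₂,
          ← Int.cast_smul_eq_zsmul F, ← Int.cast_smul_eq_zsmul F, smul_smul, smul_smul, ← neg_smul]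
        congr 1
        have h2 : (-1 : F) ^ d0 i₂ * (-1) ^ d0 i₂ = 1 := by rw [← mul_pow]; simp
        push_cast
        rw [pow_add]
        ring
      · simp
    have hr : (twist σ) (superSign F (i₁ + i₂) (j₁ + j₂) •
          if i₁ = j₂ then ((-1) ^ (m₁ + d0 i₁) * ((m₁ + n₂ + d0 i₁).descFactorial n : ℤ)) •
            mono j₁ i₂ (v * u) n₁ (m₂ + (m₁ + n₂ + d0 i₁) - n) else 0) =
        -((superSign F i₁ i₂ * superSign F j₁ j₂) •
          if i₁ = j₂ then ((-1) ^ m₁ * ((m₁ + n₂ + d0 i₁).descFactorial n : ℤ)) •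
            mono i₂ j₁ (σ u * σ v) (m₂ + (m₁ + n₂ + d0 i₁) - n) n₁ else 0) := by
      split_ifs with h
      · subst h
        rw [map_smul, map_zsmul, twist_mono, hσ,
          ← Int.cast_smul_eq_zsmul F, ← Int.cast_smul_eq_zsmul F, smul_smul, smul_smul, smul_smul,
          ← neg_smul]
        congr 1
        push_cast
        rw [pow_add]
        linear_combination ((-1) ^ m₁ * ((m₁ + n₂ + d0 i₁).descFactorial n : F)) *
          superSign_twist_right (F := F) i₁ i₂ j₁
      · simp
    rw [hl, ← map_smul, hr, add_comm i₂ i₁, add_comm j₂ j₁]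
    module
  exact congr($this x y)

end Twist

/-! ### The involution σ₂ in matrix coordinates -/

section Sigma

variable {ℓ₁ ℓ₂ : ℕ}

/-- The index paired with a given one by the matrix `S`. -/
def conjIdx : KIdx ℓ₁ ℓ₂ → KIdx ℓ₁ ℓ₂ := Sum.map Sum.swap Sum.swap

theorem conjIdx_conjIdx (p : KIdx ℓ₁ ℓ₂) : conjIdx (conjIdx p) = p := by
  rcases p with (p | p) | (p | p) <;> rfl

theorem conjIdx_ne (p : KIdx ℓ₁ ℓ₂) : conjIdx p ≠ p := by
  rcases p with (p | p) | (p | p) <;> simp [conjIdx]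

theorem idxParity_conjIdx (p : KIdx ℓ₁ ℓ₂) : idxParity (conjIdx p) = idxParity p := by
  rcases p with (p | p) | (p | p) <;> rfl

theorem conjIdx_eq_iff {p q : KIdx ℓ₁ ℓ₂} : conjIdx p = q ↔ p = conjIdx q :=
  ⟨fun h => by rw [← h, conjIdx_conjIdx], fun h => by rw [h, conjIdx_conjIdx]⟩

/-- `conjIdx` as a permutation. -/
def conjEquiv : Equiv.Perm (KIdx ℓ₁ ℓ₂) :=
  ⟨conjIdx, conjIdx, conjIdx_conjIdx, conjIdx_conjIdx⟩

variable (F : Type*) [Field F]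

/-- The sign of the nonzero entry of `S` in a given row. -/
def idxSign : KIdx ℓ₁ ℓ₂ → F
  | Sum.inl (Sum.inl _) => 1
  | Sum.inl (Sum.inr _) => -1
  | Sum.inr (Sum.inl _) => 1
  | Sum.inr (Sum.inr _) => -1

theorem idxSign_mul_self (p : KIdx ℓ₁ ℓ₂) : idxSign F p * idxSign F p = 1 := by
  rcases p with (p | p) | (p | p) <;> simp [idxSign]

theorem idxSign_conjIdx (p : KIdx ℓ₁ ℓ₂) : idxSign F (conjIdx p) = -idxSign F p := by
  rcases p with (p | p) | (p | p) <;> simp [idxSign, conjIdx]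

theorem matS_apply (p q : KIdx ℓ₁ ℓ₂) :
    matS F ℓ₁ ℓ₂ p q = if q = conjIdx p then idxSign F p else 0 := by
  rcases p with (p | p) | (p | p) <;> rcases q with (q | q) | (q | q) <;>
    simp [matS, conjIdx, idxSign, Matrix.fromBlocks, Matrix.one_apply, eq_comm] <;>
    split_ifs <;> simp

theorem matS_mul_apply (M : MatK F ℓ₁ ℓ₂) (p q : KIdx ℓ₁ ℓ₂) :
    (matS F ℓ₁ ℓ₂ * M) p q = idxSign F p * M (conjIdx p) q := by
  simp [Matrix.mul_apply, matS_apply]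

theorem mul_matS_apply (M : MatK F ℓ₁ ℓ₂) (p q : KIdx ℓ₁ ℓ₂) :
    (M * matS F ℓ₁ ℓ₂) p q = -(M p (conjIdx q) * idxSign F q) := by
  have h : ∀ x, (q = conjIdx x) = (x = conjIdx q) := fun x => by
    rw [← conjIdx_eq_iff, eq_comm (a := conjIdx q), eq_comm]
  simp only [Matrix.mul_apply, matS_apply, h]
  simp [idxSign_conjIdx]

theorem matS_inv : (matS F ℓ₁ ℓ₂)⁻¹ = -matS F ℓ₁ ℓ₂ := by
  refine Matrix.inv_eq_right_inv ?_
  ext p q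
  rw [mul_neg, Matrix.neg_apply, matS_mul_apply, matS_apply, conjIdx_conjIdx, idxSign_conjIdx,
    Matrix.one_apply]
  simp only [eq_comm (a := q)]
  split_ifs
  · rw [mul_neg, neg_neg, idxSign_mul_self]
  · simp

theorem sigma2_apply (M : MatK F ℓ₁ ℓ₂) (p q : KIdx ℓ₁ ℓ₂) :
    sigma2 F ℓ₁ ℓ₂ M p q = idxSign F p * idxSign F q * M (conjIdx q) (conjIdx p) := by
  rw [sigma2, matS_inv, mul_neg, Matrix.neg_apply, mul_matS_apply, matS_mul_apply,
    Matrix.transpose_apply]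
  ring

/-- `σ₂` as a linear map. -/
noncomputable def sigmaLin : MatK F ℓ₁ ℓ₂ →ₗ[F] MatK F ℓ₁ ℓ₂ where
  toFun := sigma2 F ℓ₁ ℓ₂
  map_add' M N := by ext p q; simp only [sigma2_apply, Matrix.add_apply]; ring
  map_smul' c M := by
    ext p q; simp only [sigma2_apply, Matrix.smul_apply, smul_eq_mul, RingHom.id_apply]; ring

theorem sigmaLin_apply (M : MatK F ℓ₁ ℓ₂) : sigmaLin F M = sigma2 F ℓ₁ ℓ₂ M := rfl

theorem sigmaLin_mul (M N : MatK F ℓ₁ ℓ₂) :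
    sigmaLin F (M * N) = sigmaLin F N * sigmaLin F M := by
  ext p q
  simp only [sigmaLin_apply, sigma2_apply, Matrix.mul_apply, Finset.mul_sum]
  refine Fintype.sum_equiv conjEquiv _ _ fun r => ?_
  change _ = idxSign F p * idxSign F (conjIdx r) * N (conjIdx (conjIdx r)) (conjIdx p) *
    (idxSign F (conjIdx r) * idxSign F q * M (conjIdx q) (conjIdx (conjIdx r)))
  rw [conjIdx_conjIdx]
  linear_combination (-(idxSign F p * N r (conjIdx p) * idxSign F q * M (conjIdx q) r)) *
    idxSign_mul_self F (conjIdx r)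

theorem sigmaLin_sigmaLin (M : MatK F ℓ₁ ℓ₂) : sigmaLin F (sigmaLin F M) = M := by
  ext p q
  simp only [sigmaLin_apply, sigma2_apply, conjIdx_conjIdx, idxSign_conjIdx]
  linear_combination (M p q * idxSign F q * idxSign F q) * idxSign_mul_self F p +
    (M p q) * idxSign_mul_self F q

theorem sigmaLin_single (p q : KIdx ℓ₁ ℓ₂) (c : F) :
    sigmaLin F (Matrix.single p q c) =
      (idxSign F p * idxSign F q) • Matrix.single (conjIdx q) (conjIdx p) c := by
  ext r s
  simp only [sigmaLin_apply, sigma2_apply, Matrix.smul_apply, Matrix.single_apply, smul_eq_mul,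
    conjIdx_eq_iff, eq_comm (a := p), eq_comm (a := q)]
  by_cases h1 : r = conjIdx q <;> by_cases h2 : s = conjIdx p
  · subst h1 h2; simp [idxSign_conjIdx, mul_comm]
  all_goals simp [h1, h2]

theorem sigmaLin_mem_matBlock {i j : ZMod 2} {M : MatK F ℓ₁ ℓ₂} (h : M ∈ matBlock F ℓ₁ ℓ₂ i j) :
    sigmaLin F M ∈ matBlock F ℓ₁ ℓ₂ j i := by
  intro p q hpq
  rw [sigmaLin_apply, sigma2_apply] at hpq
  have := h _ _ (right_ne_zero_of_mul hpq)
  rw [idxParity_conjIdx, idxParity_conjIdx] at this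
  exact this.symm

theorem mul_mem_matBlock {i j k : ZMod 2} {M N : MatK F ℓ₁ ℓ₂} (hM : M ∈ matBlock F ℓ₁ ℓ₂ i j)
    (hN : N ∈ matBlock F ℓ₁ ℓ₂ j k) : M * N ∈ matBlock F ℓ₁ ℓ₂ i k := by
  intro p q hpq
  rw [Matrix.mul_apply] at hpq
  obtain ⟨r, _, hr⟩ := Finset.exists_ne_zero_of_sum_ne_zero hpq
  exact ⟨(hM _ _ (left_ne_zero_of_mul hr)).1, (hN _ _ (right_ne_zero_of_mul hr)).2⟩

end Sigma

/-! ### R† as the image of 1 + τ -/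

section Dagger

variable (F : Type*) [Field F] (ℓ₁ ℓ₂ : ℕ)

/-- The span of the `u_{[i,j]}(m,n)` with `i + j = s` and `u` in the block `(i,j)`. -/
noncomputable def blockPart (s : ZMod 2) : Submodule F (DSpace (MatK F ℓ₁ ℓ₂)) :=
  Submodule.span F {x | ∃ (i j : ZMod 2) (u : MatK F ℓ₁ ℓ₂) (m n : ℕ),
    i + j = s ∧ u ∈ matBlock F ℓ₁ ℓ₂ i j ∧ x = mono i j u m n}

variable {F ℓ₁ ℓ₂}

theorem mono_mem_blockPart {i j s : ZMod 2} (h : i + j = s) {u : MatK F ℓ₁ ℓ₂}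
    (hu : u ∈ matBlock F ℓ₁ ℓ₂ i j) (m n : ℕ) : mono i j u m n ∈ blockPart F ℓ₁ ℓ₂ s :=
  Submodule.subset_span ⟨i, j, u, m, n, h, hu, rfl⟩

theorem blockPart_le_parityPart (s : ZMod 2) :
    blockPart F ℓ₁ ℓ₂ s ≤ parityPart F (MatK F ℓ₁ ℓ₂) s := by
  refine Submodule.span_le.2 ?_
  rintro _ ⟨i, j, u, m, n, h, -, rfl⟩
  exact mono_mem_parityPart h u m n

theorem modeProd_mem_blockPart {s t : ZMod 2} {x y : DSpace (MatK F ℓ₁ ℓ₂)}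
    (hx : x ∈ blockPart F ℓ₁ ℓ₂ s) (hy : y ∈ blockPart F ℓ₁ ℓ₂ t) (n : ℕ) :
    modeProd F n x y ∈ blockPart F ℓ₁ ℓ₂ (s + t) := by
  refine Submodule.span_induction₂ (p := fun x y _ _ => modeProd F n x y ∈ _)
    ?_ ?_ ?_ ?_ ?_ ?_ ?_ hx hy
  · rintro _ _ ⟨i₁, i₂, u, m₁, m₂, rfl, hu, rfl⟩ ⟨j₁, j₂, v, n₁, n₂, rfl, hv, rfl⟩
    rw [modeProd_mono_eq, leftProd_mono, rightProd_mono]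
    refine sub_mem ?_ (Submodule.smul_mem _ _ ?_)
    · split_ifs with h
      · subst h
        refine zsmul_mem (mono_mem_blockPart ?_ (mul_mem_matBlock F hu hv) _ _) _
        clear * -; revert i₁ i₂ j₂; decide
      · exact zero_mem _
    · split_ifs with h
      · subst h
        refine zsmul_mem (mono_mem_blockPart ?_ (mul_mem_matBlock F hv hu) _ _) _
        clear * -; revert i₁ i₂ j₁; decide
      · exact zero_mem _
  · simp
  · simp
  · intro x y z _ _ _ h h'; simpa only [map_add, LinearMap.add_apply] using add_mem h h'
  · intro x y z _ _ _ h h'; simpa only [map_add] using add_mem h h'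
  · intro c x y _ _ h
    simpa only [map_smul, LinearMap.smul_apply] using Submodule.smul_mem _ c h
  · intro c x y _ _ h; simpa only [map_smul] using Submodule.smul_mem _ c h

theorem twist_mem_blockPart {s : ZMod 2} {x : DSpace (MatK F ℓ₁ ℓ₂)}
    (hx : x ∈ blockPart F ℓ₁ ℓ₂ s) : twist (sigmaLin F) x ∈ blockPart F ℓ₁ ℓ₂ s := by
  refine Submodule.span_induction (p := fun x _ => twist (sigmaLin F) x ∈ _) ?_ ?_ ?_ ?_ hx
  · rintro _ ⟨i, j, u, m, n, h, hu, rfl⟩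
    rw [twist_mono]
    exact Submodule.smul_mem _ _ (mono_mem_blockPart ((add_comm j i).trans h)
      (sigmaLin_mem_matBlock F hu) _ _)
  · simp
  · intro x y _ _ h h'; simpa only [map_add] using add_mem h h'
  · intro c x _ h; simpa only [map_smul] using Submodule.smul_mem _ c h

theorem dd_mem_blockPart {s : ZMod 2} {x : DSpace (MatK F ℓ₁ ℓ₂)}
    (hx : x ∈ blockPart F ℓ₁ ℓ₂ s) : dd F x ∈ blockPart F ℓ₁ ℓ₂ s := by
  refine Submodule.span_induction (p := fun x _ => dd F x ∈ _) ?_ ?_ ?_ ?_ hx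
  · rintro _ ⟨i, j, u, m, n, h, hu, rfl⟩
    rw [dd_mono]
    exact add_mem (mono_mem_blockPart h hu _ _) (mono_mem_blockPart h hu _ _)
  · simp
  · intro x y _ _ h h'; simpa only [map_add] using add_mem h h'
  · intro c x _ h; simpa only [map_smul] using Submodule.smul_mem _ c h

variable (F ℓ₁ ℓ₂) in
/-- The projection, up to a factor, onto the elements fixed by the twist. -/
noncomputable def symmetrize : DSpace (MatK F ℓ₁ ℓ₂) →ₗ[F] DSpace (MatK F ℓ₁ ℓ₂) :=
  LinearMap.id + twist (sigmaLin F)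

theorem symmetrize_apply (x : DSpace (MatK F ℓ₁ ℓ₂)) :
    symmetrize F ℓ₁ ℓ₂ x = x + twist (sigmaLin F) x := rfl

variable (F) in
/-- The basis element `E_{p,q}`, in the block determined by `p` and `q`, with exponents `a`, `c`. -/
noncomputable def unitMono (p : KIdx ℓ₁ ℓ₂) (a : ℕ) (q : KIdx ℓ₁ ℓ₂) (c : ℕ) :
    DSpace (MatK F ℓ₁ ℓ₂) :=
  mono (idxParity p) (idxParity q) (Matrix.single p q 1) a c

variable (F) in
/-- The sign relating `unitMono` to its twist. -/
def twistSign (p q : KIdx ℓ₁ ℓ₂) : F :=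
  superSign F (idxParity p) (idxParity q) * (idxSign F p * idxSign F q)

theorem twistSign_mul_self (p q : KIdx ℓ₁ ℓ₂) : twistSign F p q * twistSign F p q = 1 := by
  rw [twistSign]
  linear_combination (idxSign F p * idxSign F q) ^ 2 *
    superSign_mul_self (F := F) (idxParity p) (idxParity q) +
    (idxSign F q) ^ 2 * idxSign_mul_self F p + idxSign_mul_self F q

theorem twist_unitMono (p : KIdx ℓ₁ ℓ₂) (a : ℕ) (q : KIdx ℓ₁ ℓ₂) (c : ℕ) :
    twist (sigmaLin F) (unitMono F p a q c) =
      twistSign F p q • unitMono F (conjIdx q) c (conjIdx p) a := by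
  rw [unitMono, twist_mono, sigmaLin_single, smul_mono, smul_smul, unitMono, idxParity_conjIdx,
    idxParity_conjIdx, twistSign]

theorem blockPart_le_span_unitMono (s : ZMod 2) : blockPart F ℓ₁ ℓ₂ s ≤
    Submodule.span F {x | ∃ p a q c, idxParity p + idxParity q = s ∧ x = unitMono F p a q c} := by
  refine Submodule.span_le.2 ?_
  rintro _ ⟨i, j, u, m, n, rfl, hu, rfl⟩
  have h : mono i j u m n = ∑ p, ∑ q, u p q • mono i j (Matrix.single p q (1 : F)) m n := by
    let f : MatK F ℓ₁ ℓ₂ →ₗ[F] DSpace (MatK F ℓ₁ ℓ₂) :=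
      ⟨⟨fun v => mono i j v m n, fun v w => mono_add i j v w m n⟩,
        fun c v => smul_mono F c i j v m n⟩
    change f u = ∑ p, ∑ q, u p q • f (Matrix.single p q (1 : F))
    conv_lhs => rw [Matrix.matrix_eq_sum_single u]
    simp only [map_sum, ← map_smul, Matrix.smul_single, smul_eq_mul, mul_one]
  rw [h]
  refine sum_mem fun p _ => sum_mem fun q _ => ?_
  by_cases h0 : u p q = 0
  · rw [h0, zero_smul]; exact zero_mem _
  · obtain ⟨hp, hq⟩ := hu p q h0
    refine Submodule.smul_mem _ _ (Submodule.subset_span ⟨p, m, q, n, by rw [hp, hq], ?_⟩)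
    rw [unitMono, hp, hq]

theorem single_mem_matBlock (p q : KIdx ℓ₁ ℓ₂) :
    Matrix.single p q (1 : F) ∈ matBlock F ℓ₁ ℓ₂ (idxParity p) (idxParity q) := by
  intro r s h
  by_contra h'
  refine h (Matrix.single_apply_of_ne _ _ _ _ _ ?_)
  rintro ⟨rfl, rfl⟩
  exact h' ⟨rfl, rfl⟩

theorem unitMono_mem_blockPart (p : KIdx ℓ₁ ℓ₂) (a : ℕ) (q : KIdx ℓ₁ ℓ₂) (c : ℕ) :
    unitMono F p a q c ∈ blockPart F ℓ₁ ℓ₂ (idxParity p + idxParity q) :=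
  mono_mem_blockPart rfl (single_mem_matBlock p q) _ _

theorem RDaggerPart_le_RDagger (s : ZMod 2) : RDaggerPart F ℓ₁ ℓ₂ s ≤ RDagger F ℓ₁ ℓ₂ := by
  rcases ZMod.eq_zero_or_one s with rfl | rfl
  · exact le_sup_left
  · exact le_sup_right

theorem leftProd_unitMono (n : ℕ) (p : KIdx ℓ₁ ℓ₂) (a : ℕ) (q : KIdx ℓ₁ ℓ₂) (c : ℕ)
    (r : KIdx ℓ₁ ℓ₂) (b : ℕ) (s : KIdx ℓ₁ ℓ₂) (d : ℕ) :
    leftProd F n (unitMono F p a q c) (unitMono F r b s d) =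
      if q = r then ((-1) ^ c * ((c + b + d0 (idxParity q)).descFactorial n : ℤ)) •
        unitMono F p (a + (c + b + d0 (idxParity q)) - n) s d else 0 := by
  rw [unitMono, unitMono, leftProd_mono]
  by_cases h : q = r
  · subst h; simp [unitMono]
  · rw [if_neg h, Matrix.single_mul_single_of_ne _ _ _ _ h]
    simp [mono, elt]

theorem rightProd_unitMono (n : ℕ) (p : KIdx ℓ₁ ℓ₂) (a : ℕ) (q : KIdx ℓ₁ ℓ₂) (c : ℕ)
    (r : KIdx ℓ₁ ℓ₂) (b : ℕ) (s : KIdx ℓ₁ ℓ₂) (d : ℕ) :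
    rightProd F n (unitMono F p a q c) (unitMono F r b s d) =
      if p = s then ((-1) ^ (a + d0 (idxParity p)) *
          ((a + d + d0 (idxParity p)).descFactorial n : ℤ)) •
        unitMono F r b q (c + (a + d + d0 (idxParity p)) - n) else 0 := by
  rw [unitMono, unitMono, rightProd_mono]
  by_cases h : p = s
  · subst h; simp [unitMono]
  · rw [if_neg h, Matrix.single_mul_single_of_ne _ _ _ _ (Ne.symm h)]
    simp [mono, elt]

theorem modeProd_unitMono (n : ℕ) (p : KIdx ℓ₁ ℓ₂) (a : ℕ) (q : KIdx ℓ₁ ℓ₂) (c : ℕ)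
    (r : KIdx ℓ₁ ℓ₂) (b : ℕ) (s : KIdx ℓ₁ ℓ₂) (d : ℕ) :
    modeProd F n (unitMono F p a q c) (unitMono F r b s d) =
      leftProd F n (unitMono F p a q c) (unitMono F r b s d) -
        superSign F (idxParity p + idxParity q) (idxParity r + idxParity s) •
          rightProd F n (unitMono F p a q c) (unitMono F r b s d) :=
  modeProd_mono_eq _ _ _ _ _ _ _ _ _ _ _

variable (F) in
/-- The element of `R†` obtained by symmetrizing `unitMono`. -/
noncomputable def daggerElt (p : KIdx ℓ₁ ℓ₂) (a : ℕ) (q : KIdx ℓ₁ ℓ₂) (c : ℕ) :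
    DSpace (MatK F ℓ₁ ℓ₂) :=
  symmetrize F ℓ₁ ℓ₂ (unitMono F p a q c)

theorem daggerElt_eq (p : KIdx ℓ₁ ℓ₂) (a : ℕ) (q : KIdx ℓ₁ ℓ₂) (c : ℕ) :
    daggerElt F p a q c =
      unitMono F p a q c + twistSign F p q • unitMono F (conjIdx q) c (conjIdx p) a := by
  rw [daggerElt, symmetrize_apply, twist_unitMono]

/-- Each spanning element has two descriptions, up to sign, so a fact about the first index carries
over to the second. -/
theorem daggerElt_symm (p : KIdx ℓ₁ ℓ₂) (a : ℕ) (q : KIdx ℓ₁ ℓ₂) (c : ℕ) :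
    daggerElt F (conjIdx q) c (conjIdx p) a = twistSign F p q • daggerElt F p a q c := by
  have h : twistSign F (conjIdx q) (conjIdx p) = twistSign F p q := by
    simp only [twistSign, idxParity_conjIdx, idxSign_conjIdx, superSign_comm (idxParity q)]
    ring
  rw [daggerElt_eq, daggerElt_eq, conjIdx_conjIdx, conjIdx_conjIdx, h, smul_add, smul_smul,
    twistSign_mul_self, one_smul, add_comm]

theorem modeProd_daggerElt_unitMono (n : ℕ) (p : KIdx ℓ₁ ℓ₂) (a : ℕ) (q : KIdx ℓ₁ ℓ₂) (c : ℕ)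
    (r : KIdx ℓ₁ ℓ₂) (b : ℕ) (s : KIdx ℓ₁ ℓ₂) (d : ℕ) :
    modeProd F n (daggerElt F p a q c) (unitMono F r b s d) =
      (if q = r then ((-1) ^ c * ((c + b + d0 (idxParity q)).descFactorial n : ℤ)) •
        unitMono F p (a + (c + b + d0 (idxParity q)) - n) s d else 0) +
      twistSign F p q •
        (if conjIdx p = r then ((-1) ^ a * ((a + b + d0 (idxParity p)).descFactorial n : ℤ)) •
          unitMono F (conjIdx q) (c + (a + b + d0 (idxParity p)) - n) s d else 0) -
      superSign F (idxParity p + idxParity q) (idxParity r + idxParity s) •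
        (if p = s then ((-1) ^ (a + d0 (idxParity p)) *
            ((a + d + d0 (idxParity p)).descFactorial n : ℤ)) •
          unitMono F r b q (c + (a + d + d0 (idxParity p)) - n) else 0) -
      (superSign F (idxParity p + idxParity q) (idxParity r + idxParity s) * twistSign F p q) •
        (if conjIdx q = s then ((-1) ^ (c + d0 (idxParity q)) *
            ((c + d + d0 (idxParity q)).descFactorial n : ℤ)) •
          unitMono F r b (conjIdx p) (a + (c + d + d0 (idxParity q)) - n) else 0) := by
  rw [daggerElt_eq, map_add, LinearMap.add_apply, map_smul, LinearMap.smul_apply,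
    modeProd_unitMono, modeProd_unitMono]
  simp only [leftProd_unitMono, rightProd_unitMono, idxParity_conjIdx,
    add_comm (idxParity q) (idxParity p)]
  module

variable [CharZero F]

/-- The generators of R† are symmetrizations by definition; the factorials separating `elt` from
`mono` are absorbed into u, which uses characteristic 0. -/
theorem RDaggerPart_eq_map (s : ZMod 2) :
    RDaggerPart F ℓ₁ ℓ₂ s = (blockPart F ℓ₁ ℓ₂ s).map (symmetrize F ℓ₁ ℓ₂) := by
  rw [blockPart, Submodule.map_span]
  refine le_antisymm (Submodule.span_mono ?_) (Submodule.span_le.2 ?_)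
  · rintro _ ⟨i, j, u, m, n, h, hu, rfl⟩
    refine ⟨elt i j u m n, ⟨i, j, _, m, n, h, Submodule.smul_mem _ _ hu, elt_eq_mono F i j u m n⟩, ?_⟩
    rw [symmetrize_apply, twist_elt, sigmaLin_apply]
  · rintro _ ⟨_, ⟨i, j, u, m, n, h, hu, rfl⟩, rfl⟩
    rw [mono, map_zsmul]
    refine zsmul_mem ?_ _
    refine Submodule.subset_span ⟨i, j, u, m, n, h, hu, ?_⟩
    rw [symmetrize_apply, twist_elt, sigmaLin_apply]

theorem twist_symmetrize (x : DSpace (MatK F ℓ₁ ℓ₂)) :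
    twist (sigmaLin F) (symmetrize F ℓ₁ ℓ₂ x) = symmetrize F ℓ₁ ℓ₂ x := by
  rw [symmetrize_apply, map_add, twist_twist (sigmaLin_sigmaLin F), add_comm]

theorem RDaggerPart_le_blockPart (s : ZMod 2) :
    RDaggerPart F ℓ₁ ℓ₂ s ≤ blockPart F ℓ₁ ℓ₂ s := by
  rw [RDaggerPart_eq_map]
  rintro _ ⟨x, hx, rfl⟩
  exact add_mem hx (twist_mem_blockPart hx)

/-- τ is an automorphism fixing x. This yields closure of R† under products, and it leaves four
terms rather than eight in a product of two `daggerElt`s. -/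
theorem modeProd_symmetrize_right {x : DSpace (MatK F ℓ₁ ℓ₂)}
    (hx : twist (sigmaLin F) x = x) (y : DSpace (MatK F ℓ₁ ℓ₂)) (n : ℕ) :
    modeProd F n x (symmetrize F ℓ₁ ℓ₂ y) = symmetrize F ℓ₁ ℓ₂ (modeProd F n x y) := by
  rw [symmetrize_apply, symmetrize_apply, twist_modeProd (sigmaLin_mul F), hx, map_add]

theorem RDaggerPart_isConformalSuperalgebra :
    IsConformalSuperalgebra (dd F) (modeProd F) (RDaggerPart F ℓ₁ ℓ₂) := by
  refine isConformalSuperalgebra_of_le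
    (fun s => (RDaggerPart_le_blockPart s).trans (blockPart_le_parityPart s)) ?_ ?_
  · intro i u hu
    rw [RDaggerPart_eq_map] at hu ⊢
    obtain ⟨x, hx, rfl⟩ := hu
    refine ⟨dd F x, dd_mem_blockPart hx, ?_⟩
    rw [symmetrize_apply, symmetrize_apply, map_add, twist_dd]
  · intro i j u hu v hv n
    have hu' := RDaggerPart_le_blockPart i hu
    rw [RDaggerPart_eq_map] at hu hv ⊢
    obtain ⟨x, hx, rfl⟩ := hu
    obtain ⟨y, hy, rfl⟩ := hv
    exact ⟨_, modeProd_mem_blockPart hu' hy n, (modeProd_symmetrize_right (twist_symmetrize x) y n).symm⟩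

theorem RDaggerPart_le_RPart (s : ZMod 2) :
    RDaggerPart F ℓ₁ ℓ₂ s ≤ RPart F (matGrading F ℓ₁ ℓ₂) s := by
  refine (RDaggerPart_le_blockPart s).trans (Submodule.span_le.2 ?_)
  rintro _ ⟨i, j, u, m, n, h, hu, rfl⟩
  refine zsmul_mem ?_ _
  refine Submodule.subset_span ⟨i, j, u, m, n, h, ?_, rfl⟩
  refine Submodule.mem_iSup_of_mem i ?_
  rwa [show i + (i + j) = j by clear * -; revert i j; decide]

/-! ### A spanning set -/

theorem daggerElt_mem_RDaggerPart (p : KIdx ℓ₁ ℓ₂) (a : ℕ) (q : KIdx ℓ₁ ℓ₂) (c : ℕ) :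
    daggerElt F p a q c ∈ RDaggerPart F ℓ₁ ℓ₂ (idxParity p + idxParity q) := by
  rw [RDaggerPart_eq_map]
  exact ⟨_, unitMono_mem_blockPart p a q c, rfl⟩

theorem daggerElt_mem (p : KIdx ℓ₁ ℓ₂) (a : ℕ) (q : KIdx ℓ₁ ℓ₂) (c : ℕ) :
    daggerElt F p a q c ∈ RDagger F ℓ₁ ℓ₂ :=
  RDaggerPart_le_RDagger _ (daggerElt_mem_RDaggerPart p a q c)

theorem RDagger_le {M : Submodule F (DSpace (MatK F ℓ₁ ℓ₂))}
    (h : ∀ p a q c, daggerElt F p a q c ∈ M) : RDagger F ℓ₁ ℓ₂ ≤ M := by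
  have : ∀ s, RDaggerPart F ℓ₁ ℓ₂ s ≤ M := by
    intro s
    rw [RDaggerPart_eq_map]
    refine (Submodule.map_mono (blockPart_le_span_unitMono s)).trans ?_
    rw [Submodule.map_span_le]
    rintro _ ⟨p, a, q, c, -, rfl⟩
    exact h p a q c
  exact sup_le (this 0) (this 1)

theorem modeProd_mem_RDagger {u v : DSpace (MatK F ℓ₁ ℓ₂)} (hu : u ∈ RDagger F ℓ₁ ℓ₂)
    (hv : v ∈ RDagger F ℓ₁ ℓ₂) (n : ℕ) : modeProd F n u v ∈ RDagger F ℓ₁ ℓ₂ := by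
  obtain ⟨u₀, hu₀, u₁, hu₁, rfl⟩ := Submodule.mem_sup.1 hu
  obtain ⟨v₀, hv₀, v₁, hv₁, rfl⟩ := Submodule.mem_sup.1 hv
  have h := (RDaggerPart_isConformalSuperalgebra (F := F) (ℓ₁ := ℓ₁) (ℓ₂ := ℓ₂)).map_Y
  simp only [map_add, LinearMap.add_apply]
  exact add_mem
    (add_mem (RDaggerPart_le_RDagger _ (h _ _ _ hu₀ _ hv₀ n))
      (RDaggerPart_le_RDagger _ (h _ _ _ hu₁ _ hv₀ n)))
    (add_mem (RDaggerPart_le_RDagger _ (h _ _ _ hu₀ _ hv₁ n))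
      (RDaggerPart_le_RDagger _ (h _ _ _ hu₁ _ hv₁ n)))

/-! ### Products of the spanning elements -/

theorem modeProd_daggerElt (n : ℕ) (p : KIdx ℓ₁ ℓ₂) (a : ℕ) (q : KIdx ℓ₁ ℓ₂) (c : ℕ)
    (r : KIdx ℓ₁ ℓ₂) (b : ℕ) (s : KIdx ℓ₁ ℓ₂) (d : ℕ) :
    modeProd F n (daggerElt F p a q c) (daggerElt F r b s d) =
      (if q = r then ((-1) ^ c * ((c + b + d0 (idxParity q)).descFactorial n : ℤ)) •
        daggerElt F p (a + (c + b + d0 (idxParity q)) - n) s d else 0) +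
      twistSign F p q •
        (if conjIdx p = r then ((-1) ^ a * ((a + b + d0 (idxParity p)).descFactorial n : ℤ)) •
          daggerElt F (conjIdx q) (c + (a + b + d0 (idxParity p)) - n) s d else 0) -
      superSign F (idxParity p + idxParity q) (idxParity r + idxParity s) •
        (if p = s then ((-1) ^ (a + d0 (idxParity p)) *
            ((a + d + d0 (idxParity p)).descFactorial n : ℤ)) •
          daggerElt F r b q (c + (a + d + d0 (idxParity p)) - n) else 0) -
      (superSign F (idxParity p + idxParity q) (idxParity r + idxParity s) * twistSign F p q) •
        (if conjIdx q = s then ((-1) ^ (c + d0 (idxParity q)) *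
            ((c + d + d0 (idxParity q)).descFactorial n : ℤ)) •
          daggerElt F r b (conjIdx p) (a + (c + d + d0 (idxParity q)) - n) else 0) := by
  conv_lhs => rw [daggerElt, daggerElt, modeProd_symmetrize_right (twist_symmetrize _),
    ← daggerElt, modeProd_daggerElt_unitMono]
  simp only [map_sub, map_add, map_smul, apply_ite (symmetrize F ℓ₁ ℓ₂), map_zsmul, map_zero]
  rfl

end Dagger

/-! ### Subspaces closed under products -/

section Generation

variable {F : Type*} [Field F] {ℓ₁ ℓ₂ : ℕ}
  {M : Submodule F (DSpace (MatK F ℓ₁ ℓ₂))}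

theorem mem_of_smul_mem {V : Type*} [AddCommGroup V] [Module F V] {M : Submodule F V} {c e : F}
    {x : V} (hc : c * e = 1) (h : c • x ∈ M) : x ∈ M :=
  (M.smul_mem_iff (left_ne_zero_of_mul_eq_one hc)).1 h

/-- A term of a product matters only if the indices match and n does not exceed the top of its
falling factorial; a large n can therefore be used to kill unwanted terms. -/
theorem ite_descFactorial_smul_mem {V : Type*} [AddCommGroup V] [Module F V] {M : Submodule F V}
    {P : Prop} [Decidable P] {k n N : ℕ} {x : V} (h : P → n ≤ N → x ∈ M) :
    (if P then ((-1 : ℤ) ^ k * (N.descFactorial n : ℤ)) • x else 0) ∈ M := by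
  split_ifs with hP
  · by_cases hn : n ≤ N
    · exact zsmul_mem (h hP hn) _
    · rw [Nat.descFactorial_of_lt (by omega)]; simp
  · exact zero_mem _

theorem daggerElt_symm_mem {p q : KIdx ℓ₁ ℓ₂} {a c : ℕ} (h : daggerElt F p a q c ∈ M) :
    daggerElt F (conjIdx q) c (conjIdx p) a ∈ M := by
  rw [daggerElt_symm]; exact M.smul_mem _ h

theorem extraElt_eq (h₂ : 0 < ℓ₂) : extraElt F ℓ₁ ℓ₂ h₂ =
    daggerElt F (Sum.inr (Sum.inl ⟨0, h₂⟩)) 0 (Sum.inr (Sum.inl ⟨0, h₂⟩)) 1 := by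
  rw [daggerElt_eq, twistSign]
  simp [extraElt, unitMono, mono, idxParity, superSign_one_one, idxSign, conjIdx, sub_eq_add_neg]

variable [CharZero F]

theorem mem_of_zsmul_mem {V : Type*} [AddCommGroup V] [Module F V] {M : Submodule F V} {c : ℤ}
    {x : V} (hc : c ≠ 0) (h : c • x ∈ M) : x ∈ M := by
  rw [← Int.cast_smul_eq_zsmul F] at h
  exact (M.smul_mem_iff (by exact_mod_cast hc)).1 h

theorem mem_of_descFactorial_smul_mem {V : Type*} [AddCommGroup V] [Module F V]
    {M : Submodule F V} {k n N : ℕ} {x : V} (hn : n ≤ N)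
    (h : ((-1 : ℤ) ^ k * (N.descFactorial n : ℤ)) • x ∈ M) : x ∈ M := by
  refine mem_of_zsmul_mem (mul_ne_zero (by simp) ?_) h
  have := Nat.descFactorial_eq_zero_iff_lt (n := N) (k := n)
  simp only [Ne, Nat.cast_eq_zero, this]
  omega

/-- If three of the four terms of a product lie in `M`, so does the remaining one. -/
theorem mem_of_modeProd_first {n a b c d : ℕ} {p q s : KIdx ℓ₁ ℓ₂}
    (h : modeProd F n (daggerElt F p a q c) (daggerElt F q b s d) ∈ M)
    (hn : n ≤ c + b + d0 (idxParity q))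
    (h₂ : conjIdx p = q → n ≤ a + b + d0 (idxParity p) →
      daggerElt F (conjIdx q) (c + (a + b + d0 (idxParity p)) - n) s d ∈ M)
    (h₃ : p = s → n ≤ a + d + d0 (idxParity p) →
      daggerElt F q b q (c + (a + d + d0 (idxParity p)) - n) ∈ M)
    (h₄ : conjIdx q = s → n ≤ c + d + d0 (idxParity q) →
      daggerElt F q b (conjIdx p) (a + (c + d + d0 (idxParity q)) - n) ∈ M) :
    daggerElt F p (a + (c + b + d0 (idxParity q)) - n) s d ∈ M := by
  rw [modeProd_daggerElt, if_pos rfl] at h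
  rw [Submodule.sub_mem_iff_left _ (M.smul_mem _ (ite_descFactorial_smul_mem h₄)),
    Submodule.sub_mem_iff_left _ (M.smul_mem _ (ite_descFactorial_smul_mem h₃)),
    Submodule.add_mem_iff_left _ (M.smul_mem _ (ite_descFactorial_smul_mem h₂))] at h
  exact mem_of_descFactorial_smul_mem hn h

theorem mem_of_modeProd_second {n a b c d : ℕ} {p q s : KIdx ℓ₁ ℓ₂}
    (h : modeProd F n (daggerElt F p a q c) (daggerElt F (conjIdx p) b s d) ∈ M)
    (hn : n ≤ a + b + d0 (idxParity p))
    (h₁ : q = conjIdx p → n ≤ c + b + d0 (idxParity q) →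
      daggerElt F p (a + (c + b + d0 (idxParity q)) - n) s d ∈ M)
    (h₃ : p = s → n ≤ a + d + d0 (idxParity p) →
      daggerElt F (conjIdx p) b q (c + (a + d + d0 (idxParity p)) - n) ∈ M)
    (h₄ : conjIdx q = s → n ≤ c + d + d0 (idxParity q) →
      daggerElt F (conjIdx p) b (conjIdx p) (a + (c + d + d0 (idxParity q)) - n) ∈ M) :
    daggerElt F (conjIdx q) (c + (a + b + d0 (idxParity p)) - n) s d ∈ M := by
  rw [modeProd_daggerElt, if_pos (rfl : conjIdx p = conjIdx p)] at h
  rw [Submodule.sub_mem_iff_left _ (M.smul_mem _ (ite_descFactorial_smul_mem h₄)),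
    Submodule.sub_mem_iff_left _ (M.smul_mem _ (ite_descFactorial_smul_mem h₃)),
    Submodule.add_mem_iff_right _ (ite_descFactorial_smul_mem h₁)] at h
  exact mem_of_descFactorial_smul_mem hn (mem_of_smul_mem (twistSign_mul_self p q) h)

theorem mem_of_modeProd_third {n a b c d : ℕ} {p q r : KIdx ℓ₁ ℓ₂}
    (h : modeProd F n (daggerElt F p a q c) (daggerElt F r b p d) ∈ M)
    (hn : n ≤ a + d + d0 (idxParity p))
    (h₁ : q = r → n ≤ c + b + d0 (idxParity q) →
      daggerElt F p (a + (c + b + d0 (idxParity q)) - n) p d ∈ M)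
    (h₂ : conjIdx p = r → n ≤ a + b + d0 (idxParity p) →
      daggerElt F (conjIdx q) (c + (a + b + d0 (idxParity p)) - n) p d ∈ M)
    (h₄ : conjIdx q = p → n ≤ c + d + d0 (idxParity q) →
      daggerElt F r b (conjIdx p) (a + (c + d + d0 (idxParity q)) - n) ∈ M) :
    daggerElt F r b q (c + (a + d + d0 (idxParity p)) - n) ∈ M := by
  rw [modeProd_daggerElt, if_pos (rfl : p = p)] at h
  rw [Submodule.sub_mem_iff_left _ (M.smul_mem _ (ite_descFactorial_smul_mem h₄)),
    Submodule.sub_mem_iff_right _ (add_mem (ite_descFactorial_smul_mem h₁)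
      (M.smul_mem _ (ite_descFactorial_smul_mem h₂)))] at h
  exact mem_of_descFactorial_smul_mem hn
    (mem_of_smul_mem (superSign_mul_self _ _) h)

theorem mem_of_modeProd_fourth {n a b c d : ℕ} {p q r : KIdx ℓ₁ ℓ₂}
    (h : modeProd F n (daggerElt F p a q c) (daggerElt F r b (conjIdx q) d) ∈ M)
    (hn : n ≤ c + d + d0 (idxParity q))
    (h₁ : q = r → n ≤ c + b + d0 (idxParity q) →
      daggerElt F p (a + (c + b + d0 (idxParity q)) - n) (conjIdx q) d ∈ M)
    (h₂ : conjIdx p = r → n ≤ a + b + d0 (idxParity p) →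
      daggerElt F (conjIdx q) (c + (a + b + d0 (idxParity p)) - n) (conjIdx q) d ∈ M)
    (h₃ : p = conjIdx q → n ≤ a + d + d0 (idxParity p) →
      daggerElt F r b q (c + (a + d + d0 (idxParity p)) - n) ∈ M) :
    daggerElt F r b (conjIdx p) (a + (c + d + d0 (idxParity q)) - n) ∈ M := by
  rw [modeProd_daggerElt, if_pos (rfl : conjIdx q = conjIdx q)] at h
  rw [Submodule.sub_mem_iff_right _ (sub_mem (add_mem (ite_descFactorial_smul_mem h₁)
      (M.smul_mem _ (ite_descFactorial_smul_mem h₂)))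
      (M.smul_mem _ (ite_descFactorial_smul_mem h₃)))] at h
  rw [mul_smul] at h
  exact mem_of_descFactorial_smul_mem hn
    (mem_of_smul_mem (twistSign_mul_self p q) (mem_of_smul_mem (superSign_mul_self _ _) h))

theorem ne_of_idxParity {p q : KIdx ℓ₁ ℓ₂} (hp : idxParity p = 0) (hq : idxParity q = 1) :
    p ≠ q := by
  rintro rfl
  rw [hp] at hq
  exact absurd hq (by decide)

theorem d0_of_eq_zero {i : ZMod 2} (h : i = 0) : d0 i = 1 := by simp [d0, h]

theorem d0_of_eq_one {i : ZMod 2} (h : i = 1) : d0 i = 0 := by simp [d0, h]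

/-- A subspace closed under products that contains the `daggerElt F p 0 s a` with `p` even and
`s` odd is everything. -/
theorem RDagger_le_of_forall_mem (h₁ : 0 < ℓ₁) (h₂ : 0 < ℓ₂)
    (hM : ∀ u ∈ M, ∀ v ∈ M, ∀ n, modeProd F n u v ∈ M)
    (H : ∀ (p s : KIdx ℓ₁ ℓ₂) (a : ℕ), idxParity p = 0 → idxParity s = 1 →
      daggerElt F p 0 s a ∈ M) : RDagger F ℓ₁ ℓ₂ ≤ M := by
  have c0 : ∀ {p : KIdx ℓ₁ ℓ₂} {i}, idxParity p = i → idxParity (conjIdx p) = i :=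
    fun {p _} h => (idxParity_conjIdx p).trans h
  have E1 : ∀ (p r : KIdx ℓ₁ ℓ₂) (j : ℕ), idxParity p = 0 → idxParity r = 0 →
      daggerElt F r 0 p j ∈ M := by
    intro p r j hp hr
    let s : KIdx ℓ₁ ℓ₂ := Sum.inr (Sum.inl ⟨0, h₂⟩)
    have hs : idxParity s = 1 := rfl
    have hdp := d0_of_eq_zero hp
    have hds := d0_of_eq_one hs
    -- Taking n = 2 brings the exponent j + 2 down to j and kills the contraction of the even
    -- indices, whose falling factorial has top 1.
    have := mem_of_modeProd_fourth (hM _ (H (conjIdx p) s (j + 2) (c0 hp) hs) _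
      (H r (conjIdx s) 0 hr (c0 hs)) 2) (by omega)
      (fun e => absurd e.symm (ne_of_idxParity hr hs))
      (fun _ h => by rw [idxParity_conjIdx] at h; omega)
      (fun e => absurd e (ne_of_idxParity (c0 hp) (c0 hs)))
    rw [conjIdx_conjIdx] at this
    convert this using 2; omega
  have E2 : ∀ (s t : KIdx ℓ₁ ℓ₂) (a c : ℕ), idxParity s = 1 → idxParity t = 1 →
      daggerElt F s a t c ∈ M := by
    intro s t a c hs ht
    let p : KIdx ℓ₁ ℓ₂ := Sum.inl (Sum.inl ⟨0, h₁⟩)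
    have hp : idxParity p = 0 := rfl
    have hdp := d0_of_eq_zero hp
    -- Contracting even indices of exponent 0 raises the exponent by 1, which n = 1 compensates. For
    -- s = t a second term appears, of the type covered by `E1`.
    have := mem_of_modeProd_second (hM _ (H p (conjIdx s) a hp (c0 hs)) _
      (H (conjIdx p) t c (c0 hp) ht) 1) (by omega)
      (fun e => absurd e.symm (ne_of_idxParity (c0 hp) (c0 hs)))
      (fun e => absurd e (ne_of_idxParity hp ht))
      (fun _ _ => E1 _ _ _ (c0 hp) (c0 hp))
    rw [conjIdx_conjIdx] at this
    convert this using 2; omega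
  have E0 : ∀ (p : KIdx ℓ₁ ℓ₂) (j : ℕ), idxParity p = 0 → daggerElt F p j p 0 ∈ M := by
    intro p j hp
    have := daggerElt_symm_mem (E1 (conjIdx p) (conjIdx p) j (c0 hp) (c0 hp))
    rwa [conjIdx_conjIdx] at this
  have E3 : ∀ (p r : KIdx ℓ₁ ℓ₂) (j c : ℕ), idxParity p = 0 → daggerElt F p j r c ∈ M := by
    intro p r j c hp
    have hdp := d0_of_eq_zero hp
    have hr : daggerElt F p 0 r c ∈ M := by
      rcases ZMod.eq_zero_or_one (idxParity r) with hr | hr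
      · exact E1 _ _ _ hr hp
      · exact H _ _ _ hp hr
    -- The first product with a diagonal element gives the even index p its exponent j.
    have := mem_of_modeProd_first (hM _ (E0 p j hp) _ hr 1) (by omega)
      (fun e => absurd e (conjIdx_ne p)) (fun _ _ => E1 _ _ _ hp hp)
      (fun _ _ => E1 _ _ _ (c0 hp) hp)
    convert this using 2; omega
  refine RDagger_le fun p a q c => ?_
  rcases ZMod.eq_zero_or_one (idxParity p) with hp | hp
  · exact E3 _ _ _ _ hp
  rcases ZMod.eq_zero_or_one (idxParity q) with hq | hq
  · have := daggerElt_symm_mem (E3 (conjIdx q) (conjIdx p) c a (c0 hq))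
    rwa [conjIdx_conjIdx, conjIdx_conjIdx] at this
  · exact E2 _ _ _ _ hp hq

/-! ### Generation by the elements of weight `3/2` -/

/-- Generation when there are two pairs of odd indices. -/
theorem RDagger_le_of_two_le_right (h₁ : 0 < ℓ₁) (h₂ : 2 ≤ ℓ₂)
    (hM : ∀ u ∈ M, ∀ v ∈ M, ∀ n, modeProd F n u v ∈ M)
    (H : ∀ (p s : KIdx ℓ₁ ℓ₂), idxParity p = 0 → idxParity s = 1 →
      daggerElt F p 0 s 0 ∈ M) : RDagger F ℓ₁ ℓ₂ ≤ M := by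
  have c0 : ∀ {p : KIdx ℓ₁ ℓ₂} {i}, idxParity p = i → idxParity (conjIdx p) = i :=
    fun {p _} h => (idxParity_conjIdx p).trans h
  have E1 : ∀ s t : KIdx ℓ₁ ℓ₂, idxParity s = 1 → idxParity t = 1 → t ≠ s →
      daggerElt F s 1 t 0 ∈ M := by
    intro s t hs ht hst
    let p : KIdx ℓ₁ ℓ₂ := Sum.inl (Sum.inl ⟨0, h₁⟩)
    have hp : idxParity p = 0 := rfl
    have hdp := d0_of_eq_zero hp
    have := mem_of_modeProd_second (hM _ (H p (conjIdx s) hp (c0 hs)) _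
      (H (conjIdx p) t (c0 hp) ht) 0) (by omega)
      (fun e => absurd e.symm (ne_of_idxParity (c0 hp) (c0 hs)))
      (fun e => absurd e (ne_of_idxParity hp ht))
      (fun e => absurd (e.symm.trans (conjIdx_conjIdx s)) hst)
    rw [conjIdx_conjIdx] at this
    convert this using 2; omega
  have E2 : ∀ s : KIdx ℓ₁ ℓ₂, idxParity s = 1 →
      ∃ t : KIdx ℓ₁ ℓ₂, idxParity t = 1 ∧ t ≠ s ∧ conjIdx s ≠ t := by
    rintro (s | s) hs
    · exact absurd hs (show (0 : ZMod 2) ≠ 1 by decide)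
    let i : Fin ℓ₂ := Sum.elim id id s
    have : Nontrivial (Fin ℓ₂) := Fin.nontrivial_iff_two_le.2 h₂
    obtain ⟨j, hj⟩ := exists_ne i
    refine ⟨Sum.inr (Sum.inl j), rfl, ?_, ?_⟩ <;> rcases s with s | s <;>
      simp [conjIdx, i] at hj ⊢
    · exact hj
    · exact fun e => hj e.symm
  refine RDagger_le_of_forall_mem h₁ (by omega) hM fun p s a hp => ?_
  induction a generalizing s with
  | zero => exact H p s hp
  | succ a ih =>
    intro hs
    obtain ⟨t, ht, hts, hts'⟩ := E2 s hs
    have hdt := d0_of_eq_one ht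
    -- The exponent 1 of the element from `E1` is added to a, while the odd index moves from t to s.
    -- The spare index t differs from s, as `E1` requires, and from its conjugate, which removes the
    -- fourth term.
    have := mem_of_modeProd_third (hM _ (E1 t s ht hs (Ne.symm hts)) _ (ih t ht) 0) (by omega)
      (fun e => absurd e.symm (ne_of_idxParity hp hs))
      (fun e => absurd e.symm (ne_of_idxParity hp (c0 ht)))
      (fun e => absurd e hts')
    convert this using 2; omega

/-- Generation when there are two pairs of even indices. -/
theorem RDagger_le_of_two_le_left (h₁ : 2 ≤ ℓ₁) (h₂ : 0 < ℓ₂)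
    (hM : ∀ u ∈ M, ∀ v ∈ M, ∀ n, modeProd F n u v ∈ M)
    (H : ∀ (p s : KIdx ℓ₁ ℓ₂), idxParity p = 0 → idxParity s = 1 →
      daggerElt F p 0 s 0 ∈ M) : RDagger F ℓ₁ ℓ₂ ≤ M := by
  have c0 : ∀ {p : KIdx ℓ₁ ℓ₂} {i}, idxParity p = i → idxParity (conjIdx p) = i :=
    fun {p _} h => (idxParity_conjIdx p).trans h
  have E1 : ∀ p r : KIdx ℓ₁ ℓ₂, idxParity p = 0 → idxParity r = 0 → p ≠ r →
      daggerElt F r 0 p 0 ∈ M := by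
    intro p r hp hr hpr
    let s : KIdx ℓ₁ ℓ₂ := Sum.inr (Sum.inl ⟨0, h₂⟩)
    have hs : idxParity s = 1 := rfl
    have hds := d0_of_eq_one hs
    have := mem_of_modeProd_fourth (hM _ (H (conjIdx p) s (c0 hp) hs) _
      (H r (conjIdx s) hr (c0 hs)) 0) (by omega)
      (fun e => absurd e.symm (ne_of_idxParity hr hs))
      (fun e => absurd ((conjIdx_conjIdx p).symm.trans e) hpr)
      (fun e => absurd e (ne_of_idxParity (c0 hp) (c0 hs)))
    rw [conjIdx_conjIdx] at this
    convert this using 2; omega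
  have E2 : ∀ p : KIdx ℓ₁ ℓ₂, idxParity p = 0 →
      ∃ r : KIdx ℓ₁ ℓ₂, idxParity r = 0 ∧ r ≠ p ∧ conjIdx p ≠ r := by
    rintro (p | p) hp
    swap
    · exact absurd hp (show (1 : ZMod 2) ≠ 0 by decide)
    let i : Fin ℓ₁ := Sum.elim id id p
    have : Nontrivial (Fin ℓ₁) := Fin.nontrivial_iff_two_le.2 h₁
    obtain ⟨j, hj⟩ := exists_ne i
    refine ⟨Sum.inl (Sum.inl j), rfl, ?_, ?_⟩ <;> rcases p with p | p <;>
      simp [conjIdx, i] at hj ⊢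
    · exact hj
    · exact fun e => hj e.symm
  have E3 : ∀ (b : ℕ) (p s : KIdx ℓ₁ ℓ₂), idxParity p = 0 → idxParity s = 1 →
      daggerElt F p b s 0 ∈ M := by
    intro b
    induction b with
    | zero => exact H
    | succ b ih =>
      intro p s hp hs
      obtain ⟨r, hr, hrp, hrp'⟩ := E2 p hp
      have hdr := d0_of_eq_zero hr
      -- Contracting an even index in a zeroth product raises the exponent by 1; the spare index r
      -- avoids p and its conjugate.
      have := mem_of_modeProd_first (hM _ (E1 r p hr hp hrp) _ (ih r s hr hs) 0) (by omega)
        (fun e => absurd e hrp')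
        (fun e => absurd e (ne_of_idxParity hp hs))
        (fun e => absurd e (ne_of_idxParity (c0 hr) hs))
      convert this using 2; omega
  have E4 : ∀ (s : KIdx ℓ₁ ℓ₂) (a : ℕ), idxParity s = 1 →
      daggerElt F (conjIdx s) (a + 1) s 0 ∈ M := by
    intro s a hs
    let p : KIdx ℓ₁ ℓ₂ := Sum.inl (Sum.inl ⟨0, by omega⟩)
    have hp : idxParity p = 0 := rfl
    have hdp := d0_of_eq_zero hp
    have := mem_of_modeProd_second (hM _ (E3 a p s hp hs) _
      (H (conjIdx p) s (c0 hp) hs) 0) (by omega)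
      (fun e => absurd e.symm (ne_of_idxParity (c0 hp) hs))
      (fun e => absurd e (ne_of_idxParity hp hs))
      (fun e => absurd e (conjIdx_ne s))
    convert this using 2; omega
  refine RDagger_le_of_forall_mem (by omega) h₂ hM fun p s a hp hs => ?_
  have hds := d0_of_eq_one hs
  -- The first product lowers a + 1 to a and removes the fourth term, whose falling factorial has
  -- top 0.
  have := mem_of_modeProd_third (hM _ (E4 s a hs) _ (H p (conjIdx s) hp (c0 hs)) 1)
    (by omega)
    (fun e => absurd e.symm (ne_of_idxParity hp hs))
    (fun e => absurd (e.symm.trans (conjIdx_conjIdx s)) (ne_of_idxParity hp hs))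
    (fun _ h => by omega)
  convert this using 2
  rw [idxParity_conjIdx]; omega

/-- Generation in rank `(2, 2)`. -/
theorem RDagger_le_of_extraElt_mem (h₂ : 0 < 1)
    {M : Submodule F (DSpace (MatK F 1 1))}
    (hM : ∀ u ∈ M, ∀ v ∈ M, ∀ n, modeProd F n u v ∈ M)
    (H : ∀ (p s : KIdx 1 1), idxParity p = 0 → idxParity s = 1 →
      daggerElt F p 0 s 0 ∈ M) (hZ : extraElt F 1 1 h₂ ∈ M) : RDagger F 1 1 ≤ M := by
  rw [extraElt_eq] at hZ
  refine RDagger_le_of_forall_mem one_pos h₂ hM fun p s a hp hs => ?_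
  set q : KIdx 1 1 := Sum.inr (Sum.inl ⟨0, h₂⟩) with hq
  have hq1 : idxParity q = 1 := rfl
  have hdq := d0_of_eq_one hq1
  have hs' : s = q ∨ s = conjIdx q := by
    rcases s with s | s | s
    · exact absurd hs (show (0 : ZMod 2) ≠ 1 by decide)
    · exact Or.inl (by rw [hq, Subsingleton.elim s])
    · exact Or.inr (by rw [hq, Subsingleton.elim s]; rfl)
  induction a with
  | zero => exact H p s hp hs
  | succ a ih =>
    rcases hs' with rfl | rfl
    -- The zeroth product with the extra generator raises the odd exponent by 1, through the third
    -- term for q and through the fourth for its conjugate.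
    · have := mem_of_modeProd_third (hM _ hZ _ ih 0) (by omega)
        (fun e => absurd e.symm (ne_of_idxParity hp hs))
        (fun e => absurd e.symm (ne_of_idxParity hp hs))
        (fun e => absurd e (conjIdx_ne _))
      convert this using 2; omega
    · have := mem_of_modeProd_fourth (hM _ hZ _ ih 0) (by omega)
        (fun e => absurd e.symm (ne_of_idxParity hp rfl))
        (fun e => absurd e.symm (ne_of_idxParity hp hs))
        (fun e => absurd e.symm (conjIdx_ne _))
      convert this using 2; omega

end Generation

/-! ### Spans of monomials are closed under products -/

section Monomials

variable {F V : Type*} [Field F] [AddCommGroup V] [Module F V] {D : V →ₗ[F] V}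
  {Y : ℕ → V →ₗ[F] V →ₗ[F] V} {R : ZMod 2 → Submodule F V} {S T : Set V}

theorem IsMonomial.mono (h : S ⊆ T) {w : V} (hw : IsMonomial Y S w) : IsMonomial Y T w := by
  induction hw with
  | base v hv => exact .base v (h hv)
  | step u w m hu _ ih => exact .step u w m (h hu) ih

theorem IsMonomial.mem {P : Submodule F V} (hS : S ⊆ P)
    (hP : ∀ u ∈ P, ∀ v ∈ P, ∀ n, Y n u v ∈ P) {w : V} (hw : IsMonomial Y S w) : w ∈ P := by
  induction hw with
  | base v hv => exact hS hv
  | step u w m hu _ ih => exact hP _ (hS hu) _ ih m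

theorem IsMonomial.exists_mem (hR : IsConformalSuperalgebra D Y R)
    (hS : ∀ u ∈ S, ∃ i, u ∈ R i) {w : V} (hw : IsMonomial Y S w) : ∃ i, w ∈ R i := by
  induction hw with
  | base v hv => exact hS v hv
  | step u w m hu _ ih =>
    obtain ⟨i, hi⟩ := hS u hu
    obtain ⟨j, hj⟩ := ih
    exact ⟨i + j, hR.map_Y i j u hi w hj m⟩

theorem le_sup_of_zmod_two (i : ZMod 2) : R i ≤ R 0 ⊔ R 1 := by
  rcases ZMod.eq_zero_or_one i with rfl | rfl
  · exact le_sup_left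
  · exact le_sup_right

/-- The span of the monomials in a set of homogeneous elements is closed under the products. -/
theorem span_isMonomial_closed (hR : IsConformalSuperalgebra D Y R)
    (hS : ∀ u ∈ S, ∃ i, u ∈ R i) {u v : V} (hu : u ∈ Submodule.span F {w | IsMonomial Y S w})
    (hv : v ∈ Submodule.span F {w | IsMonomial Y S w}) (n : ℕ) :
    Y n u v ∈ Submodule.span F {w | IsMonomial Y S w} := by
  set M := Submodule.span F {w | IsMonomial Y S w} with hM
  have hMR : M ≤ R 0 ⊔ R 1 := by
    refine Submodule.span_le.2 fun w hw => ?_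
    obtain ⟨i, hi⟩ := IsMonomial.exists_mem hR hS hw
    exact le_sup_of_zmod_two i hi
  have base : ∀ u ∈ S, ∀ x ∈ M, ∀ n, Y n u x ∈ M := by
    intro u hu x hx n
    refine Submodule.span_induction (p := fun x _ => Y n u x ∈ M) ?_ ?_ ?_ ?_ hx
    · exact fun w hw => Submodule.subset_span (IsMonomial.step u w n hu hw)
    · simp
    · intro x y _ _ h h'; simpa only [map_add] using add_mem h h'
    · intro c x _ h; simpa only [map_smul] using Submodule.smul_mem _ c h
  have key : ∀ w, IsMonomial Y S w → ∀ x ∈ M, ∀ n, Y n w x ∈ M := by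
    intro w hw
    induction hw with
    | base v hv => exact base v hv
    | step u w m hu hw ih =>
      obtain ⟨i, hi⟩ := hS u hu
      obtain ⟨j, hj⟩ := IsMonomial.exists_mem hR hS hw
      intro x hx
      -- In the commutator formula for `Y m u` and `Y n w`, the summand r = m is the product with `Y
      -- m u w`, with coefficient 1; the summands r < m are covered by induction.
      induction m using Nat.strong_induction_on with
      | _ m ihm =>
        intro n
        have hJ := hR.jacobi i j u hi w hj x (hMR hx) m n
        have hl : Y m u (Y n w x) - superSign F i j • Y n w (Y m u x) ∈ M :=
          sub_mem (base u hu _ (ih x hx n) m)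
            (M.smul_mem _ (ih _ (base u hu x hx m) n))
        rw [hJ, Finset.sum_range_succ, Submodule.add_mem_iff_right] at hl
        · simpa using hl
        · refine sum_mem fun r hr => M.smul_mem _ (ihm r (Finset.mem_range.1 hr) _)
  refine Submodule.span_induction (p := fun u _ => Y n u v ∈ M) ?_ ?_ ?_ ?_ hu
  · exact fun w hw => key w hw v hv n
  · simp
  · intro x y _ _ h h'; simpa only [map_add, LinearMap.add_apply] using add_mem h h'
  · intro c x _ h; simpa only [map_smul, LinearMap.smul_apply] using Submodule.smul_mem _ c h

end Monomials

/-! ### The two generation statements -/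

section Generators

variable {F : Type*} [Field F] {ℓ₁ ℓ₂ : ℕ}

theorem unitMono_zero_zero (p q : KIdx ℓ₁ ℓ₂) : unitMono F p 0 q 0 =
    elt (idxParity p) (idxParity q) (Matrix.single p q (1 : F)) 0 0 := by
  simp [unitMono, mono]

theorem matBlock_le_matGrading (i j : ZMod 2) :
    matBlock F ℓ₁ ℓ₂ i j ≤ matGrading F ℓ₁ ℓ₂ (i + j) := by
  have := le_iSup (fun i' : ZMod 2 => matBlock F ℓ₁ ℓ₂ i' (i' + (i + j))) i
  rwa [show i + (i + j) = j by clear * -; revert i j; decide] at this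

variable [CharZero F]

theorem daggerElt_mem_RDaggerWeight {p s : KIdx ℓ₁ ℓ₂} (hp : idxParity p = 0)
    (hs : idxParity s = 1) : daggerElt F p 0 s 0 ∈ RDaggerWeight F ℓ₁ ℓ₂ (3 / 2) := by
  refine ⟨daggerElt_mem _ _ _ _, ?_⟩
  rw [daggerElt_eq, unitMono_zero_zero, unitMono_zero_zero]
  refine add_mem (Submodule.subset_span ⟨_, _, _, 0, 0,
    matBlock_le_matGrading _ _ (single_mem_matBlock p s), ?_, rfl⟩)
    (Submodule.smul_mem _ _ (Submodule.subset_span ⟨_, _, _, 0, 0,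
    matBlock_le_matGrading _ _ (single_mem_matBlock _ _), ?_, rfl⟩))
  · rw [hp, hs]; norm_num [d0, d1]
  · rw [idxParity_conjIdx, idxParity_conjIdx, hp, hs]; norm_num [d0, d1]

variable (F ℓ₁ ℓ₂) in
/-- The elements `daggerElt F p 0 s 0` with `p` even and `s` odd. -/
def mixedElts : Set (DSpace (MatK F ℓ₁ ℓ₂)) :=
  {x | ∃ p s, idxParity p = 0 ∧ idxParity s = 1 ∧ x = daggerElt F p 0 s 0}

/-- T may contain inhomogeneous elements, whereas the commutator formula needs homogeneous ones. The
closure argument is therefore run on S, and monomials in S are monomials in T. -/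
theorem isGeneratedBy_of_homogeneous {S T : Set (DSpace (MatK F ℓ₁ ℓ₂))}
    (hS : ∀ u ∈ S, ∃ i, u ∈ RDaggerPart F ℓ₁ ℓ₂ i) (hST : S ⊆ T) (hT : T ⊆ RDagger F ℓ₁ ℓ₂)
    (h : ∀ M : Submodule F (DSpace (MatK F ℓ₁ ℓ₂)),
      (∀ u ∈ M, ∀ v ∈ M, ∀ n, modeProd F n u v ∈ M) → S ⊆ M → RDagger F ℓ₁ ℓ₂ ≤ M) :
    IsGeneratedBy (modeProd F) (RDagger F ℓ₁ ℓ₂) T := by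
  refine le_antisymm ?_ (Submodule.span_le.2 fun w hw =>
    hw.mem hT fun u hu v hv n => modeProd_mem_RDagger hu hv n)
  refine (h (Submodule.span F {w | IsMonomial (modeProd F) S w}) ?_ ?_).trans
    (Submodule.span_mono (show {w | IsMonomial (modeProd F) S w} ⊆
      {w | IsMonomial (modeProd F) T w} from fun w hw => IsMonomial.mono hST hw))
  · exact fun u hu v hv n =>
      span_isMonomial_closed RDaggerPart_isConformalSuperalgebra hS hu hv n
  · exact fun u hu => Submodule.subset_span (.base u hu)

theorem isGeneratedBy_of_four_lt (h₁ : 0 < ℓ₁) (h₂ : 0 < ℓ₂) (h : 4 < 2 * ℓ₁ + 2 * ℓ₂) :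
    IsGeneratedBy (modeProd F) (RDagger F ℓ₁ ℓ₂) (RDaggerWeight F ℓ₁ ℓ₂ (3 / 2)) := by
  refine isGeneratedBy_of_homogeneous (S := mixedElts F ℓ₁ ℓ₂) ?_ ?_
    (fun x hx => hx.1) fun M hM hS => ?_
  · rintro _ ⟨p, s, -, -, rfl⟩
    exact ⟨_, daggerElt_mem_RDaggerPart _ _ _ _⟩
  · rintro _ ⟨p, s, hp, hs, rfl⟩
    exact daggerElt_mem_RDaggerWeight hp hs
  · have H : ∀ (p s : KIdx ℓ₁ ℓ₂), idxParity p = 0 → idxParity s = 1 →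
      daggerElt F p 0 s 0 ∈ M := fun p s hp hs => hS ⟨p, s, hp, hs, rfl⟩
    by_cases h' : 2 ≤ ℓ₁
    · exact RDagger_le_of_two_le_left h' h₂ hM H
    · exact RDagger_le_of_two_le_right h₁ (by omega) hM H

theorem isGeneratedBy_of_eq_four (h₁ : 0 < ℓ₁) (h₂ : 0 < ℓ₂) (h : 2 * ℓ₁ + 2 * ℓ₂ = 4) :
    IsGeneratedBy (modeProd F) (RDagger F ℓ₁ ℓ₂)
      (RDaggerWeight F ℓ₁ ℓ₂ (3 / 2) ⊔ Submodule.span F {extraElt F ℓ₁ ℓ₂ h₂} :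
        Submodule F (DSpace (MatK F ℓ₁ ℓ₂))) := by
  obtain rfl : ℓ₁ = 1 := by omega
  obtain rfl : ℓ₂ = 1 := by omega
  refine isGeneratedBy_of_homogeneous
    (S := mixedElts F 1 1 ∪ {extraElt F 1 1 h₂}) ?_ ?_ ?_ fun M hM hS => ?_
  · rintro _ (⟨p, s, -, -, rfl⟩ | rfl)
    · exact ⟨_, daggerElt_mem_RDaggerPart _ _ _ _⟩
    · rw [extraElt_eq]; exact ⟨_, daggerElt_mem_RDaggerPart _ _ _ _⟩
  · rintro _ (⟨p, s, hp, hs, rfl⟩ | rfl)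
    · exact Submodule.mem_sup_left (daggerElt_mem_RDaggerWeight hp hs)
    · exact Submodule.mem_sup_right (Submodule.mem_span_singleton_self _)
  · refine sup_le (a := RDaggerWeight F 1 1 (3 / 2)) inf_le_left ?_
    rw [Submodule.span_singleton_le_iff_mem, extraElt_eq]
    exact daggerElt_mem _ _ _ _
  · exact RDagger_le_of_extraElt_mem h₂ hM (fun p s hp hs => hS (Or.inl ⟨p, s, hp, hs, rfl⟩))
      (hS (Or.inr rfl))

end Generators

/-! ### Coordinates and their behaviour under products -/

section Coordinates

variable {F : Type*} [Field F] {ℓ₁ ℓ₂ : ℕ}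

variable (F ℓ₁ ℓ₂) in
/-- The span of the `unitMono`s. -/
noncomputable def unitSpan : Submodule F (DSpace (MatK F ℓ₁ ℓ₂)) :=
  Submodule.span F {x | ∃ p a q c, x = unitMono F p a q c}

theorem unitMono_mem (p : KIdx ℓ₁ ℓ₂) (a : ℕ) (q : KIdx ℓ₁ ℓ₂) (c : ℕ) :
    unitMono F p a q c ∈ unitSpan F ℓ₁ ℓ₂ :=
  Submodule.subset_span ⟨p, a, q, c, rfl⟩

variable (F) in
/-- The coordinate at `E_{p,q} t₁^a t₂^c` in the block of `p` and `q`. -/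
noncomputable def coord (p : KIdx ℓ₁ ℓ₂) (a : ℕ) (q : KIdx ℓ₁ ℓ₂) (c : ℕ) :
    DSpace (MatK F ℓ₁ ℓ₂) →ₗ[F] F :=
  Matrix.entryLinearMap F F p q ∘ₗ Finsupp.lapply (idxParity p, idxParity q, a, c)

variable (F) in
/-- The coordinate of `unitMono` in one exponent. -/
def factCoeff (B b : ℕ) : F := if b = B then (b.factorial : F) else 0

theorem coord_unitMono (R : KIdx ℓ₁ ℓ₂) (B : ℕ) (S : KIdx ℓ₁ ℓ₂) (D : ℕ)
    (r : KIdx ℓ₁ ℓ₂) (b : ℕ) (s : KIdx ℓ₁ ℓ₂) (d : ℕ) :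
    coord F R B S D (unitMono F r b s d) =
      (if r = R then 1 else 0) * (if s = S then 1 else 0) * (factCoeff F B b * factCoeff F D d) := by
  rw [unitMono, mono, map_zsmul]
  simp only [coord, elt, LinearMap.comp_apply, Finsupp.lapply_apply, Matrix.entryLinearMap_apply,
    factCoeff]
  by_cases h1 : r = R
  swap
  · rw [Finsupp.single_apply]; split_ifs <;> simp [h1]
  by_cases h2 : s = S
  swap
  · rw [Finsupp.single_apply]; split_ifs <;> simp [h2]
  subst h1 h2
  by_cases h3 : b = B
  swap
  · rw [Finsupp.single_apply, if_neg (by simp [h3])]; simp [h3]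
  by_cases h4 : d = D
  swap
  · rw [Finsupp.single_apply, if_neg (by simp [h4])]; simp [h4]
  subst h3 h4
  simp

/-- `coord` reads a matrix entry only in the block of its two parities. In the span of the
`unitMono`s all other entries are zero, so the coordinates separate points. -/
theorem exists_coord_ne_zero {x : DSpace (MatK F ℓ₁ ℓ₂)} (hx : x ∈ unitSpan F ℓ₁ ℓ₂)
    (h : x ≠ 0) : ∃ R B S D, coord F R B S D x ≠ 0 := by
  have key : ∀ d p q, x d p q ≠ 0 → idxParity p = d.1 ∧ idxParity q = d.2.1 := by
    refine Submodule.span_induction (p := fun x _ => ∀ d p q, x d p q ≠ 0 →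
      idxParity p = d.1 ∧ idxParity q = d.2.1) ?_ ?_ ?_ ?_ hx
    · rintro _ ⟨r, a, s, c, rfl⟩ d p q hd
      simp only [unitMono, mono, elt] at hd
      rw [Finsupp.smul_apply, Matrix.smul_apply] at hd
      have hd' := right_ne_zero_of_smul hd
      rw [Finsupp.single_apply] at hd'
      split_ifs at hd' with h'
      · rw [← h']
        rw [Matrix.single_apply] at hd'
        split_ifs at hd' with h''
        · rw [h''.1, h''.2]; exact ⟨rfl, rfl⟩
        · exact absurd rfl hd'
      · exact absurd rfl hd'
    · intro d p q hd; exact absurd rfl hd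
    · intro x y _ _ hx hy d p q hd
      rw [Finsupp.add_apply, Matrix.add_apply] at hd
      by_cases h0 : x d p q = 0
      · exact hy d p q (by rwa [h0, zero_add] at hd)
      · exact hx d p q h0
    · intro c x _ hx d p q hd
      rw [Finsupp.smul_apply, Matrix.smul_apply] at hd
      exact hx d p q (right_ne_zero_of_smul hd)
  by_contra! h'
  refine h (Finsupp.ext fun d => Matrix.ext fun p q => ?_)
  by_contra h0
  obtain ⟨h1, h2⟩ := key d p q h0
  obtain ⟨i, j, m, n⟩ := d
  have := h' p m q n
  simp only [coord, LinearMap.comp_apply, Finsupp.lapply_apply, Matrix.entryLinearMap_apply, h1,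
    h2] at this
  exact h0 this

theorem coord_twist {x : DSpace (MatK F ℓ₁ ℓ₂)} (hx : x ∈ unitSpan F ℓ₁ ℓ₂)
    (R : KIdx ℓ₁ ℓ₂) (B : ℕ) (S : KIdx ℓ₁ ℓ₂) (D : ℕ) :
    coord F (conjIdx S) D (conjIdx R) B (twist (sigmaLin F) x) =
      twistSign F R S * coord F R B S D x := by
  refine Submodule.span_induction (p := fun x _ => coord F (conjIdx S) D (conjIdx R) B
    (twist (sigmaLin F) x) = twistSign F R S * coord F R B S D x) ?_ ?_ ?_ ?_ hx
  · rintro _ ⟨r, b, s, d, rfl⟩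
    rw [twist_unitMono, map_smul, coord_unitMono, coord_unitMono, smul_eq_mul]
    simp only [conjIdx_eq_iff, conjIdx_conjIdx]
    by_cases h1 : r = R
    · by_cases h2 : s = S
      · subst h1 h2; simp [mul_comm]
      · simp [h2]
    · simp [h1]
  · simp
  · intro x y _ _ h h'; simp only [map_add, h, h']; ring
  · intro c x _ h; simp only [map_smul, h, smul_eq_mul]; ring

theorem ite_mul_indicator {P Q T : Prop} [Decidable P] [Decidable Q] [Decidable T]
    {c e c' e' t : F} (h : c * e = c' * e') :
    (if P then c * ((if Q then 1 else 0) * (if T then 1 else 0) * (e * t)) else 0) =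
      if Q then c' * ((if P then 1 else 0) * (if T then 1 else 0) * (e' * t)) else 0 := by
  split_ifs <;> first | linear_combination t * h | simp

/-- Coordinates of `u_n v` for `u = daggerElt F p 0 q 0`, for those `n` for which the exponents
transform as prescribed by `f, α` and `g, β`. -/
theorem coord_modeProd_daggerElt {n : ℕ} {p q : KIdx ℓ₁ ℓ₂} {f g : ℕ → ℕ} {α β : ℕ → F}
    (hq : ∀ b B, ((b + d0 (idxParity q)).descFactorial n : F) *
      factCoeff F B (b + d0 (idxParity q) - n) = α B * factCoeff F (f B) b)
    (hp : ∀ b B, ((b + d0 (idxParity p)).descFactorial n : F) *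
      factCoeff F B (b + d0 (idxParity p) - n) = β B * factCoeff F (g B) b)
    {v : DSpace (MatK F ℓ₁ ℓ₂)} (hv : v ∈ unitSpan F ℓ₁ ℓ₂)
    (R : KIdx ℓ₁ ℓ₂) (B : ℕ) (S : KIdx ℓ₁ ℓ₂) (D : ℕ) :
    coord F R B S D (modeProd F n (daggerElt F p 0 q 0) v) =
      (if p = R then α B * coord F q (f B) S D v else 0) +
      twistSign F p q * (if conjIdx q = R then β B * coord F (conjIdx p) (g B) S D v else 0) -
      superSign F (idxParity p + idxParity q) (idxParity R + idxParity p) *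
        (if q = S then (-1) ^ d0 (idxParity p) * (β D * coord F R B p (g D) v) else 0) -
      superSign F (idxParity p + idxParity q) (idxParity R + idxParity q) * twistSign F p q *
        (if conjIdx p = S then
          (-1) ^ d0 (idxParity q) * (α D * coord F R B (conjIdx q) (f D) v) else 0) := by
  induction hv using Submodule.span_induction with
  | mem y hy =>
    obtain ⟨r, b, s, d, rfl⟩ := hy
    simp only [modeProd_daggerElt_unitMono, map_add, map_sub, map_smul, apply_ite (coord F R B S D),
      map_zero, coord_unitMono, smul_eq_mul, ← Int.cast_smul_eq_zsmul F, zero_add]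
    push_cast
    simp only [one_mul]
    refine congrArg₂ (· - ·) (congrArg₂ (· - ·) (congrArg₂ (· + ·) ?_ (congrArg _ ?_)) ?_) ?_
    · rw [ite_mul_indicator (hq b B)]
      simp only [eq_comm (a := q)]
    · rw [ite_mul_indicator (hp b B)]
      simp only [eq_comm (a := conjIdx p)]
    · by_cases h1 : s = p
      · by_cases h2 : r = R
        · by_cases h3 : q = S
          · subst h1 h2 h3
            simp only [if_true]
            linear_combination superSign F (idxParity s + idxParity q) (idxParity r + idxParity s) *
              (-1) ^ d0 (idxParity s) * factCoeff F B b * hp d D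
          · simp [h3]
        · simp [h2]
      · simp [h1, Ne.symm h1]
    · by_cases h1 : s = conjIdx q
      · by_cases h2 : r = R
        · by_cases h3 : conjIdx p = S
          · subst h1 h2 h3
            simp only [if_true, idxParity_conjIdx]
            linear_combination superSign F (idxParity p + idxParity q) (idxParity r + idxParity q) *
              twistSign F p q * (-1) ^ d0 (idxParity q) * factCoeff F B b * hq d D
          · simp [h3]
        · simp [h2]
      · simp [h1, Ne.symm h1]
  | zero => simp
  | add y z _ _ h h' =>
    simp only [map_add, h, h']
    split_ifs <;> ring
  | smul c y _ h =>
    simp only [map_smul, h, smul_eq_mul]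
    split_ifs <;> ring

/-- The entries of a commutator: the zeroth product is bracketing with E_{p,q} plus its twisted
partner, without touching exponents. -/
theorem coord_modeProd_zero {p q : KIdx ℓ₁ ℓ₂} (hp : idxParity p = 1) (hq : idxParity q = 1)
    {v : DSpace (MatK F ℓ₁ ℓ₂)} (hv : v ∈ unitSpan F ℓ₁ ℓ₂)
    (R : KIdx ℓ₁ ℓ₂) (B : ℕ) (S : KIdx ℓ₁ ℓ₂) (D : ℕ) :
    coord F R B S D (modeProd F 0 (daggerElt F p 0 q 0) v) =
      (if p = R then coord F q B S D v else 0) +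
      twistSign F p q * (if conjIdx q = R then coord F (conjIdx p) B S D v else 0) -
      (if q = S then coord F R B p D v else 0) -
      twistSign F p q * (if conjIdx p = S then coord F R B (conjIdx q) D v else 0) := by
  rw [coord_modeProd_daggerElt (f := id) (g := id) (α := 1) (β := 1) ?_ ?_ hv]
  · simp [hp, hq, d0, show (1 + 1 : ZMod 2) = 0 from rfl, superSign_zero_left]
  · simp [hq, d0]
  · simp [hp, d0]

theorem factCoeff_succ (b B : ℕ) :
    (b.descFactorial 1 : F) * factCoeff F B (b - 1) = factCoeff F (B + 1) b := by
  cases b with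
  | zero => simp [factCoeff]
  | succ b =>
    simp only [factCoeff, Nat.descFactorial_one, Nat.add_sub_cancel, Nat.factorial_succ,
      Nat.add_right_cancel_iff]
    split_ifs <;> push_cast <;> ring

/-- For an even index the shift `d0` = 1 compensates the first product, so the exponent is kept and
a factor B + 1 appears; for an odd index (`factCoeff_succ`) the exponent drops by 1. -/
theorem factCoeff_self (b B : ℕ) :
    ((b + 1).descFactorial 1 : F) * factCoeff F B (b + 1 - 1) =
      ((B : F) + 1) * factCoeff F B b := by
  simp only [factCoeff, Nat.descFactorial_one, Nat.add_sub_cancel]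
  split_ifs with h
  · subst h; push_cast; ring
  · simp

theorem coord_modeProd_one_odd {p q : KIdx ℓ₁ ℓ₂} (hp : idxParity p = 1) (hq : idxParity q = 1)
    {v : DSpace (MatK F ℓ₁ ℓ₂)} (hv : v ∈ unitSpan F ℓ₁ ℓ₂)
    (R : KIdx ℓ₁ ℓ₂) (B : ℕ) (S : KIdx ℓ₁ ℓ₂) (D : ℕ) :
    coord F R B S D (modeProd F 1 (daggerElt F p 0 q 0) v) =
      (if p = R then coord F q (B + 1) S D v else 0) +
      twistSign F p q * (if conjIdx q = R then coord F (conjIdx p) (B + 1) S D v else 0) -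
      (if q = S then coord F R B p (D + 1) v else 0) -
      twistSign F p q * (if conjIdx p = S then coord F R B (conjIdx q) (D + 1) v else 0) := by
  rw [coord_modeProd_daggerElt (f := (· + 1)) (g := (· + 1)) (α := 1) (β := 1) ?_ ?_ hv]
  · simp [hp, hq, d0, show (1 + 1 : ZMod 2) = 0 from rfl, superSign_zero_left]
  · simp only [hq, d0_of_eq_one rfl, add_zero, factCoeff_succ]; simp
  · simp only [hp, d0_of_eq_one rfl, add_zero, factCoeff_succ]; simp

theorem coord_modeProd_one_mixed {p q : KIdx ℓ₁ ℓ₂} (hp : idxParity p = 0) (hq : idxParity q = 1)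
    {v : DSpace (MatK F ℓ₁ ℓ₂)} (hv : v ∈ unitSpan F ℓ₁ ℓ₂)
    (R : KIdx ℓ₁ ℓ₂) (B : ℕ) (S : KIdx ℓ₁ ℓ₂) (D : ℕ) :
    coord F R B S D (modeProd F 1 (daggerElt F p 0 q 0) v) =
      (if p = R then coord F q (B + 1) S D v else 0) +
      twistSign F p q *
        (if conjIdx q = R then ((B : F) + 1) * coord F (conjIdx p) B S D v else 0) +
      superSign F 1 (idxParity R) *
        (if q = S then ((D : F) + 1) * coord F R B p D v else 0) -
      superSign F 1 (idxParity R + 1) * twistSign F p q *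
        (if conjIdx p = S then coord F R B (conjIdx q) (D + 1) v else 0) := by
  rw [coord_modeProd_daggerElt (f := (· + 1)) (g := id) (α := 1)
    (β := fun B => (B : F) + 1) ?_ ?_ hv]
  · simp only [hp, hq, d0_of_eq_one rfl, d0_of_eq_zero rfl, zero_add, add_zero, id, Pi.one_apply,
      pow_zero, one_mul, pow_one]
    split_ifs <;> ring
  · simp only [hq, d0_of_eq_one rfl, add_zero, factCoeff_succ]; simp
  · simp only [hp, d0_of_eq_zero rfl, factCoeff_self, id]; simp

end Coordinates

/-! ### Simplicity -/

section Simplicity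

variable {F : Type*} [Field F] {ℓ₁ ℓ₂ : ℕ}

theorem twistSign_self_odd {q : KIdx ℓ₁ ℓ₂} (hq : idxParity q = 1) : twistSign F q q = -1 := by
  rw [twistSign, hq, superSign_one_one, idxSign_mul_self]; ring

theorem twistSign_conjIdx_left (p q : KIdx ℓ₁ ℓ₂) :
    twistSign F (conjIdx p) q = -twistSign F p q := by
  rw [twistSign, twistSign, idxParity_conjIdx, idxSign_conjIdx]; ring

theorem twistSign_conjIdx_right (p q : KIdx ℓ₁ ℓ₂) :
    twistSign F p (conjIdx q) = -twistSign F p q := by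
  rw [twistSign, twistSign, idxParity_conjIdx, idxSign_conjIdx]; ring

theorem twistSign_comm (p q : KIdx ℓ₁ ℓ₂) : twistSign F p q = twistSign F q p := by
  rw [twistSign, twistSign, superSign_comm]; ring

/-! ### Vectors of lowest weight -/

/-- All coordinates of `v` of doubled weight (up to a shift) at least `N` vanish. -/
def VanishesFrom (N : ℕ) (v : DSpace (MatK F ℓ₁ ℓ₂)) : Prop :=
  ∀ R B S D, N ≤ 2 * B + 2 * D + d0 (idxParity R) + d0 (idxParity S) → coord F R B S D v = 0

theorem d0_le_one (i : ZMod 2) : d0 i ≤ 1 := by unfold d0; split_ifs <;> simp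

theorem exists_vanishesFrom {v : DSpace (MatK F ℓ₁ ℓ₂)} (hv : v ∈ unitSpan F ℓ₁ ℓ₂) :
    ∃ N, VanishesFrom N v := by
  induction hv using Submodule.span_induction with
  | mem y hy =>
    obtain ⟨r, b, s, d, rfl⟩ := hy
    refine ⟨2 * b + 2 * d + 3, fun R B S D h => ?_⟩
    have h1 := d0_le_one (idxParity R)
    have h2 := d0_le_one (idxParity S)
    rw [coord_unitMono]
    by_cases h3 : b = B
    · have h4 : d ≠ D := by omega
      simp [factCoeff, h4]
    · simp [factCoeff, h3]
  | zero => exact ⟨0, fun R B S D _ => map_zero _⟩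
  | add x y _ _ hx hy =>
    obtain ⟨N, hN⟩ := hx
    obtain ⟨M, hM⟩ := hy
    refine ⟨N + M, fun R B S D h => ?_⟩
    rw [map_add, hN _ _ _ _ (by omega), hM _ _ _ _ (by omega), add_zero]
  | smul c x _ hx =>
    obtain ⟨N, hN⟩ := hx
    exact ⟨N, fun R B S D h => by rw [map_smul, hN _ _ _ _ h, smul_zero]⟩

theorem VanishesFrom.modeProd_odd {N : ℕ} {v : DSpace (MatK F ℓ₁ ℓ₂)}
    (h : VanishesFrom (N + 1) v) (hv : v ∈ unitSpan F ℓ₁ ℓ₂) {p q : KIdx ℓ₁ ℓ₂}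
    (hp : idxParity p = 1) (hq : idxParity q = 1) :
    VanishesFrom N (modeProd F 1 (daggerElt F p 0 q 0) v) := by
  intro R B S D hN
  have hp' := d0_of_eq_one hp
  have hq' := d0_of_eq_one hq
  rw [coord_modeProd_one_odd hp hq hv]
  have e1 : (if p = R then coord F q (B + 1) S D v else 0) = 0 := by
    split_ifs with e
    · exact h _ _ _ _ (by rw [← e] at hN; omega)
    · rfl
  have e2 : (if conjIdx q = R then coord F (conjIdx p) (B + 1) S D v else 0) = 0 := by
    split_ifs with e
    · exact h _ _ _ _ (by rw [← e, idxParity_conjIdx] at hN; omega)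
    · rfl
  have e3 : (if q = S then coord F R B p (D + 1) v else 0) = 0 := by
    split_ifs with e
    · exact h _ _ _ _ (by rw [← e] at hN; omega)
    · rfl
  have e4 : (if conjIdx p = S then coord F R B (conjIdx q) (D + 1) v else 0) = 0 := by
    split_ifs with e
    · exact h _ _ _ _ (by rw [← e, idxParity_conjIdx] at hN; omega)
    · rfl
  rw [e1, e2, e3, e4]; ring

/-- The first product with an element of weight 3/2 lowers weight by 1/2, one unit of doubled
weight; in the odd-odd case above the drop is by two units. -/
theorem VanishesFrom.modeProd_mixed {N : ℕ} {v : DSpace (MatK F ℓ₁ ℓ₂)}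
    (h : VanishesFrom (N + 1) v) (hv : v ∈ unitSpan F ℓ₁ ℓ₂) {p q : KIdx ℓ₁ ℓ₂}
    (hp : idxParity p = 0) (hq : idxParity q = 1) :
    VanishesFrom N (modeProd F 1 (daggerElt F p 0 q 0) v) := by
  intro R B S D hN
  have hp' := d0_of_eq_zero hp
  have hq' := d0_of_eq_one hq
  rw [coord_modeProd_one_mixed hp hq hv]
  have e1 : (if p = R then coord F q (B + 1) S D v else 0) = 0 := by
    split_ifs with e
    · exact h _ _ _ _ (by rw [← e] at hN; omega)
    · rfl
  have e2 : (if conjIdx q = R then ((B : F) + 1) * coord F (conjIdx p) B S D v else 0) = 0 := by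
    split_ifs with e
    · rw [h _ _ _ _ (by rw [← e] at hN; simp only [idxParity_conjIdx] at *; omega), mul_zero]
    · rfl
  have e3 : (if q = S then ((D : F) + 1) * coord F R B p D v else 0) = 0 := by
    split_ifs with e
    · rw [h _ _ _ _ (by rw [← e] at hN; omega), mul_zero]
    · rfl
  have e4 : (if conjIdx p = S then coord F R B (conjIdx q) (D + 1) v else 0) = 0 := by
    split_ifs with e
    · exact h _ _ _ _ (by rw [← e] at hN; simp only [idxParity_conjIdx] at *; omega)
    · rfl
  rw [e1, e2, e3, e4]; ring

/-- All coordinates vanish, except those at the `unitMono F R 0 S 0` with `R`, `S` odd. -/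
def IsOddConstant (v : DSpace (MatK F ℓ₁ ℓ₂)) : Prop :=
  ∀ R B S D, ¬(idxParity R = 1 ∧ B = 0 ∧ idxParity S = 1 ∧ D = 0) → coord F R B S D v = 0

theorem IsOddConstant.modeProd {v : DSpace (MatK F ℓ₁ ℓ₂)} (h : IsOddConstant v)
    (hv : v ∈ unitSpan F ℓ₁ ℓ₂) {p q : KIdx ℓ₁ ℓ₂} (hp : idxParity p = 1)
    (hq : idxParity q = 1) : IsOddConstant (modeProd F 0 (daggerElt F p 0 q 0) v) := by
  intro R B S D h'
  have h1 : ∀ x y : KIdx ℓ₁ ℓ₂, idxParity y = 1 → y = R → coord F x B S D v = 0 :=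
    fun x y hy e => h _ _ _ _ fun h2 => h' ⟨e ▸ hy, h2.2⟩
  have h2 : ∀ x y : KIdx ℓ₁ ℓ₂, idxParity y = 1 → y = S → coord F R B x D v = 0 :=
    fun x y hy e => h _ _ _ _ fun h2 => h' ⟨h2.1, h2.2.1, e ▸ hy, h2.2.2.2⟩
  have hp' := (idxParity_conjIdx p).trans hp
  have hq' := (idxParity_conjIdx q).trans hq
  rw [coord_modeProd_zero hp hq hv, ite_eq_right_iff.2 (h1 _ _ hp), ite_eq_right_iff.2 (h1 _ _ hq'),
    ite_eq_right_iff.2 (h2 _ _ hq), ite_eq_right_iff.2 (h2 _ _ hp')]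
  ring

/-- The index pair is fixed by the twist with sign 1, so the `daggerElt` is twice a single matrix
unit: a long root vector of the symplectic Lie algebra. -/
theorem coord_modeProd_conjIdx {q : KIdx ℓ₁ ℓ₂} (hq : idxParity q = 1)
    {v : DSpace (MatK F ℓ₁ ℓ₂)} (hv : v ∈ unitSpan F ℓ₁ ℓ₂)
    (R : KIdx ℓ₁ ℓ₂) (B : ℕ) (S : KIdx ℓ₁ ℓ₂) (D : ℕ) :
    coord F R B S D (modeProd F 0 (daggerElt F (conjIdx q) 0 q 0) v) =
      2 * (if conjIdx q = R then coord F q B S D v else 0) -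
      2 * (if q = S then coord F R B (conjIdx q) D v else 0) := by
  rw [coord_modeProd_zero ((idxParity_conjIdx q).trans hq) hq hv, twistSign_conjIdx_left,
    twistSign_self_odd hq, conjIdx_conjIdx]
  ring

variable [CharZero F]

theorem RDagger_le_unitSpan : RDagger F ℓ₁ ℓ₂ ≤ unitSpan F ℓ₁ ℓ₂ :=
  RDagger_le fun p a q c => by
    rw [daggerElt_eq]
    exact add_mem (unitMono_mem _ _ _ _) (Submodule.smul_mem _ _ (unitMono_mem _ _ _ _))

theorem twist_of_mem_RDagger {v : DSpace (MatK F ℓ₁ ℓ₂)} (hv : v ∈ RDagger F ℓ₁ ℓ₂) :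
    twist (sigmaLin F) v = v := by
  have : RDagger F ℓ₁ ℓ₂ ≤ LinearMap.eqLocus (twist (sigmaLin F)) LinearMap.id :=
    RDagger_le fun p a q c => twist_symmetrize _
  exact this hv

theorem coord_conjIdx {v : DSpace (MatK F ℓ₁ ℓ₂)} (hv : v ∈ RDagger F ℓ₁ ℓ₂)
    (R : KIdx ℓ₁ ℓ₂) (B : ℕ) (S : KIdx ℓ₁ ℓ₂) (D : ℕ) :
    coord F (conjIdx S) D (conjIdx R) B v = twistSign F R S * coord F R B S D v := by
  rw [← coord_twist (RDagger_le_unitSpan hv), twist_of_mem_RDagger hv]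

/-- A nonzero ideal contains a nonzero vector killed by the first products with the
`daggerElt F p 0 q 0`, `q` odd. -/
theorem exists_lowest {I : Submodule F (DSpace (MatK F ℓ₁ ℓ₂))}
    (hI : IsConformalIdeal (dd F) (modeProd F) (RDagger F ℓ₁ ℓ₂) I) (h : I ≠ ⊥) :
    ∃ v ∈ I, v ≠ 0 ∧ ∀ p q : KIdx ℓ₁ ℓ₂, idxParity q = 1 →
      modeProd F 1 (daggerElt F p 0 q 0) v = 0 := by
  classical
  have hle : I ≤ unitSpan F ℓ₁ ℓ₂ := hI.le.trans RDagger_le_unitSpan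
  have hex : ∃ N, ∃ v ∈ I, v ≠ 0 ∧ VanishesFrom N v := by
    obtain ⟨v, hv, hv0⟩ := (Submodule.ne_bot_iff I).1 h
    obtain ⟨N, hN⟩ := exists_vanishesFrom (hle hv)
    exact ⟨N, v, hv, hv0, hN⟩
  obtain ⟨v, hv, hv0, hN⟩ := Nat.find_spec hex
  -- A bound 0 would force all coordinates of v, hence v, to vanish.
  obtain ⟨N, hN'⟩ : ∃ N, Nat.find hex = N + 1 := by
    refine Nat.exists_eq_succ_of_ne_zero fun h0 => ?_
    rw [h0] at hN
    obtain ⟨R, B, S, D, h⟩ := exists_coord_ne_zero (hle hv) hv0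
    exact h (hN _ _ _ _ (Nat.zero_le _))
  rw [hN'] at hN
  refine ⟨v, hv, hv0, fun p q hq => ?_⟩
  by_contra h0
  -- A nonzero first product would lie in the ideal with a smaller bound.
  refine Nat.find_min hex (m := N) (by omega)
    ⟨_, hI.map_Y _ (daggerElt_mem p 0 q 0) v hv 1, h0, ?_⟩
  rcases ZMod.eq_zero_or_one (idxParity p) with hp | hp
  · exact hN.modeProd_mixed (hle hv) hp hq
  · exact hN.modeProd_odd (hle hv) hp hq

section Lowest

variable {v : DSpace (MatK F ℓ₁ ℓ₂)} (hv : v ∈ RDagger F ℓ₁ ℓ₂)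
  (h : ∀ p q : KIdx ℓ₁ ℓ₂, idxParity q = 1 → modeProd F 1 (daggerElt F p 0 q 0) v = 0)

include hv h

/-- Annihilation by the elements with index pairs (t, t) and (conjIdx t, t) gives linear relations
between coordinates. They isolate the coordinate at once unless s = t, where the symmetry under the
twist is needed as well. -/
theorem coord_succ_of_lowest {t s : KIdx ℓ₁ ℓ₂} (ht : idxParity t = 1) (B D : ℕ) :
    coord F t (B + 1) s D v = 0 := by
  have hv' := RDagger_le_unitSpan hv
  have ht' : idxParity (conjIdx t) = 1 := (idxParity_conjIdx t).trans ht
  have hc := conjIdx_ne t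
  have h1 := coord_modeProd_one_odd ht ht hv' 
  have h2 := coord_modeProd_one_odd ht' ht hv'
  simp only [h _ _ ht, map_zero, twistSign_conjIdx_left, twistSign_self_odd ht, conjIdx_conjIdx,
    neg_neg, one_mul] at h1 h2
  by_cases e : s = t
  · subst e
    -- The diagonal coordinates thus depend only on B + D. The other annihilator and the twist
    -- symmetry then equate such a coordinate with its negative.
    have h3 : ∀ B D, coord F s (B + 1) s D v = coord F s B s (D + 1) v := by
      intro B D
      have := h1 s B s D
      simp only [if_true, if_neg hc] at this
      linear_combination -this
    have h4 : ∀ B D, coord F s B s D v = coord F s (B + D) s 0 v := by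
      intro B D
      induction D generalizing B with
      | zero => rfl
      | succ D ih => rw [← h3, ih, Nat.add_right_comm, Nat.add_assoc]
    have h5 := h2 (conjIdx s) B s D
    simp only [if_true] at h5
    have h6 := coord_conjIdx hv s (D + 1) s B
    rw [twistSign_self_odd ht, h4 (D + 1)] at h6
    rw [h4 (B + 1), show B + 1 + D = D + 1 + B by omega] at h5 ⊢
    have h7 : (4 : F) * coord F s (D + 1 + B) s 0 v = 0 := by linear_combination -h5 + 2 * h6
    exact (mul_eq_zero.1 h7).resolve_left (by norm_num)
  by_cases e' : s = conjIdx t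
  · subst e'
    have h5 := h2 (conjIdx t) B (conjIdx t) D
    simp only [if_true, if_neg hc.symm] at h5
    have h7 : (2 : F) * coord F t (B + 1) (conjIdx t) D v = 0 := by linear_combination -h5
    exact (mul_eq_zero.1 h7).resolve_left (by norm_num)
  · have := h1 t B s D
    simp only [if_true, if_neg hc, if_neg (Ne.symm e), if_neg (Ne.symm e')] at this
    linear_combination -this

/-- For odd s ≠ x, the coordinate at (conjIdx s, x) of the first product with the element of indices
(conjIdx p, s) is ±(B + 1) times the coordinate in question, plus, if x = p, one that vanishes by
`coord_succ_of_lowest`. -/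
theorem coord_even_of_lowest (h₂ : 0 < ℓ₂) {p : KIdx ℓ₁ ℓ₂} (hp : idxParity p = 0) (B : ℕ)
    (x : KIdx ℓ₁ ℓ₂) (D : ℕ) : coord F p B x D v = 0 := by
  have hv' := RDagger_le_unitSpan hv
  have hp' : idxParity (conjIdx p) = 0 := (idxParity_conjIdx p).trans hp
  have key : ∀ s : KIdx ℓ₁ ℓ₂, idxParity s = 1 → s ≠ x → coord F p B x D v = 0 := by
    intro s hs hx
    have hs' : idxParity (conjIdx s) = 1 := (idxParity_conjIdx s).trans hs
    have h1 := coord_modeProd_one_mixed hp' hs hv' (conjIdx s) B x D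
    have h2 : coord F (conjIdx s) B (conjIdx s) (D + 1) v = 0 := by
      rw [coord_conjIdx hv, coord_succ_of_lowest hv h hs, mul_zero]
    simp only [h _ _ hs, map_zero, conjIdx_conjIdx, if_true, if_neg hx, h2, ite_self,
      if_neg (ne_of_idxParity hp' hs'), mul_zero, zero_add, add_zero, sub_zero] at h1
    have h3 := mul_eq_zero.1 h1.symm
    refine (mul_eq_zero.1 (h3.resolve_left ?_)).resolve_left (Nat.cast_add_one_ne_zero B)
    exact left_ne_zero_of_mul_eq_one (twistSign_mul_self _ _)
  rcases ZMod.eq_zero_or_one (idxParity x) with hx | hx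
  · exact key (Sum.inr (Sum.inl ⟨0, h₂⟩)) rfl (ne_of_idxParity hx rfl).symm
  · exact key _ ((idxParity_conjIdx x).trans hx) (conjIdx_ne x)

end Lowest

theorem isOddConstant_of_lowest (h₂ : 0 < ℓ₂) {v : DSpace (MatK F ℓ₁ ℓ₂)}
    (hv : v ∈ RDagger F ℓ₁ ℓ₂) (h : ∀ p q : KIdx ℓ₁ ℓ₂, idxParity q = 1 →
      modeProd F 1 (daggerElt F p 0 q 0) v = 0) : IsOddConstant v := by
  have half : ∀ R B S D, ¬(idxParity R = 1 ∧ B = 0) → coord F R B S D v = 0 := by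
    intro R B S D h'
    rcases ZMod.eq_zero_or_one (idxParity R) with hR | hR
    · exact coord_even_of_lowest hv h h₂ hR B S D
    · obtain ⟨B, rfl⟩ := Nat.exists_eq_succ_of_ne_zero fun h0 => h' ⟨hR, h0⟩
      exact coord_succ_of_lowest hv h hR B D
  intro R B S D h'
  by_cases h1 : idxParity R = 1 ∧ B = 0
  · have h3 := half (conjIdx S) D (conjIdx R) B fun h2 =>
      h' ⟨h1.1, h1.2, (idxParity_conjIdx S).symm.trans h2.1, h2.2⟩
    rw [coord_conjIdx hv] at h3
    exact (mul_eq_zero.1 h3).resolve_left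
      (left_ne_zero_of_mul_eq_one (twistSign_mul_self _ _))
  · exact half R B S D h1

/-- With E = E_{conjIdx q, q} and E² = 0, the double bracket of v with 2E is -8 EvE, and EvE is the
(q, conjIdx q) entry of v times E. -/
theorem modeProd_modeProd_conjIdx {q : KIdx ℓ₁ ℓ₂} (hq : idxParity q = 1)
    {v : DSpace (MatK F ℓ₁ ℓ₂)} (hv : v ∈ RDagger F ℓ₁ ℓ₂) (h : IsOddConstant v) :
    modeProd F 0 (daggerElt F (conjIdx q) 0 q 0)
      (modeProd F 0 (daggerElt F (conjIdx q) 0 q 0) v) =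
      (-8 * coord F q 0 (conjIdx q) 0 v) • unitMono F (conjIdx q) 0 q 0 := by
  have hv' := modeProd_mem_RDagger (daggerElt_mem (conjIdx q) 0 q 0) hv 0
  have hv'' := modeProd_mem_RDagger (daggerElt_mem (conjIdx q) 0 q 0) hv' 0
  rw [← sub_eq_zero]
  by_contra h0
  obtain ⟨R, B, S, D, h1⟩ := exists_coord_ne_zero (sub_mem (RDagger_le_unitSpan hv'')
    (Submodule.smul_mem _ _ (unitMono_mem _ _ _ _))) h0
  refine h1 ?_
  rw [map_sub, map_smul, coord_modeProd_conjIdx hq (RDagger_le_unitSpan hv'), coord_unitMono]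
  simp only [coord_modeProd_conjIdx hq (RDagger_le_unitSpan hv), if_neg (conjIdx_ne q),
    if_neg (conjIdx_ne q).symm, smul_eq_mul]
  by_cases h2 : conjIdx q = R
  · by_cases h3 : q = S
    · by_cases h4 : 0 = B
      · by_cases h5 : 0 = D
        · subst h2 h3 h4 h5; simp [factCoeff]; ring
        · rw [h q B (conjIdx q) D fun h' => h5 h'.2.2.2.symm]; simp [factCoeff, h5]
      · rw [h q B (conjIdx q) D fun h' => h4 h'.2.1.symm]; simp [factCoeff, h4]
    · simp [h3]
  · simp [h2]

theorem exists_unitMono_mem (h₂ : 0 < ℓ₂) {I : Submodule F (DSpace (MatK F ℓ₁ ℓ₂))}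
    (hI : IsConformalIdeal (dd F) (modeProd F) (RDagger F ℓ₁ ℓ₂) I) (h : I ≠ ⊥) :
    ∃ q : KIdx ℓ₁ ℓ₂, idxParity q = 1 ∧ unitMono F (conjIdx q) 0 q 0 ∈ I := by
  obtain ⟨v, hv, hv0, hlow⟩ := exists_lowest hI h
  have hvR := hI.le hv
  have hc := isOddConstant_of_lowest h₂ hvR hlow
  obtain ⟨t, B, s, D, hts⟩ := exists_coord_ne_zero (RDagger_le_unitSpan hvR) hv0
  obtain ⟨ht, rfl, hs, rfl⟩ := not_not.1 (mt (hc t B s D) hts)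
  have hs' := (idxParity_conjIdx s).trans hs
  have hw := hI.map_Y _ (daggerElt_mem (conjIdx s) 0 t 0) v hv 0
  have hwc := hc.modeProd (RDagger_le_unitSpan hvR) hs' ht
  -- One zeroth product moves the nonzero entry from (t, s) to (conjIdx s, s), where the double
  -- bracket detects it. By the twist symmetry the contributions add up, to 4 times the entry if t =
  -- s and 2 times otherwise.
  have hcw : coord F (conjIdx s) 0 s 0 (modeProd F 0 (daggerElt F (conjIdx s) 0 t 0) v) ≠ 0 := by
    have h1 := coord_conjIdx hvR t 0 s 0
    rw [coord_modeProd_zero hs' ht (RDagger_le_unitSpan hvR), conjIdx_conjIdx,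
      twistSign_conjIdx_left, if_pos rfl, if_pos rfl, h1, twistSign_comm s t]
    by_cases e : t = s
    · subst e
      rw [if_pos rfl, if_pos rfl, h1, twistSign_self_odd ht]
      convert mul_ne_zero (by norm_num : (4 : F) ≠ 0) hts using 1
      ring
    · rw [if_neg e, if_neg (by rwa [conjIdx_eq_iff, conjIdx_conjIdx])]
      convert mul_ne_zero (by norm_num : (2 : F) ≠ 0) hts using 1
      linear_combination coord F t 0 s 0 v * twistSign_mul_self (F := F) t s
  refine ⟨conjIdx s, hs', ?_⟩
  have h3 := modeProd_modeProd_conjIdx hs' (hI.le hw) hwc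
  rw [conjIdx_conjIdx] at h3 ⊢
  refine (I.smul_mem_iff (mul_ne_zero (by norm_num : (-8 : F) ≠ 0) hcw)).1 ?_
  rw [← h3]
  have h4 := daggerElt_mem (F := F) s 0 (conjIdx s) 0
  exact hI.map_Y _ h4 _ (hI.map_Y _ h4 _ hw 0) 0

theorem RDagger_isConformallySimple (h₁ : 0 < ℓ₁) (h₂ : 0 < ℓ₂) :
    IsConformallySimple (dd F) (modeProd F) (RDagger F ℓ₁ ℓ₂) := by
  intro I hI
  refine or_iff_not_imp_left.2 fun h => le_antisymm hI.le ?_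
  obtain ⟨q, hq, hqI⟩ := exists_unitMono_mem h₂ hI h
  have hq' := (idxParity_conjIdx q).trans hq
  have hd := d0_of_eq_one hq
  have hd' := d0_of_eq_one hq'
  refine RDagger_le_of_forall_mem h₁ h₂ (fun u hu v hv n => hI.map_Y u (hI.le hu) v hv n) ?_
  intro p s a hp hs
  -- The first and fourth terms of this zeroth product are the two halves of the `daggerElt`.
  have E1 : daggerElt F p 0 q 0 ∈ I := by
    have := hI.map_Y _ (daggerElt_mem p 0 (conjIdx q) 0) _ hqI 0
    rw [modeProd_daggerElt_unitMono, if_pos rfl, conjIdx_conjIdx, if_pos rfl,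
      if_neg (ne_of_idxParity hp hq),
      if_neg (ne_of_idxParity ((idxParity_conjIdx p).trans hp) hq'),
      twistSign_conjIdx_right, hq, hq', show (1 + 1 : ZMod 2) = 0 from rfl, superSign_comm,
      superSign_zero_left] at this
    rw [daggerElt_eq]
    simpa [d0] using this
  have third : ∀ t, idxParity t = 1 → daggerElt F p 0 t 0 ∈ I → s ≠ conjIdx t →
      daggerElt F p 0 s a ∈ I := by
    intro t ht hI' hst
    have hdt := d0_of_eq_one ht
    have := mem_of_modeProd_third (hI.map_Y _ (daggerElt_mem t 0 s a) _ hI' 0) (by omega)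
      (fun e => absurd e.symm (ne_of_idxParity hp hs))
      (fun e => absurd e.symm (ne_of_idxParity hp ((idxParity_conjIdx t).trans ht)))
      (fun e => absurd ((conjIdx_eq_iff).1 e) hst)
    simpa [hdt] using this
  by_cases e : s = conjIdx q
  -- In the excluded case, q is first replaced by its conjugate by a zeroth product. There the third
  -- and fourth terms coincide, giving the factor -2.
  · refine third (conjIdx q) hq' ?_ (by rw [e, conjIdx_conjIdx]; exact conjIdx_ne q)
    have := hI.map_Y _ (daggerElt_mem q 0 (conjIdx q) 0) _ E1 0
    rw [modeProd_daggerElt, if_pos rfl, conjIdx_conjIdx, if_pos rfl,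
      if_neg (ne_of_idxParity hp hq').symm, if_neg (ne_of_idxParity hp hq').symm,
      twistSign_conjIdx_right, twistSign_self_odd hq, hq, hq',
      show (1 + 1 : ZMod 2) = 0 from rfl, superSign_zero_left] at this
    refine mem_of_zsmul_mem (F := F) (c := -2) (by norm_num) ?_
    simpa [d0, two_smul, sub_eq_add_neg] using this
  · exact third q hq E1 e

end Simplicity

theorem theorem4p3 (F : Type*) [Field F] [CharZero F] (ℓ₁ ℓ₂ : ℕ) (h₁ : 0 < ℓ₁) (h₂ : 0 < ℓ₂) :
    (∀ s, RDaggerPart F ℓ₁ ℓ₂ s ≤ RPart F (matGrading F ℓ₁ ℓ₂) s) ∧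
    IsConformalSuperalgebra (dd F) (modeProd F) (RDaggerPart F ℓ₁ ℓ₂) ∧
    IsConformallySimple (dd F) (modeProd F) (RDagger F ℓ₁ ℓ₂) ∧
    (4 < 2 * ℓ₁ + 2 * ℓ₂ →
      IsGeneratedBy (modeProd F) (RDagger F ℓ₁ ℓ₂) (RDaggerWeight F ℓ₁ ℓ₂ (3 / 2))) ∧
    (2 * ℓ₁ + 2 * ℓ₂ = 4 →
      IsGeneratedBy (modeProd F) (RDagger F ℓ₁ ℓ₂)
        (RDaggerWeight F ℓ₁ ℓ₂ (3 / 2) ⊔ Submodule.span F {extraElt F ℓ₁ ℓ₂ h₂} :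
          Submodule F (DSpace (MatK F ℓ₁ ℓ₂)))) :=
  ⟨RDaggerPart_le_RPart, RDaggerPart_isConformalSuperalgebra, RDagger_isConformallySimple h₁ h₂,
    isGeneratedBy_of_four_lt h₁ h₂, isGeneratedBy_of_eq_four h₁ h₂⟩
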